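/- Conventions. $\Gamma_F=\mathrm{Aut}(F^{\mathrm{alg}}/F)$ denotes the absolute Galois group of a field $F$ with its Krull topology. A profinite group $\Gamma$ has \emph{enough automorphisms} if for every finite group $G$, every automorphism $\alpha$ of $G$ and all continuous surjective homomorphisms $f,g:\Gamma\to G$ there is a topological automorphism $\beta$ of $\Gamma$ with $g\circ\beta=\alpha\circ f$. Let $K$ be a field of one of the following two types, with associated Dedekind scheme $C$ over a valued field $k$: (a) $K$ is the function field of an integral smooth projective curve $C$ over a henselian valued field $k$ such that $\Gamma_k$ has enough automorphisms; (b) $K$ is a finite extension of $k_0((x,y))=\mathrm{Frac}(k_0[[x,y]])$, where $k_0$ is a perfect field such that $\Gamma_{k_0}\times\widehat{\mathbf Z}$ has enough automorphisms; here $k=k_0((x))$ with its $x$-adic valuation and $C=\mathrm{Spec}\,A[x^{-1}]$, where $A$ is the integral closure of $k_0[[x,y]]$ in $K$. A closed point $v$ of $C$ defines a place of $K$ with valuation ring $\mathcal O_{C,v}$; let $K_v$ be the completion of $K$ at it and $k(v)$ the residue field, a finite extension of $k$, topologized as a finite-dimensional $k$-vector space. Let $C(k(v))$ be the set of $k$-morphisms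 $\mathrm{Spec}\,k(v)\to C$. For $V\subseteq C$ affine open, $V(k(v))$ has the coarsest topology for which all functions $V(k(v))\to k(v)$ induced by sections of $\mathcal O_C(V)$ are continuous, and $C(k(v))$ has the topology glued from these. The point $v$ is an element of $C(k(v))$, and every $w\in C(k(v))$ has as its image a closed point of $C$, hence defines a place of $K$ and a completion $K_w$. Theorem. Let $L/K$ be a finite Galois extension and let $v$ be a closed point of $C$ whose place is unramified in $L/K$. Then there is an open neighbourhood $U$ of $v$ in $C(k(v))$ such that for every $w\in U$ (and every choice of $K$-embeddings $L\to K^{\mathrm{alg}}$, $K^{\mathrm{alg}}\to K_v^{\mathrm{alg}}$ and $K^{\mathrm{alg}}\to K_w^{\mathrm{alg}}$, which define the maps $\Gamma_K\to\mathrm{Gal}(L/K)$, $\Gamma_{K_v}\to\Gamma_K$ and $\Gamma_{K_w}\to\Gamma_K$) there are an isomorphism of topological groups $\phi_{v,w}:\Gamma_{K_v}\to\Gamma_{K_w}$ and an element $\rho_w\in\Gamma_K$ such that for every $s\in\Gamma_{K_v}$ the elements $\phi_{v,w}(s)$ and $\rho_w s\rho_w^{-1}$ have the same image in $\mathrm{Gal}(L/K)$.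 -/

import Mathlib

open AlgebraicGeometry CategoryTheory

universe u v w

noncomputable section

namespace Reocurrence

/-! ### Profinite groups with enough automorphisms -/

/-- A topological group `Γ` has *enough automorphisms* if for every finite (discrete) group `G`,
every automorphism `α` of `G` and all continuous surjections `f, g : Γ → G` there is a topological
automorphism `β` of `Γ` with `g ∘ β = α ∘ f`.  (Every finite group is isomorphic to one in
`Type`, so letting `G` range over `Type` is no restriction.) -/
def EnoughAutomorphisms (Γ : Type*) [Group Γ] [TopologicalSpace Γ] : Prop :=
  ∀ (G : Type) [Group G] [Finite G] [TopologicalSpace G] [DiscreteTopology G]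
    (α : G ≃* G) (f g : Γ →* G), Continuous f → Continuous g →
    Function.Surjective f → Function.Surjective g →
    ∃ β : Γ ≃ₜ* Γ, ∀ x, g (β x) = α (f x)

/-- The additive group `Ẑ = lim ℤ/n` of profinite integers: compatible families in `∏ ℤ/n`,
`n ≥ 1`, with the topology induced by the product of the discrete topologies. -/
def ZHat : AddSubgroup (∀ n : ℕ+, ZMod n) where
  carrier := {x | ∀ (m n : ℕ+) (h : (m : ℕ) ∣ n), ZMod.castHom h (ZMod m) (x n) = x m}
  zero_mem' := fun m n h => by simp
  add_mem' := fun {a b} ha hb m n h => by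
    rw [Pi.add_apply, Pi.add_apply, map_add, ha m n h, hb m n h]
  neg_mem' := fun {a} ha m n h => by
    rw [Pi.neg_apply, Pi.neg_apply, map_neg, ha m n h]

/-! ### Restriction maps between Galois groups -/

/-- For a normal extension `M/K` and a `K`-embedding `i : M → Ω`, where `Ω` is an extension of
`K' ⊇ K`: the restriction homomorphism `Gal(Ω/K') → Gal(M/K)` along `i`. -/
def restrictAlong {K M K' Ω : Type*} [Field K] [Field M] [Field K'] [Field Ω]
    [Algebra K M] [Normal K M] [Algebra K K'] [Algebra K' Ω] [Algebra K Ω] [IsScalarTower K K' Ω]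
    (i : M →ₐ[K] Ω) : (Ω ≃ₐ[K'] Ω) →* (M ≃ₐ[K] M) :=
  letI : Algebra M Ω := i.toRingHom.toAlgebra
  haveI : IsScalarTower K M Ω := IsScalarTower.of_algebraMap_eq fun x => (i.commutes x).symm
  (AlgEquiv.restrictNormalHom M).comp (AlgEquiv.restrictScalarsHom K)

/-- The characterization of `restrictAlong`: it is the unique map with `i (σ|_M a) = σ (i a)`. -/
theorem apply_restrictAlong {K M K' Ω : Type*} [Field K] [Field M] [Field K'] [Field Ω]
    [Algebra K M] [Normal K M] [Algebra K K'] [Algebra K' Ω] [Algebra K Ω] [IsScalarTower K K' Ω]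
    (i : M →ₐ[K] Ω) (σ : Ω ≃ₐ[K'] Ω) (a : M) : i (restrictAlong i σ a) = σ (i a) := by
  let _ : Algebra M Ω := i.toRingHom.toAlgebra
  have : IsScalarTower K M Ω := IsScalarTower.of_algebraMap_eq fun x => (i.commutes x).symm
  exact AlgEquiv.restrictNormal_commutes (AlgEquiv.restrictScalars K σ) M a

/-- The map `Γ_{K'} → Γ_K` of absolute Galois groups defined by a `K`-embedding
`K^alg → K'^alg`. -/
def absGaloisMap {K K' : Type*} [Field K] [Field K'] [Algebra K K']
    (i : AlgebraicClosure K →ₐ[K] AlgebraicClosure K') :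
    Field.absoluteGaloisGroup K' →* Field.absoluteGaloisGroup K :=
  restrictAlong (K' := K') i

/-- The map `Γ_K → Gal(L/K)` for a normal extension `L/K` embedded in `K^alg` by `j`. -/
def toGal {K L : Type*} [Field K] [Field L] [Algebra K L] [Normal K L]
    (j : L →ₐ[K] AlgebraicClosure K) : Field.absoluteGaloisGroup K →* (L ≃ₐ[K] L) :=
  restrictAlong (K' := K) j

/-! ### Rational points of a `k`-scheme with values in a topological field -/

section Points

variable {k : Type u} [Field k] {X : Scheme.{u}} (π : X ⟶ Spec (.of k))

/-- `X(ℓ)`: the `k`-morphisms `Spec ℓ ⟶ X`. -/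
def Points (ℓ : Type u) [Field ℓ] [Algebra k ℓ] : Type u :=
  {p : Spec (.of ℓ) ⟶ X // p ≫ π = Spec.map (CommRingCat.ofHom (algebraMap k ℓ))}

variable {π} {ℓ : Type u} [Field ℓ] [Algebra k ℓ]

/-- The point of the scheme underlying `p ∈ X(ℓ)`. -/
def Points.pt (p : Points π ℓ) : X := p.1 (IsLocalRing.closedPoint ℓ)

/-- `p ∈ X(ℓ)` lies in `V(ℓ)`. -/
def Points.LiesIn (p : Points π ℓ) (V : X.Opens) : Prop := ⊤ ≤ p.1 ⁻¹ᵁ V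

/-- The value `f(p) ∈ ℓ` of a section `f ∈ Γ(V, 𝒪_X)` at `p ∈ V(ℓ)`. -/
def Points.eval (p : Points π ℓ) (V : X.Opens) (h : p.LiesIn V) (f : Γ(X, V)) : ℓ :=
  (Scheme.ΓSpecIso (.of ℓ)).hom (p.1.appLE V ⊤ h f)

variable (π ℓ) in
/-- For `V` open in `X`: the coarsest topology on `V(ℓ)` for which all functions `V(ℓ) → ℓ`
induced by sections of `𝒪_X` over `V` are continuous. -/
abbrev sectionTopology [TopologicalSpace ℓ] (V : X.Opens) :
    TopologicalSpace {p : Points π ℓ // p.LiesIn V} :=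
  ⨅ f : Γ(X, V), TopologicalSpace.induced (fun p => p.1.eval V p.2 f) inferInstance

/-- The topology on `X(ℓ)` glued from the topologies of the `V(ℓ)`, `V ⊆ X` affine open:
a subset of `X(ℓ)` is open iff its intersection with every `V(ℓ)` is open. -/
instance [TopologicalSpace ℓ] : TopologicalSpace (Points π ℓ) :=
  ⨆ V : X.affineOpens, TopologicalSpace.coinduced Subtype.val (sectionTopology π ℓ V.1)

/-- The residue field `k(v)` of a `k`-scheme at a point `v`, as an extension of `k`. -/
def ResidueField (_π : X ⟶ Spec (.of k)) (v : X) : Type u := X.residueField v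

instance (v : X) : Field (ResidueField π v) := inferInstanceAs (Field (X.residueField v))

instance (v : X) : Algebra k (ResidueField π v) :=
  (Spec.preimage (X.fromSpecResidueField v ≫ π)).hom.toAlgebra

/-- For a topological field `k`, the field `k(v)` carries the topology of a `k`-vector space: for
`[k(v) : k] = n < ∞` this is the product topology of `k^n` for any choice of basis. -/
instance [TopologicalSpace k] (v : X) : TopologicalSpace (ResidueField π v) :=
  moduleTopology k (ResidueField π v)

variable (π) in
/-- A point `v` of `X`, viewed as an element of `X(k(v))`. -/
def tautPoint (v : X) : Points π (ResidueField π v) :=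
  ⟨X.fromSpecResidueField v, (Spec.map_preimage (X.fromSpecResidueField v ≫ π)).symm⟩

theorem tautPoint_pt (v : X) : (tautPoint π v).pt = v :=
  X.fromSpecResidueField_apply v _

end Points

/-! ### Places of a function field -/

section Places

variable {C : Scheme.{u}} [IsIntegral C] {K : Type u} [Field K] (e : C.functionField ≃+* K)

/-- The local ring `𝒪_{C,v}`, as a subring of the function field `K` of `C`. -/
def localRing (v : C) : LocalSubring K :=
  LocalSubring.range (e.toRingHom.comp (algebraMap (C.presheaf.stalk v) C.functionField))

/-- The place of `K` defined by `v`, given by its valuation ring: a valuation ring of `K` which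
dominates `𝒪_{C,v}`.  At a closed point of a Dedekind scheme the local ring `𝒪_{C,v}` is itself a
(discrete) valuation ring and then, by `place_eq`, the place is `𝒪_{C,v}`. -/
def place (v : C) : ValuationSubring K :=
  (localRing e v).exists_le_valuationSubring.choose

theorem place_eq (v : C) (V : ValuationSubring K) (hV : V.toLocalSubring = localRing e v) :
    place e v = V := by
  have h := (localRing e v).exists_le_valuationSubring.choose_spec
  have h' : V.toLocalSubring ≤ (place e v).toLocalSubring := by rw [hV]; exact h
  exact (ValuationSubring.toLocalSubring_injective
    (le_antisymm h' (V.isMax_toLocalSubring h'))).symm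

/-- `K_v`: the completion of `K` at the place `v`. -/
def Completion (v : C) : Type u := (place e v).valuation.Completion

instance (v : C) : Field (Completion e v) :=
  inferInstanceAs (Field (place e v).valuation.Completion)

instance (v : C) : Algebra K (Completion e v) :=
  ((UniformSpace.Completion.coeRingHom : WithVal (place e v).valuation →+* _).comp
    (WithVal.equiv (place e v).valuation).symm.toRingHom).toAlgebra

/-- A place of `K`, given by its valuation ring `V`, is unramified in the extension `L/K` if the
integral closure of `V` in `L` is unramified over `V` at all maximal ideals, i.e. at all places of
`L` above the given one. -/
def IsUnramifiedIn (V : ValuationSubring K) (L : Type v) [Field L] [Algebra K L] : Prop :=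
  ∀ (Q : Ideal (integralClosure V L)) [Q.IsMaximal], Algebra.IsUnramifiedAt V Q

end Places

/-! ### The reocurrence property -/

/-- Let `C` be an integral scheme over a topological field `k`, with function field `K` and a
point `v`, and let `L/K` be a finite Galois extension.  The property: there is an open
neighbourhood `U` of `v` in `C(k(v))` such that for all `w ∈ U` there are an isomorphism of
topological groups `φ : Γ_{K_v} → Γ_{K_w}` and `ρ ∈ Γ_K` such that `φ s` and `ρ s ρ⁻¹` have the
same image in `Gal(L/K)` for every `s ∈ Γ_{K_v}`.  Here `j`, `iv`, `iw` are arbitrary choices of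
the embeddings which define the maps `Γ_K → Gal(L/K)`, `Γ_{K_v} → Γ_K` and `Γ_{K_w} → Γ_K`. -/
def ReocursAt {k : Type u} [Field k] [TopologicalSpace k] {C : Scheme.{u}} [IsIntegral C]
    (π : C ⟶ Spec (.of k)) {K : Type u} [Field K] (e : C.functionField ≃+* K)
    (L : Type v) [Field L] [Algebra K L] [Normal K L] (v : C) : Prop :=
  ∃ U : Set (Points π (ResidueField π v)), IsOpen U ∧ tautPoint π v ∈ U ∧ ∀ w ∈ U,
    ∀ (j : L →ₐ[K] AlgebraicClosure K)
      (iv : AlgebraicClosure K →ₐ[K] AlgebraicClosure (Completion e v))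
      (iw : AlgebraicClosure K →ₐ[K] AlgebraicClosure (Completion e w.pt)),
    ∃ (φ : Field.absoluteGaloisGroup (Completion e v) ≃ₜ*
          Field.absoluteGaloisGroup (Completion e w.pt))
      (ρ : Field.absoluteGaloisGroup K),
      ∀ s, toGal j (absGaloisMap iw (φ s)) = toGal j (ρ * absGaloisMap iv s * ρ⁻¹)

/-! ### Finite extensions of `k₀((x, y))` -/

/-- The canonical isomorphism (of `R`-algebras) between the function field of `Spec R` and a
given fraction field `K` of `R`. -/
def affineFunctionField (R : CommRingCat.{u}) [IsDomain R] (K : Type u) [Field K] [Algebra R K]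
    [IsFractionRing R K] : (Spec R).functionField ≃+* K :=
  (IsLocalization.algEquiv (nonZeroDivisors R) (Spec R).functionField K).toRingEquiv

section Laurent

variable (k₀ : Type u) [Field k₀]

/-- `k₀[[x, y]]`; the variables are `x = X 0` and `y = X 1`. -/
abbrev PowerSeriesXY : Type u := MvPowerSeries (Fin 2) k₀

/-- `k₀((x, y))`, the fraction field of `k₀[[x, y]]`. -/
abbrev LaurentXY : Type u := FractionRing (PowerSeriesXY k₀)

instance : IsDomain (PowerSeriesXY k₀) := NoZeroDivisors.to_isDomain _

variable (K : Type u) [Field K] [Algebra (PowerSeriesXY k₀) K] [Algebra (LaurentXY k₀) K]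
  [IsScalarTower (PowerSeriesXY k₀) (LaurentXY k₀) K]

/-- The integral closure `A` of `k₀[[x, y]]` in `K`. -/
abbrev IntClosure : Type u := integralClosure (PowerSeriesXY k₀) K

/-- The element `x` of `A`. -/
def elemX : IntClosure k₀ K := algebraMap (PowerSeriesXY k₀) _ (MvPowerSeries.X 0)

theorem powers_elemX_le :
    Submonoid.powers (elemX k₀ K) ≤ nonZeroDivisors (IntClosure k₀ K) := by
  refine powers_le_nonZeroDivisors_of_noZeroDivisors fun h => ?_
  have hinj : Function.Injective (algebraMap (PowerSeriesXY k₀) K) := by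
    rw [IsScalarTower.algebraMap_eq (PowerSeriesXY k₀) (LaurentXY k₀) K]
    exact (algebraMap (LaurentXY k₀) K).injective.comp
      (IsFractionRing.injective (PowerSeriesXY k₀) (LaurentXY k₀))
  have h0 : algebraMap (PowerSeriesXY k₀) K (MvPowerSeries.X 0) = 0 :=
    congrArg Subtype.val h
  rw [map_eq_zero_iff _ hinj] at h0
  have := congrArg (MvPowerSeries.coeff (Finsupp.single (0 : Fin 2) 1)) h0
  simp [MvPowerSeries.coeff_X] at this

variable [FiniteDimensional (LaurentXY k₀) K]

instance : IsFractionRing (IntClosure k₀ K) K :=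
  integralClosure.isFractionRing_of_finite_extension (LaurentXY k₀) K

/-- The ring `A[x⁻¹]`, as a subring of `K`. -/
abbrev InvX : Type u :=
  Localization.subalgebra K (Submonoid.powers (elemX k₀ K)) (powers_elemX_le k₀ K)

/-- The structure of `k₀((x))`-algebra on `A[x⁻¹]`: the unique extension of the composition
`k₀[[x]] → k₀[[x, y]] → A → A[x⁻¹]`. -/
def laurentToInvX : LaurentSeries k₀ →+* InvX k₀ K :=
  IsLocalization.lift (M := Submonoid.powers (PowerSeries.X : PowerSeries k₀))
    (g := ((algebraMap (IntClosure k₀ K) (InvX k₀ K)).comp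
      (algebraMap (PowerSeriesXY k₀) (IntClosure k₀ K))).comp
        (PowerSeries.toMvPowerSeries (0 : Fin 2) : PowerSeries k₀ →ₐ[k₀] _).toRingHom) (by
    rintro ⟨_, n, rfl⟩
    have : IsUnit (algebraMap (IntClosure k₀ K) (InvX k₀ K) (elemX k₀ K)) :=
      IsLocalization.map_units (InvX k₀ K)
        (⟨elemX k₀ K, Submonoid.mem_powers _⟩ : Submonoid.powers (elemX k₀ K))
    simpa [elemX] using this.pow n)

/-- The Dedekind scheme `C = Spec A[x⁻¹]`. -/
def dedekindScheme : Scheme.{u} := Spec (.of (InvX k₀ K))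

instance : IsIntegral (dedekindScheme k₀ K) :=
  inferInstanceAs (IsIntegral (Spec (.of (InvX k₀ K))))

/-- `C` as a scheme over `k = k₀((x))`. -/
def dedekindSchemeHom : dedekindScheme k₀ K ⟶ Spec (.of (LaurentSeries k₀)) :=
  Spec.map (CommRingCat.ofHom (laurentToInvX k₀ K))

/-- The canonical identification of the function field of `C` with `K`. -/
def dedekindFunctionField : (dedekindScheme k₀ K).functionField ≃+* K :=
  affineFunctionField (.of (InvX k₀ K)) K

end Laurent

end Reocurrence

end

noncomputable section

namespace Reocurrence

section

/-! ### Uniqueness of extensions of henselian valuations -/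

/-! The fields K_v and K_w are compared through their residue fields, and the two maps to Gal(L/K)
through the reductions of a well-chosen element of L.

A point w of C(k(v)) embeds k(w) in k(v). If w is close to v, then finitely many functions whose
values at v form a k-basis of k(v) have nearby values at w, and Krasner's lemma shows that k(v) is
purely inseparable over k(w) (`exists_isOpen_forall_purelyInseparable`). The completions have equal
characteristic, so after choosing coefficient fields and uniformizers they are fields of Laurent
series over k(v) and k(w). Hence k(w) → k(v) lifts to an embedding K_w → K_v whose image contains
all p^n-th powers (`exists_completion_lift`). A purely inseparable extension does not change the
absolute Galois group (`exists_autEquiv_of_pow_mem_range`), and this gives φ.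

For the compatibility with L, unramifiedness yields θ in L, integral over the valuation ring of v,
such that θ and τθ have different reductions at a chosen place above v for every τ ≠ 1
(`exists_separating_element`). With F = ∏ (X - τθ), interpolation gives polynomials g_σ over the
base such that σθ = g_σ(θ)/F'(θ). So the labelling of the roots of the reduced F by Gal(L/K) depends
continuously on the coefficients and on one simple root. After a change of the place above w by some
σ₁, every root at w is close to the root at v with the same label. Elements of Γ_{K_v} act on the
residue field of K_v^alg, an algebraic closure of k, by isometries, because the valuation of k is
henselian (`valuation_apply_of_henselian`). Therefore an element that acts as σ on the roots at v
must act as σ on those at w (`exists_isOpen_forall_conj`); the changes of embedding account for ρ.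

All that is needed of C is that k(v) is finite over k and that the local rings at the images of the
points of C(k(v)) are discrete valuation rings (`reocursAt_of_isDiscreteValuationRing`). A smooth
curve is locally étale over the affine line; for k₀[[x, y]] both facts come from Weierstrass
division in k₀[[x]][[y]]. -/

theorem exists_pow_mem_range_of_forall_aut {k M : Type*} [Field k] [Field M] [Algebra k M]
    [Normal k M] (q : ℕ) [ExpChar k q] (c : M) (h : ∀ σ : M ≃ₐ[k] M, σ c = c) :
    ∃ n, c ^ q ^ n ∈ (algebraMap k M).range := by
  classical
  have hc : IsIntegral k c := Normal.isIntegral ‹_› c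
  -- An element fixed by all automorphisms is the only root of its minimal polynomial, so the
  -- separable degree is one.
  rw [← minpoly.natSepDegree_eq_one_iff_pow_mem,
    Polynomial.natSepDegree_eq_of_splits _ (Normal.splits ‹_› c), Finset.card_eq_one]
  refine ⟨c, ?_⟩
  ext z
  simp only [Multiset.mem_toFinset, Finset.mem_singleton, Polynomial.mem_aroots]
  constructor
  · rintro ⟨_, hz⟩
    obtain ⟨σ, hσ⟩ := minpoly.exists_algEquiv_of_root' hc.isAlgebraic hz
    rw [← hσ, h]
  · rintro rfl
    exact ⟨minpoly.ne_zero hc, minpoly.aeval ..⟩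

/-- An algebraic element over the fraction field of a valuation ring is a root of a polynomial
over the valuation ring with some coefficient equal to `1`. -/
theorem exists_primitive_aeval_eq_zero {k Ω : Type*} [Field k] [Field Ω] [Algebra k Ω]
    (O : ValuationSubring k) {y : Ω} (hy : IsAlgebraic k y) :
    ∃ P : Polynomial O, (∃ i, P.coeff i = 1) ∧
      P.eval₂ ((algebraMap k Ω).comp O.subtype) y = 0 := by
  obtain ⟨p, hp0, hp⟩ := hy
  obtain ⟨j, hj, hmax⟩ := Finset.exists_max_image p.support (fun i => O.valuation (p.coeff i))
    (by simpa using hp0)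
  have hj0 : p.coeff j ≠ 0 := by simpa using hj
  have hlift : Polynomial.C (p.coeff j)⁻¹ * p ∈ Polynomial.lifts O.subtype := by
    rw [Polynomial.lifts_iff_coeff_lifts]
    intro n
    have hn : O.valuation ((p.coeff j)⁻¹ * p.coeff n) ≤ 1 := by
      by_cases hn : n ∈ p.support
      · rw [map_mul, map_inv₀]
        exact inv_mul_le_one_of_le₀ (hmax n hn) zero_le
      · simp [Polynomial.notMem_support_iff.mp hn]
    exact ⟨⟨_, (O.valuation_le_one_iff _).mp hn⟩, by simp⟩
  obtain ⟨P, hP⟩ := (Polynomial.mem_lifts _).mp hlift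
  refine ⟨P, ⟨j, ?_⟩, ?_⟩
  · apply O.subtype_injective
    have := congrArg (fun f => Polynomial.coeff f j) hP
    simpa [hj0] using this
  · rw [← Polynomial.eval₂_map, hP, Polynomial.eval₂_mul]
    exact mul_eq_zero_of_right _ hp

/-- The integral closure is an intersection of valuation rings; this form lets integrality be
checked through the dichotomy between an element and its inverse. -/
theorem isIntegral_of_forall_valuationSubring {O Ω : Type*} [CommRing O] [Field Ω] [Algebra O Ω]
    {x : Ω} (h : ∀ V : ValuationSubring Ω, (∀ o : O, algebraMap O Ω o ∈ V) → x ∈ V) :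
    IsIntegral O x := by
  have h1 : x ∈ (⨅ V : {V : ValuationSubring Ω // Set.range (algebraMap O Ω) ⊆ V.toSubring},
      V.1.toSubring : Subring Ω) := by
    rw [Subring.mem_iInf]
    exact fun V => h V.1 fun o => V.2 ⟨o, rfl⟩
  rw [iInf_valuationSubring_superset] at h1
  have h2 : IsIntegral (Subring.closure (Set.range (algebraMap O Ω))) x := h1
  obtain ⟨p, hp, hpx⟩ := h2
  have hcl : Subring.closure (Set.range (algebraMap O Ω)) = (algebraMap O Ω).range := by
    rw [← RingHom.coe_range, Subring.closure_eq]
  have hpl : p.map (algebraMap (Subring.closure (Set.range (algebraMap O Ω))) Ω) ∈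
      Polynomial.lifts (algebraMap O Ω) := by
    rw [Polynomial.lifts_iff_coeff_lifts]
    intro n
    rw [Polynomial.coeff_map]
    exact hcl.le (p.coeff n).2
  obtain ⟨P, hP, -, hPm⟩ := Polynomial.lifts_and_degree_eq_and_monic hpl (hp.map _)
  refine ⟨P, hPm, ?_⟩
  rw [← Polynomial.eval_map, hP, Polynomial.eval_map, hpx]

theorem mem_valuationSubring_of_isIntegral {O Ω : Type*} [CommRing O] [Field Ω] [Algebra O Ω]
    (W : ValuationSubring Ω) (hW : ∀ o : O, algebraMap O Ω o ∈ W) {x : Ω} (hx : IsIntegral O x) :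
    x ∈ W := by
  obtain ⟨p, hp, hpx⟩ := hx
  have : IsIntegral W x := by
    refine ⟨p.map ((algebraMap O Ω).codRestrict W hW), hp.map _, ?_⟩
    rw [Polynomial.eval₂_map]
    exact hpx
  obtain ⟨z, hz⟩ := IsIntegrallyClosed.algebraMap_eq_of_integral (R := W) (K := Ω) this
  rw [← hz]; exact z.2

/-- A valuation ring `W` above `O` is a localization of the integral closure of `O`. -/
theorem exists_isIntegral_mul_eq {k Ω : Type*} [Field k] [Field Ω] [Algebra k Ω]
    (O : ValuationSubring k) (W : ValuationSubring Ω) (hW : ∀ x ∈ O, algebraMap k Ω x ∈ W)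
    {y : Ω} (hy : IsAlgebraic k y) (hyW : y ∈ W) :
    ∃ b c : Ω, IsIntegral O b ∧ IsIntegral O c ∧ W.valuation c = 1 ∧ c * y = b := by
  obtain ⟨P, ⟨j, hj⟩, hP⟩ := exists_primitive_aeval_eq_zero O hy
  set f : O →+* Ω := (algebraMap k Ω).comp O.subtype with hf
  have hfalg : f = algebraMap O Ω := rfl
  -- tails of the polynomial
  let t : ℕ → Ω := fun i => ∑ m ∈ Finset.range (P.natDegree + 1 - i), f (P.coeff (i + m)) * y ^ m
  have hrec : ∀ i, i ≤ P.natDegree → t i = f (P.coeff i) + t (i + 1) * y := by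
    intro i hi
    have : P.natDegree + 1 - i = (P.natDegree + 1 - (i + 1)) + 1 := by omega
    simp only [t]
    rw [this, Finset.sum_range_succ', Finset.sum_mul, add_comm]
    simp only [add_zero, pow_zero, mul_one]
    congr 1
    refine Finset.sum_congr rfl fun m _ => ?_
    rw [show i + (m + 1) = i + 1 + m by ring, pow_succ, mul_assoc]
  have htop : t (P.natDegree + 1) = 0 := by simp [t]
  have h0 : t 0 = 0 := by
    rw [Polynomial.eval₂_eq_sum_range] at hP
    simpa [t] using hP
  have hint : ∀ i, i ≤ P.natDegree + 1 → IsIntegral O (t i) := by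
    intro i hi
    -- If `y ∈ V`, the defining sum lies in `V`. Otherwise `y⁻¹ ∈ V`, and one climbs from `t 0 = 0`
    -- by `t (i + 1) = (t i - a_i) * y⁻¹`.
    refine isIntegral_of_forall_valuationSubring fun V hV => ?_
    rcases eq_or_ne y 0 with rfl | hy0
    · refine sum_mem fun m _ => mul_mem (hV _) (pow_mem (V.zero_mem) _)
    rcases V.mem_or_inv_mem y with h | h
    · exact sum_mem fun m _ => mul_mem (hV _) (pow_mem h _)
    · induction i with
      | zero => rw [h0]; exact V.zero_mem
      | succ i ih =>
        have := hrec i (by omega)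
        have h2 : t (i + 1) = (t i - f (P.coeff i)) * y⁻¹ := by
          rw [this]; field_simp; ring
        rw [h2]
        exact mul_mem (sub_mem (ih (by omega)) (hV _)) h
  have hintW : ∀ x : Ω, IsIntegral O x → x ∈ W :=
    fun x hx => mem_valuationSubring_of_isIntegral W (fun o : O => hW _ o.2) hx
  -- The coefficient equal to one gives `1 = t j - t (j + 1) * y`, so these two tails cannot both
  -- lie in the maximal ideal of `W`.
  have hex : ∃ i ≤ P.natDegree, W.valuation (t i) = 1 ∨ W.valuation (t (i + 1)) = 1 := by
    by_contra! hcon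
    have hjn : j ≤ P.natDegree := by
      refine Polynomial.le_natDegree_of_ne_zero ?_
      rw [hj]; exact one_ne_zero
    have hlt : ∀ i, i ≤ P.natDegree → W.valuation (t i) < 1 ∧ W.valuation (t (i + 1)) < 1 :=
      fun i hi => ⟨lt_of_le_of_ne ((W.valuation_le_one_iff _).mpr (hintW _ (hint i (by omega))))
        (hcon i hi).1, lt_of_le_of_ne ((W.valuation_le_one_iff _).mpr
          (hintW _ (hint (i + 1) (by omega)))) (hcon i hi).2⟩
    have h1 := hrec j hjn
    rw [hj, map_one] at h1
    have h2 : (1 : Ω) = t j - t (j + 1) * y := by rw [h1]; ring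
    have h3 : W.valuation (1 : Ω) < 1 := by
      rw [h2]
      refine lt_of_le_of_lt (Valuation.map_sub _ _ _) (max_lt (hlt j hjn).1 ?_)
      rw [map_mul]
      exact mul_lt_one_of_lt_of_le (hlt j hjn).2 ((W.valuation_le_one_iff _).mpr hyW)
    simp at h3
  have hex' : ∃ i, 1 ≤ i ∧ i ≤ P.natDegree ∧ W.valuation (t i) = 1 := by
    obtain ⟨i, hi, h | h⟩ := hex
    · refine ⟨i, ?_, hi, h⟩
      rcases Nat.eq_zero_or_pos i with rfl | h'
      · rw [h0] at h; simp at h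
      · exact h'
    · refine ⟨i + 1, by omega, ?_, h⟩
      rcases hi.lt_or_eq with h' | rfl
      · omega
      · rw [htop] at h; simp at h
  obtain ⟨i, hi1, hi, h⟩ := hex'
  refine ⟨t i * y, t i, ?_, hint i (by omega), h, rfl⟩
  obtain ⟨i, rfl⟩ : ∃ i', i = i' + 1 := ⟨i - 1, by omega⟩
  have : t (i + 1) * y = t i - f (P.coeff i) := by rw [hrec i (by omega)]; ring
  rw [this]
  exact (hint i (by omega)).sub (hfalg ▸ isIntegral_algebraMap)

/-- If an automorphism moved the maximal ideal that `W` cuts out on the integral closure, one could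
find an integral `y` that is congruent to 1 there while its conjugates are either equal to `y` or in
the maximal ideal of `W`. The orbit polynomial of `y` then has 1 as a simple root in the residue
field, and Hensel's lemma gives a root in `O`. A root in the base field is fixed by all
automorphisms, so it would be both a unit and a nonunit. Inseparability is absorbed by passing to `q
^ N`-th powers of the roots. -/
theorem mem_of_henselian_of_finite {k M : Type*} [Field k] [Field M] [Algebra k M] [Normal k M]
    [FiniteDimensional k M] (O : ValuationSubring k) [HenselianLocalRing O]
    (W : ValuationSubring M) (hW : W.comap (algebraMap k M) = O) (σ : M ≃ₐ[k] M) {b : M}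
    (hb : IsIntegral O b) (hbW : W.valuation b < 1) : W.valuation (σ b) < 1 := by
  classical
  have hOW : ∀ o : O, algebraMap O M o ∈ W := fun o => hW.ge o.2
  have hOm : ∀ o : O, W.valuation (algebraMap O M o) < 1 ↔ o ∈ IsLocalRing.maximalIdeal O := by
    intro o
    rw [IsLocalRing.mem_maximalIdeal, mem_nonunits_iff, ← not_iff_not, not_lt, not_not]
    constructor
    · intro h
      have ho : (o : k) ≠ 0 := by
        intro h0
        have : algebraMap O M o = 0 := by
          rw [IsScalarTower.algebraMap_apply O k M]; simp [h0]
        rw [this] at h; simp at h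
      have hinv : (o : k)⁻¹ ∈ O := by
        refine hW.le ?_
        rw [ValuationSubring.mem_comap, ← W.valuation_le_one_iff, map_inv₀, map_inv₀]
        exact inv_le_one_of_one_le₀ h
      exact IsUnit.of_mul_eq_one ⟨_, hinv⟩ (Subtype.ext (mul_inv_cancel₀ ho))
    · rintro ⟨u, rfl⟩
      have h1 : algebraMap O M u * algebraMap O M ↑(u⁻¹) = 1 := by rw [← map_mul]; simp
      have h2 := congrArg W.valuation h1
      rw [map_mul, map_one] at h2
      by_contra! h3
      have := mul_lt_one_of_lt_of_le h3 ((W.valuation_le_one_iff _).mpr (hOW ↑(u⁻¹)))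
      exact absurd h2 this.ne
  have hσint : ∀ (τ : M ≃ₐ[k] M) (x : M), IsIntegral O x → IsIntegral O (τ x) := fun τ x hx =>
    hx.map (τ.toAlgHom.restrictScalars O)
  have hmem : ∀ (τ : M ≃ₐ[k] M) (x : integralClosure O M), τ x ∈ W := fun τ x =>
    mem_valuationSubring_of_isIntegral W hOW (hσint τ _ x.2)
  let f : (M ≃ₐ[k] M) → integralClosure O M →+* W := fun τ =>
    ((τ : M →+* M).comp (algebraMap (integralClosure O M) M)).codRestrict W (hmem τ)
  let m : (M ≃ₐ[k] M) → Ideal (integralClosure O M) := fun τ =>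
    (IsLocalRing.maximalIdeal W).comap (f τ)
  have hm : ∀ τ x, x ∈ m τ ↔ W.valuation (τ x) < 1 := fun τ x => by
    rw [Ideal.mem_comap, W.valuation_lt_one_iff]; rfl
  have hmax : ∀ τ, (m τ).IsMaximal := by
    intro τ
    have : (m τ).IsPrime := Ideal.comap_isPrime _ _
    refine Ideal.isMaximal_of_isIntegral_of_isMaximal_comap (R := O) (m τ) ?_
    have : Ideal.comap (algebraMap O (integralClosure O M)) (m τ) =
        IsLocalRing.maximalIdeal O := by
      ext o
      rw [Ideal.mem_comap, hm, ← hOm]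
      congr! 2
      exact τ.commutes o.1
    rw [this]
    infer_instance
  by_contra hcon
  have hne : m σ ≠ m 1 := by
    intro h
    have h1 : (⟨b, hb⟩ : integralClosure O M) ∈ m 1 := (hm _ _).mpr hbW
    rw [← h, hm] at h1
    exact hcon h1
  -- an element separating `m 1` from the other conjugates
  obtain ⟨x, hx1, hx⟩ : ∃ x : integralClosure O M, x - 1 ∈ m 1 ∧
      ∀ τ, m τ ≠ m 1 → x ∈ m τ := by
    let T := Finset.univ.filter fun τ => m τ ≠ m 1
    have hT : ¬ T.inf m ≤ m 1 := by
      rw [(hmax 1).isPrime.inf_le']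
      rintro ⟨τ, hτ, hle⟩
      exact (Finset.mem_filter.mp hτ).2 ((hmax τ).eq_of_le (hmax 1).ne_top hle)
    obtain ⟨z, hzT, hz⟩ := SetLike.not_le_iff_exists.mp hT
    obtain ⟨c, hc⟩ := (hmax 1).exists_inv hz
    obtain ⟨i, hi, hci⟩ := hc
    refine ⟨c * z, ?_, fun τ hτ => ?_⟩
    · have : c * z - 1 = -i := by rw [← hci]; ring
      rw [this]; exact neg_mem hi
    · refine Ideal.mul_mem_left _ _ ?_
      have : T.inf m ≤ m τ := Finset.inf_le (Finset.mem_filter.mpr ⟨Finset.mem_univ _, hτ⟩)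
      exact this hzT
  -- `D` is the decomposition group of `m 1`. The product of the `D`-conjugates of `x` is fixed by
  -- `D` and still congruent to 1, while any `τ ∉ D` sends it into the maximal ideal because of the
  -- factor `τ x`.
  let D : Finset (M ≃ₐ[k] M) := Finset.univ.filter fun τ => m τ = m 1
  have hmmul : ∀ τ d, m d = m 1 → m (τ * d) = m 1 → m τ = m 1 := by
    intro τ d hd hτd
    ext z
    have hz : z = ⟨d (d⁻¹ z), by rw [← AlgEquiv.mul_apply, mul_inv_cancel]; exact z.2⟩ := by
      apply Subtype.ext
      change (z : M) = (d * d⁻¹) z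
      rw [mul_inv_cancel]; rfl
    let z' : integralClosure O M := ⟨d⁻¹ z, hσint d⁻¹ _ z.2⟩
    have e1 : z ∈ m τ ↔ z' ∈ m (τ * d) := by
      rw [hm, hm]
      have : (τ * d) z' = τ z := by
        change (τ * d * d⁻¹) z = τ z
        rw [mul_assoc, mul_inv_cancel, mul_one]
      rw [this]
    have e2 : z ∈ m 1 ↔ z' ∈ m d := by
      rw [hm, hm]
      have : d z' = (1 : M ≃ₐ[k] M) z := by
        change (d * d⁻¹) z = _
        rw [mul_inv_cancel]
      rw [this]
    rw [e1, e2, hτd, hd]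
  have hmmul' : ∀ τ d, m τ = m 1 → m d = m 1 → m (τ * d) = m 1 := by
    intro τ d hτ hd
    ext z
    let z' : integralClosure O M := ⟨d z, hσint d _ z.2⟩
    have e1 : z ∈ m (τ * d) ↔ z' ∈ m τ := by rw [hm, hm]; rfl
    have e2 : z ∈ m d ↔ z' ∈ m 1 := by rw [hm, hm]; rfl
    rw [e1, hτ, ← e2, hd]
  let y : M := ∏ d ∈ D, d (x : M)
  have hyint : IsIntegral O y := IsIntegral.prod _ fun d _ => hσint d _ x.2
  have hone : ∀ z : M, W.valuation (z - 1) < 1 → W.valuation z = 1 := fun z hz => by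
    have := W.valuation.map_add_eq_of_lt_right (x := z - 1) (y := 1) (by simpa using hz)
    simpa using this
  have hy1 : W.valuation y = 1 := by
    simp only [y, map_prod]
    refine Finset.prod_eq_one fun d hd => hone _ ?_
    have hd : m d = m 1 := (Finset.mem_filter.mp hd).2
    have := hx1
    rw [← hd, hm] at this
    simpa using this
  have hyD : ∀ τ ∈ D, τ y = y := by
    intro τ hτ
    have hτ : m τ = m 1 := (Finset.mem_filter.mp hτ).2
    simp only [y, map_prod]
    refine Finset.prod_bij (fun d _ => τ * d) ?_ ?_ ?_ ?_
    · intro d hd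
      exact Finset.mem_filter.mpr ⟨Finset.mem_univ _, hmmul' _ _ hτ (Finset.mem_filter.mp hd).2⟩
    · intro a _ b _ h
      exact mul_left_cancel h
    · intro d hd
      have hd : m d = m 1 := (Finset.mem_filter.mp hd).2
      have hτ' : m τ⁻¹ = m 1 := hmmul _ τ hτ (by rw [inv_mul_cancel])
      exact ⟨τ⁻¹ * d, Finset.mem_filter.mpr ⟨Finset.mem_univ _, hmmul' _ _ hτ' hd⟩, by simp⟩
    · intro d _; rfl
  have hyn : ∀ τ, τ ∉ D → W.valuation (τ y) < 1 := by
    intro τ hτ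
    have h1D : (1 : M ≃ₐ[k] M) ∈ D := Finset.mem_filter.mpr ⟨Finset.mem_univ _, rfl⟩
    have hτ' : m τ ≠ m 1 := fun h => hτ (Finset.mem_filter.mpr ⟨Finset.mem_univ _, h⟩)
    simp only [y, map_prod]
    rw [← Finset.mul_prod_erase _ _ h1D]
    refine mul_lt_one_of_lt_of_le ((hm _ _).mp (hx τ hτ')) (Finset.prod_le_one' fun d _ => ?_)
    exact (W.valuation_le_one_iff _).mpr (hmem (τ * d) x)
  -- the orbit polynomial, after raising to a power to descend to `k`
  let orb : Finset M := Finset.univ.image fun τ : M ≃ₐ[k] M => τ y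
  have hyorb : y ∈ orb := Finset.mem_image.mpr ⟨1, Finset.mem_univ _, rfl⟩
  let q := ringExpChar k
  have : ExpChar k q := inferInstance
  have : ExpChar M q := expChar_of_injective_algebraMap (algebraMap k M).injective q
  let f0 : Polynomial M := ∏ z ∈ orb, (Polynomial.X - Polynomial.C z)
  have hf0 : ∀ τ : M ≃ₐ[k] M, f0.map (τ : M →+* M) = f0 := by
    intro τ
    simp only [f0, Polynomial.map_prod, Polynomial.map_sub, Polynomial.map_X, Polynomial.map_C]
    refine Finset.prod_bij (fun z _ => τ z) ?_ ?_ ?_ ?_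
    · intro z hz
      obtain ⟨ρ, -, rfl⟩ := Finset.mem_image.mp hz
      exact Finset.mem_image.mpr ⟨τ * ρ, Finset.mem_univ _, rfl⟩
    · intro a _ b _ h
      exact τ.injective h
    · intro z hz
      obtain ⟨ρ, -, rfl⟩ := Finset.mem_image.mp hz
      refine ⟨(τ⁻¹ * ρ) y, Finset.mem_image.mpr ⟨τ⁻¹ * ρ, Finset.mem_univ _, rfl⟩, ?_⟩
      change (τ * (τ⁻¹ * ρ)) y = _
      rw [mul_inv_cancel_left]
    · intro z _; rfl
  have hcoef : ∀ i, ∃ n, f0.coeff i ^ q ^ n ∈ (algebraMap k M).range := by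
    intro i
    refine exists_pow_mem_range_of_forall_aut q _ fun τ => ?_
    have := congrArg (fun p => Polynomial.coeff p i) (hf0 τ)
    simpa using this
  choose n hn using hcoef
  let N := f0.support.sup n
  have hN : ∀ i, f0.coeff i ^ q ^ N ∈ (algebraMap k M).range := by
    intro i
    by_cases hi : i ∈ f0.support
    · have : n i ≤ N := Finset.le_sup hi
      rw [← Nat.sub_add_cancel this, pow_add, mul_comm, pow_mul]
      exact pow_mem (hn i) _
    · rw [Polynomial.notMem_support_iff.mp hi, zero_pow (pow_ne_zero _ (expChar_ne_zero k q))]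
      exact zero_mem _
  let g : Polynomial M := ∏ z ∈ orb, (Polynomial.X - Polynomial.C (z ^ q ^ N))
  have hgf : g = f0.map (iterateFrobenius M q N) := by
    simp only [g, f0, Polynomial.map_prod, Polynomial.map_sub, Polynomial.map_X,
      Polynomial.map_C, iterateFrobenius_def]
  have horbint : ∀ z ∈ orb, IsIntegral O z := by
    intro z hz
    obtain ⟨ρ, -, rfl⟩ := Finset.mem_image.mp hz
    exact hσint ρ _ hyint
  have hgm : g.Monic := Polynomial.monic_prod_of_monic _ _ fun z _ => Polynomial.monic_X_sub_C _
  have hg : g ∈ Polynomial.lifts (algebraMap O M) := by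
    rw [Polynomial.lifts_iff_coeff_lifts]
    intro i
    have h1 : g.coeff i ∈ integralClosure O M := by
      have : g ∈ Polynomial.lifts (algebraMap (integralClosure O M) M) := by
        refine prod_mem fun z hz => ?_
        exact (Polynomial.mem_lifts _).mpr ⟨Polynomial.X - Polynomial.C
          ⟨z ^ q ^ N, (horbint z hz).pow _⟩, by simp⟩
      obtain ⟨c, hc⟩ := (Polynomial.lifts_iff_coeff_lifts _).mp this i
      rw [← hc]; exact c.2
    have h2 : g.coeff i ∈ (algebraMap k M).range := by
      rw [hgf, Polynomial.coeff_map, iterateFrobenius_def]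
      exact hN i
    obtain ⟨c, hc⟩ := h2
    have h3 : IsIntegral O c := by
      rw [← isIntegral_algebraMap_iff (algebraMap k M).injective, hc]
      exact h1
    obtain ⟨o, ho⟩ := IsIntegrallyClosed.algebraMap_eq_of_integral h3
    exact ⟨o, by rw [IsScalarTower.algebraMap_apply O k M, ho, hc]⟩
  obtain ⟨G, hG, -, hGm⟩ := Polynomial.lifts_and_degree_eq_and_monic hg hgm
  let h : Polynomial M := ∏ z ∈ orb.erase y, (Polynomial.X - Polynomial.C (z ^ q ^ N))
  have hgh : g = (Polynomial.X - Polynomial.C (y ^ q ^ N)) * h :=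
    (Finset.mul_prod_erase _ _ hyorb).symm
  have hqN : q ^ N ≠ 0 := pow_ne_zero _ (expChar_ne_zero k q)
  have hh1 : W.valuation (h.eval 1) = 1 := by
    simp only [h, Polynomial.eval_prod, map_prod]
    refine Finset.prod_eq_one fun z hz => hone _ ?_
    obtain ⟨hzy, hz⟩ := Finset.mem_erase.mp hz
    obtain ⟨ρ, -, rfl⟩ := Finset.mem_image.mp hz
    have hρ : ρ ∉ D := fun h => hzy (hyD ρ h)
    rw [Polynomial.eval_sub, Polynomial.eval_X, Polynomial.eval_C, sub_sub_cancel_left,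
      Valuation.map_neg, map_pow]
    exact pow_lt_one₀ zero_le (hyn ρ hρ) hqN
  have hyN : W.valuation (1 - y ^ q ^ N) < 1 := by
    have h1 : W.valuation (y - 1) < 1 := by
      have hD : ∀ s : Finset (M ≃ₐ[k] M), s ⊆ D →
          W.valuation ((∏ d ∈ s, d (x : M)) - 1) < 1 := by
        intro s
        induction s using Finset.induction_on with
        | empty => simp
        | insert d s hds ih =>
          intro hs
          rw [Finset.insert_subset_iff] at hs
          rw [Finset.prod_insert hds]
          have e : d (x : M) * ∏ d ∈ s, d (x : M) - 1 =
            d (x : M) * (∏ d ∈ s, d (x : M) - 1) + (d (x : M) - 1) := by ring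
          rw [e]
          refine lt_of_le_of_lt (Valuation.map_add _ _ _) (max_lt ?_ ?_)
          · rw [map_mul]
            rw [mul_comm]
            exact mul_lt_one_of_lt_of_le (ih hs.2) ((W.valuation_le_one_iff _).mpr (hmem d x))
          · have hd : m d = m 1 := (Finset.mem_filter.mp hs.1).2
            have := hx1
            rw [← hd, hm] at this
            simpa using this
      exact hD D subset_rfl
    have e : 1 - y ^ q ^ N = - (y - 1) ^ q ^ N := by
      rw [sub_pow_expChar_pow, one_pow]; ring
    rw [e, Valuation.map_neg, map_pow]
    exact pow_lt_one₀ zero_le h1 hqN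
  have hGe : ∀ o : O, algebraMap O M (G.eval o) = g.eval (algebraMap O M o) := by
    intro o; rw [← hG, Polynomial.eval_map, Polynomial.eval₂_at_apply]
  have hGe' : algebraMap O M (G.derivative.eval 1) = g.derivative.eval 1 := by
    rw [← hG, Polynomial.derivative_map, Polynomial.eval_map, ← map_one (algebraMap O M),
      Polynomial.eval₂_at_apply]
  have hint : ∀ p : Polynomial M, p ∈ Polynomial.lifts (algebraMap (integralClosure O M) M) →
      W.valuation (p.eval 1) ≤ 1 := by
    intro p hp
    obtain ⟨P, rfl⟩ := (Polynomial.mem_lifts _).mp hp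
    rw [W.valuation_le_one_iff, Polynomial.eval_map, ← map_one (algebraMap (integralClosure O M) M),
      Polynomial.eval₂_at_apply]
    exact hmem 1 _
  have hhl : h ∈ Polynomial.lifts (algebraMap (integralClosure O M) M) := by
    refine prod_mem fun z hz => ?_
    exact (Polynomial.mem_lifts _).mpr ⟨Polynomial.X - Polynomial.C
      ⟨z ^ q ^ N, (horbint z (Finset.mem_of_mem_erase hz)).pow _⟩, by simp⟩
  have hhl' : h.derivative ∈ Polynomial.lifts (algebraMap (integralClosure O M) M) := by
    obtain ⟨P, hP⟩ := (Polynomial.mem_lifts _).mp hhl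
    exact (Polynomial.mem_lifts _).mpr ⟨P.derivative, by rw [← Polynomial.derivative_map, hP]⟩
  -- Modulo the maximal ideal of `W`, `g` is `X - 1` times a power of `X`.
  obtain ⟨a, ha, ha1⟩ := HenselianLocalRing.is_henselian G hGm 1 (by
    rw [← hOm, hGe, map_one, hgh, Polynomial.eval_mul, map_mul]
    refine mul_lt_one_of_lt_of_le ?_ hh1.le
    simpa using hyN) (by
    rw [← IsLocalRing.notMem_maximalIdeal, ← hOm, hGe', hgh, Polynomial.derivative_mul]
    simp only [Polynomial.derivative_sub, Polynomial.derivative_X, Polynomial.derivative_C,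
      sub_zero, one_mul, Polynomial.eval_add, Polynomial.eval_mul, Polynomial.eval_sub,
      Polynomial.eval_X, Polynomial.eval_C]
    rw [W.valuation.map_add_eq_of_lt_left, hh1]
    · exact lt_irrefl _
    · rw [hh1, map_mul]
      exact mul_lt_one_of_lt_of_le hyN (hint _ hhl'))
  have ha0 : g.eval (algebraMap O M a) = 0 := by
    rw [← hGe, ha.eq_zero, map_zero]
  simp only [g, Polynomial.eval_prod, Finset.prod_eq_zero_iff, Polynomial.eval_sub,
    Polynomial.eval_X, Polynomial.eval_C, sub_eq_zero] at ha0
  obtain ⟨z, hz, hza⟩ := ha0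
  obtain ⟨ρ, -, rfl⟩ := Finset.mem_image.mp hz
  have hτa : ∀ τ : M ≃ₐ[k] M, τ (algebraMap O M a) = algebraMap O M a := fun τ => τ.commutes a.1
  -- Since `a` is fixed by all automorphisms, it is the `q ^ N`-th power of every conjugate of `y`,
  -- in particular of `σ y`, which lies in the maximal ideal.
  have hya : (σ y) ^ q ^ N = algebraMap O M a := by
    have h1 : (y) ^ q ^ N = algebraMap O M a := by
      apply ρ.injective
      rw [hτa, hza, map_pow]
    rw [← map_pow, h1, hτa]
  have hσD : σ ∉ D := fun h => hne (Finset.mem_filter.mp h).2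
  have hlt : W.valuation (algebraMap O M a) < 1 := by
    rw [← hya, map_pow]
    exact pow_lt_one₀ zero_le (hyn σ hσD) hqN
  have : W.valuation (algebraMap O M a) = 1 := by
    refine hone _ ?_
    have := (hOm _).mpr ha1
    simpa using this
  exact absurd this hlt.ne

/-- The valuation rings above a henselian valuation ring are stable under automorphisms. -/
theorem map_mem_of_henselian {k Ω : Type*} [Field k] [Field Ω] [Algebra k Ω] [Normal k Ω]
    (O : ValuationSubring k) [HenselianLocalRing O]
    (W : ValuationSubring Ω) (hW : W.comap (algebraMap k Ω) = O) (σ : Ω ≃ₐ[k] Ω) {x : Ω}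
    (hx : x ∈ W) : σ x ∈ W := by
  have hOW : ∀ o ∈ O, algebraMap k Ω o ∈ W := fun o ho => by rwa [← hW] at ho
  have hxi : IsIntegral k x := Normal.isIntegral ‹_› x
  -- integral elements of the maximal ideal are preserved
  have key : ∀ (τ : Ω ≃ₐ[k] Ω) (c : Ω), IsIntegral O c → W.valuation c < 1 →
      W.valuation (τ c) < 1 := by
    intro τ c hc hc1
    have hci : IsIntegral k c := Normal.isIntegral ‹_› c
    let F := IntermediateField.adjoin k {c}
    have : FiniteDimensional k F := IntermediateField.adjoin.finiteDimensional hci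
    let M := IntermediateField.normalClosure k F Ω
    have : Normal k M := normalClosure.normal k F Ω
    have : FiniteDimensional k M := normalClosure.is_finiteDimensional k F Ω
    have hcM : c ∈ M := by
      have h1 : F ≤ M := IntermediateField.le_normalClosure F
      exact h1 (IntermediateField.mem_adjoin_simple_self k c)
    let W' := W.comap (algebraMap M Ω)
    have hval : ∀ z : M, W'.valuation z < 1 ↔ W.valuation (z : Ω) < 1 := by
      intro z
      rw [← ValuationSubring.mem_nonunits_iff, ← ValuationSubring.mem_nonunits_iff,
        ValuationSubring.mem_nonunits_iff_or, ValuationSubring.mem_nonunits_iff_or]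
      simp [W', ValuationSubring.mem_comap]
    have hcO : IsIntegral O (⟨c, hcM⟩ : M) := by
      rw [← isIntegral_algebraMap_iff (algebraMap M Ω).injective]
      exact hc
    have := mem_of_henselian_of_finite O W' (by rw [← hW]; rfl) (τ.restrictNormal M) hcO
      ((hval _).mpr hc1)
    rw [hval] at this
    have h2 := τ.restrictNormal_commutes M ⟨c, hcM⟩
    rw [show algebraMap M Ω ⟨c, hcM⟩ = c from rfl] at h2
    rw [← h2]
    exact this
  obtain ⟨b, c, hb, hc, hc1, hcx⟩ := exists_isIntegral_mul_eq O W hOW hxi.isAlgebraic hx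
  have hWint : ∀ z : Ω, IsIntegral O z → z ∈ W := fun z hz =>
    mem_valuationSubring_of_isIntegral W (fun o : O => hOW _ o.2) hz
  have hσint : ∀ x : Ω, IsIntegral O x → IsIntegral O (σ x) := fun x hx =>
    hx.map (σ.toAlgHom.restrictScalars O)
  have hσc : W.valuation (σ c) = 1 := by
    refine le_antisymm ((W.valuation_le_one_iff _).mpr (hWint _ (hσint c hc))) ?_
    by_contra! h
    have := key σ.symm (σ c) (hσint c hc) h
    rw [AlgEquiv.symm_apply_apply] at this
    exact absurd hc1 this.ne
  have : W.valuation (σ x) = W.valuation (σ b) := by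
    rw [← hcx, map_mul, map_mul, hσc, one_mul]
  rw [← W.valuation_le_one_iff, this, W.valuation_le_one_iff]
  exact hWint _ (hσint b hb)

end

section

/-! ### Continuity of the action on a generic root -/

open Polynomial in
/-- The reduction of a polynomial `F` with roots the conjugates of `θ`, along an embedding of `L`
into a field with a valuation ring. -/
theorem exists_integral_roots {A K L Ω : Type*} [CommRing A] [Field K] [Field L] [Algebra A K]
    [Algebra K L] [Algebra A L] [IsScalarTower A K L] [Fintype (L ≃ₐ[K] L)] [Field Ω]
    (W : ValuationSubring Ω) {θ : L} {d : A} {F : A[X]} {g : (L ≃ₐ[K] L) → A[X]}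
    (hF : F.map (algebraMap A L) = C (algebraMap A L d) * ∏ τ : L ≃ₐ[K] L, (X - C (τ θ)))
    (hg : ∀ σ, aeval θ (g σ) = σ θ * aeval θ (derivative F))
    (b : L →+* Ω) (β : A →+* W) (hβ : ∀ c, (β c : Ω) = b (algebraMap A L c))
    (hd : IsUnit (β d)) :
    ∃ ρ : (L ≃ₐ[K] L) → W, (∀ τ, (ρ τ : Ω) = b (τ θ)) ∧
      F.map β = C (β d) * ∏ τ, (X - C (ρ τ)) ∧
      ∀ σ, eval₂ β (ρ 1) (g σ) = ρ σ * eval₂ β (ρ 1) (derivative F) := by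
  have hcomp : W.subtype.comp β = b.comp (algebraMap A L) := RingHom.ext hβ
  have hint : ∀ τ : L ≃ₐ[K] L, b (τ θ) ∈ W := by
    intro τ
    obtain ⟨u, hu⟩ := hd
    have hmap : (C (↑(u⁻¹) : W) * F.map β).map W.subtype = ∏ τ : L ≃ₐ[K] L, (X - C (b (τ θ))) := by
      rw [Polynomial.map_mul, Polynomial.map_map, hcomp, ← Polynomial.map_map, hF, map_C,
        Polynomial.map_mul, map_C, ← mul_assoc, ← C_mul, ← hβ, ← hu, Polynomial.map_prod]
      have : W.subtype ↑u⁻¹ * (u : W) = 1 := congrArg Subtype.val u.inv_mul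
      rw [this]
      simp
    have hmonic : (C (↑(u⁻¹) : W) * F.map β).Monic := by
      refine (Function.Injective.monic_map_iff W.subtype_injective).mpr ?_
      rw [hmap]
      exact monic_prod_of_monic _ _ fun _ _ => monic_X_sub_C _
    refine mem_valuationSubring_of_isIntegral (O := W) W (fun o => o.2) ⟨_, hmonic, ?_⟩
    change eval₂ W.subtype _ _ = 0
    rw [← Polynomial.eval_map, hmap, eval_prod]
    exact Finset.prod_eq_zero (Finset.mem_univ τ) (by simp)
  refine ⟨fun τ => ⟨b (τ θ), hint τ⟩, fun τ => rfl, ?_, fun σ => ?_⟩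
  · refine Polynomial.map_injective W.subtype W.subtype_injective ?_
    rw [Polynomial.map_map, hcomp, ← Polynomial.map_map, hF]
    simp [Polynomial.map_prod, hβ]
  · apply W.subtype_injective
    have h1 : ∀ p : A[X], W.subtype (eval₂ β ⟨b ((1 : L ≃ₐ[K] L) θ), hint 1⟩ p) =
        b (aeval θ p) := by
      intro p
      rw [hom_eval₂, hcomp, aeval_def, hom_eval₂]
      rfl
    rw [map_mul, h1, h1, hg, map_mul]
    rfl

theorem valued_ball_mem_nhds {κ Γ : Type*} [Field κ] [LinearOrderedCommGroupWithZero Γ]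
    [Valued κ Γ] (r : κ) {e : κ} (he : e ≠ 0) :
    {x : κ | Valued.v (x - r) < Valued.v e} ∈ nhds r := by
  rw [Valued.mem_nhds]
  have h0 : Valued.v.restrict e ≠ 0 := by simpa using he
  refine ⟨Units.mk0 _ h0, fun y hy => ?_⟩
  simpa using hy

open Polynomial in
/-- The coefficientwise evaluation of `p` along a function `c` on the coefficients. -/
def evalCoeff {A κ : Type*} [CommRing A] [CommRing κ] (p : A[X]) (c : A → κ) (x : κ) : κ :=
  ∑ i ∈ p.support, c (p.coeff i) * x ^ i

open Polynomial in
theorem evalCoeff_eq {A κ : Type*} [CommRing A] [CommRing κ] (p : A[X]) (c : A →+* κ) (x : κ) :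
    evalCoeff p c x = eval₂ c x p :=
  (eval₂_eq_sum).symm

-- The coefficients are an arbitrary point of the product space `A → κ`, not a ring homomorphism, so
-- that the reduction of `A` can be varied in an open set.
open Polynomial in
theorem continuous_evalCoeff {A κ : Type*} [CommRing A] [CommRing κ] [TopologicalSpace κ]
    [IsTopologicalRing κ] (p : A[X]) :
    Continuous fun z : (A → κ) × κ => evalCoeff p z.1 z.2 := by
  unfold evalCoeff
  fun_prop

open Polynomial in
/-- If the reductions of two embeddings of `L` are close on finitely many functions, then the
decomposition homomorphisms of the two embeddings are conjugate. -/
theorem exists_isOpen_forall_conj {A K L Ω κ Γ : Type*} [CommRing A] [Field K] [Field L]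
    [Algebra A K] [Algebra K L] [Algebra A L] [IsScalarTower A K L] [Fintype (L ≃ₐ[K] L)] [Field Ω]
    [Field κ] [LinearOrderedCommGroupWithZero Γ] [Valued κ Γ]
    (W : ValuationSubring Ω) (red : W →+* κ) (hred : ∀ x, red x ≠ 0 → IsUnit x)
    {θ : L} {d : A} {F : A[X]} {g : (L ≃ₐ[K] L) → A[X]}
    (hF : F.map (algebraMap A L) = C (algebraMap A L d) * ∏ τ : L ≃ₐ[K] L, (X - C (τ θ)))
    (hg : ∀ σ, aeval θ (g σ) = σ θ * aeval θ (derivative F))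
    (a : L →+* Ω) (α : A →+* W) (hα : ∀ c, (α c : Ω) = a (algebraMap A L c))
    (hd : red (α d) ≠ 0)
    (hsep : ∀ τ : L ≃ₐ[K] L, τ ≠ 1 → ∀ x : W, (x : Ω) = a (τ θ - θ) → red x ≠ 0) :
    ∃ N : Set (A → κ), IsOpen N ∧ (fun c => red (α c)) ∈ N ∧
      ∀ (b : L →+* Ω) (β : A →+* W), (∀ c, (β c : Ω) = b (algebraMap A L c)) →
        (fun c => red (β c)) ∈ N → ∃ σ₁ : L ≃ₐ[K] L,
        ∀ (s : Ω →+* Ω) (s' : κ →+* κ),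
          (∀ x : W, ∃ y : W, (y : Ω) = s x ∧ red y = s' (red x)) →
          (∀ x, Valued.v (s' x) = Valued.v x) →
          ∀ σ σ' : L ≃ₐ[K] L, (∀ x, s (a x) = a (σ x)) → (∀ x, s (b (σ₁ x)) = b (σ₁ (σ' x))) →
          σ = σ' := by
  classical
  obtain ⟨ρ, hρ, hρF, hρg⟩ := exists_integral_roots W hF hg a α hα (hred _ hd)
  set r : (L ≃ₐ[K] L) → κ := fun τ => red (ρ τ) with hr
  have hr1 : ∀ τ, r τ = r 1 → τ = 1 := by
    intro τ h
    by_contra hτ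
    refine hsep τ hτ (ρ τ - ρ 1) ?_ ?_
    · change (ρ τ : Ω) - (ρ 1 : Ω) = _
      rw [hρ, hρ, map_sub]; rfl
    · rw [map_sub, sub_eq_zero]; exact h
  -- a bound separating the distinct reductions
  obtain ⟨e, he0, he⟩ : ∃ e : κ, e ≠ 0 ∧ ∀ σ τ, r σ ≠ r τ → Valued.v e ≤ Valued.v (r σ - r τ) := by
    let T := (Finset.univ : Finset ((L ≃ₐ[K] L) × (L ≃ₐ[K] L))).filter fun p => r p.1 ≠ r p.2
    rcases T.eq_empty_or_nonempty with hT | hT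
    · refine ⟨1, one_ne_zero, fun σ τ h => ?_⟩
      have : (σ, τ) ∈ T := Finset.mem_filter.mpr ⟨Finset.mem_univ _, h⟩
      rw [hT] at this
      simp at this
    · obtain ⟨p, hp, hmin⟩ := Finset.exists_min_image T
        (fun p => Valued.v (r p.1 - r p.2)) hT
      refine ⟨r p.1 - r p.2, sub_ne_zero.mpr (Finset.mem_filter.mp hp).2, fun σ τ h => ?_⟩
      exact hmin (σ, τ) (Finset.mem_filter.mpr ⟨Finset.mem_univ _, h⟩)
  set ca : A → κ := fun c => red (α c) with hca
  have heval : ∀ (γ : A →+* W) (x : W) (p : A[X]),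
      evalCoeff p (fun c => red (γ c)) (red x) = red (eval₂ γ x p) := by
    intro γ x p
    rw [show (fun c => red (γ c)) = (red.comp γ : A →+* κ) from rfl, evalCoeff_eq, hom_eval₂]
  have hder : red (eval₂ α (ρ 1) (derivative F)) ≠ 0 := by
    have h1 : eval₂ α (ρ 1) (derivative F) = α d * ∏ τ ∈ Finset.univ.erase 1, (ρ 1 - ρ τ) := by
      rw [← Polynomial.eval_map, ← derivative_map, hρF, derivative_C_mul, eval_mul, eval_C]
      congr 1
      rw [← Finset.mul_prod_erase _ _ (Finset.mem_univ (1 : L ≃ₐ[K] L)), derivative_mul]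
      simp [eval_prod]
    rw [h1, map_mul, map_prod]
    refine mul_ne_zero hd (Finset.prod_ne_zero_iff.mpr fun τ hτ => ?_)
    rw [map_sub, sub_ne_zero]
    exact fun h => (Finset.mem_erase.mp hτ).1 (hr1 τ h.symm)
  -- Since `r 1` is a simple root, `F'` does not vanish there, and the root with label `σ` is
  -- recovered from it by a rational expression.
  have hgr : ∀ σ, evalCoeff (g σ) ca (r 1) / evalCoeff (derivative F) ca (r 1) = r σ := by
    intro σ
    rw [heval, heval, hρg, map_mul, mul_div_assoc, div_self hder, mul_one]
  have hcont : ∀ σ, ∀ᶠ z : (A → κ) × κ in nhds (ca, r 1),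
      evalCoeff (derivative F) z.1 z.2 ≠ 0 ∧
      Valued.v (evalCoeff (g σ) z.1 z.2 / evalCoeff (derivative F) z.1 z.2 - r σ) <
        Valued.v e := by
    intro σ
    have hd0 : evalCoeff (derivative F) ca (r 1) ≠ 0 := by rw [heval]; exact hder
    refine Filter.Eventually.and ?_ ?_
    · exact (continuous_evalCoeff (κ := κ) (derivative F)).continuousAt.eventually_ne hd0
    · have h1 : ContinuousAt (fun z : (A → κ) × κ =>
          evalCoeff (g σ) z.1 z.2 / evalCoeff (derivative F) z.1 z.2) (ca, r 1) :=
        (continuous_evalCoeff _).continuousAt.div (continuous_evalCoeff _).continuousAt hd0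
      have h2 := h1.tendsto
      simp only [hgr] at h2
      exact h2 (valued_ball_mem_nhds (r σ) he0)
  have hcont' := Filter.eventually_all.mpr hcont
  rw [nhds_prod_eq, Filter.eventually_prod_iff] at hcont'
  obtain ⟨pc, hpc, px, hpx, hpcx⟩ := hcont'
  obtain ⟨γ, hγ⟩ := Valued.mem_nhds.mp hpx
  obtain ⟨ε, hε⟩ := MonoidWithZeroHom.ValueGroup₀.restrict₀_surjective
    (MonoidWithZeroHom.ofClass (Valued.v : Valuation κ Γ)) γ.1
  have hε0 : ε ≠ 0 := by
    rintro rfl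
    exact γ.ne_zero (by rw [← hε]; simp)
  have hpx' : ∀ x, Valued.v (x - r 1) < Valued.v ε → px x := by
    intro x hx
    refine hγ ?_
    rw [Set.mem_ofPred_eq, ← hε]
    exact (Valuation.restrict_lt_iff _).mpr hx
  -- The quotient of `F(r 1)` by the leading coefficient is the product of the differences of `r 1`
  -- with the roots; if its value is below that of `ε` to the number of roots, then some root is
  -- within `ε` of `r 1`.
  have hsmall : ∀ᶠ c : A → κ in nhds ca, c d ≠ 0 ∧
      Valued.v (evalCoeff F c (r 1) / c d - 0) < Valued.v (ε ^ Fintype.card (L ≃ₐ[K] L)) := by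
    have hcd : Continuous fun c : A → κ => c d := continuous_apply d
    refine Filter.Eventually.and (hcd.continuousAt.eventually_ne hd) ?_
    have h1 : ContinuousAt (fun c : A → κ => evalCoeff F c (r 1) / c d) ca :=
      ((continuous_evalCoeff F).comp (Continuous.prodMk_left (r 1))).continuousAt.div
        hcd.continuousAt hd
    have h2 := h1.tendsto
    have h3 : evalCoeff F ca (r 1) = 0 := by
      rw [heval, ← Polynomial.eval_map, hρF]
      simp only [eval_mul, eval_prod]
      rw [Finset.prod_eq_zero (Finset.mem_univ (1 : L ≃ₐ[K] L)) (by simp)]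
      simp
    rw [h3, zero_div] at h2
    exact h2 (valued_ball_mem_nhds 0 (pow_ne_zero _ hε0))
  obtain ⟨N, hN, hNo, hNa⟩ := mem_nhds_iff.mp (Filter.inter_mem hpc hsmall)
  refine ⟨N, hNo, hNa, fun b β hβ hβN => ?_⟩
  obtain ⟨hβ1, hβd, hβ2⟩ := hN hβN
  obtain ⟨ρb, hρb, hρbF, hρbg⟩ := exists_integral_roots W hF hg b β hβ (hred _ hβd)
  -- a root close to `r 1`
  obtain ⟨σ₁, hσ₁⟩ : ∃ σ₁, Valued.v (r 1 - red (ρb σ₁)) < Valued.v ε := by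
    by_contra! hcon
    rw [heval, ← Polynomial.eval_map, hρbF] at hβ2
    simp only [eval_mul, eval_prod, eval_C, map_mul, eval_sub, eval_X, map_prod, map_sub,
      sub_zero] at hβ2
    rw [mul_div_cancel_left₀ _ hβd, map_prod, map_pow, ← Finset.card_univ,
      ← Finset.prod_const] at hβ2
    exact absurd hβ2 (not_lt.mpr (Finset.prod_le_prod' fun τ _ => hcon τ))
  -- Composition with `σ₁` gives the label 1 to the root near `r 1`; continuity then puts every
  -- other root near the one with the same label.
  let b₁ : L →+* Ω := b.comp (σ₁ : L →+* L)
  have hb₁ : ∀ c, (β c : Ω) = b₁ (algebraMap A L c) := by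
    intro c
    rw [hβ, RingHom.comp_apply]
    congr 1
    rw [IsScalarTower.algebraMap_apply A K L]
    exact (σ₁.commutes _).symm
  obtain ⟨ρ₁, hρ₁, hρ₁F, hρ₁g⟩ := exists_integral_roots W hF hg b₁ β hb₁ (hred _ hβd)
  have hρ₁1 : ρ₁ 1 = ρb σ₁ := Subtype.ext (by rw [hρ₁, hρb]; rfl)
  have hclose1 : Valued.v (red (ρ₁ 1) - r 1) < Valued.v ε := by
    rw [hρ₁1, Valuation.map_sub_swap]; exact hσ₁
  have hclose : ∀ σ, Valued.v (red (ρ₁ σ) - r σ) < Valued.v e := by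
    intro σ
    obtain ⟨h1, h2⟩ := hpcx hβ1 (hpx' _ hclose1) σ
    rw [heval] at h1
    rw [heval, heval, hρ₁g, map_mul, mul_div_assoc, div_self h1, mul_one] at h2
    exact h2
  have heq : ∀ σ τ (x : κ), Valued.v (x - r σ) < Valued.v e → Valued.v (x - r τ) < Valued.v e →
      r σ = r τ := by
    intro σ τ x h1 h2
    by_contra h
    have h3 : r σ - r τ = (x - r τ) - (x - r σ) := by ring
    have h4 := he σ τ h
    rw [h3] at h4
    exact absurd (lt_of_le_of_lt (Valuation.map_sub _ _ _) (max_lt h2 h1)) (not_lt.mpr h4)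
  refine ⟨σ₁, fun s s' hs hs' σ σ' hσ hσ' => ?_⟩
  have hsr : ∀ τ, s' (r τ) = r (σ * τ) := by
    intro τ
    obtain ⟨y, hy, hy'⟩ := hs (ρ τ)
    rw [hr]
    dsimp only
    rw [← hy']
    congr 1
    apply Subtype.ext
    rw [hy, hρ, hρ, hσ]; rfl
  have hsr1 : s' (red (ρ₁ 1)) = red (ρ₁ σ') := by
    obtain ⟨y, hy, hy'⟩ := hs (ρ₁ 1)
    rw [← hy']
    congr 1
    apply Subtype.ext
    rw [hy, hρ₁, hρ₁]
    exact hσ' θ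
  have hε_e : Valued.v (red (ρ₁ 1) - r 1) < Valued.v e := hclose 1
  -- The root at `b₁` with label `σ'` is close to `r σ'` by continuity, and close to `r σ` because
  -- it is the image under the isometry `s'` of a root close to `r 1`.
  have h1 : r σ = r σ' := by
    refine heq σ σ' (red (ρ₁ σ')) ?_ (hclose σ')
    have : red (ρ₁ σ') - r σ = s' (red (ρ₁ 1) - r 1) := by
      rw [map_sub, hsr1, hsr, mul_one]
    rw [this, hs']
    exact hε_e
  -- Only `r 1` is known to be different from all other roots, so the equality is carried back to
  -- it.
  have h2 : s' (r 1) = s' (r (σ⁻¹ * σ')) := by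
    rw [hsr, hsr, mul_one, mul_inv_cancel_left, h1]
  have h3 := hr1 _ (s'.injective h2).symm
  exact (inv_mul_eq_one.mp h3)

end

section

/-! ### Elements with trivial stabilizer in an unramified residue extension -/

section Separating

variable {K L : Type*} [Field K] [Field L] [Algebra K L] [FiniteDimensional K L] [IsGalois K L]
  (V : ValuationSubring K)

section Unramified

variable [IsDiscreteValuationRing V]

theorem isNoetherianRing_integralClosure : IsNoetherianRing (integralClosure V L) := by
  have := IsIntegralClosure.isNoetherian V K L (integralClosure V L)
  exact isNoetherian_of_tower V this

/-- Triviality of inertia: `τ` extends to an endomorphism of the local ring at `Q` that is the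
identity modulo the maximal ideal. Formal unramifiedness lifts this equality modulo all powers, and
Krull's intersection theorem makes the endomorphism the identity. -/
theorem eq_one_of_forall_sub_mem (Q : Ideal (integralClosure V L)) [Q.IsPrime]
    [Algebra.IsUnramifiedAt V Q] (τ : L ≃ₐ[K] L)
    (h : ∀ b, galRestrict V K L (integralClosure V L) τ b - b ∈ Q) : τ = 1 := by
  set t : (integralClosure V L) ≃ₐ[V] (integralClosure V L) := galRestrict V K L (integralClosure V L) τ with ht
  have := isNoetherianRing_integralClosure (L := L) V
  have : IsNoetherianRing (Localization.AtPrime Q) :=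
    IsLocalization.isNoetherianRing Q.primeCompl _ inferInstance
  have hunit : ∀ y : Q.primeCompl,
      IsUnit (((IsScalarTower.toAlgHom V (integralClosure V L) (Localization.AtPrime Q)).comp t.toAlgHom) y) := by
    intro y
    have : t y ∈ Q.primeCompl := fun hy => y.2 <| by
      have := sub_mem hy (h y)
      rwa [sub_sub_cancel] at this
    exact IsLocalization.map_units (Localization.AtPrime Q) (⟨_, this⟩ : Q.primeCompl)
  let g : Localization.AtPrime Q →ₐ[V] Localization.AtPrime Q :=
    IsLocalization.liftAlgHom (M := Q.primeCompl) hunit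
  have hg : ∀ b : (integralClosure V L), g (algebraMap (integralClosure V L) _ b) = algebraMap (integralClosure V L) _ (t b) := fun b =>
    IsLocalization.lift_eq _ _
  have hgid : g = AlgHom.id V _ := by
    refine Algebra.FormallyUnramified.ext_of_iInf (R := V) (A := Localization.AtPrime Q)
      (B := Localization.AtPrime Q)
      (IsLocalRing.maximalIdeal (Localization.AtPrime Q))
      (Ideal.iInf_pow_eq_bot_of_isLocalRing _ (Ideal.IsPrime.ne_top inferInstance)) fun x => ?_
    let π := Ideal.Quotient.mk (R := Localization.AtPrime Q) (IsLocalRing.maximalIdeal (Localization.AtPrime Q))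
    have : RingHom.comp π (g : Localization.AtPrime Q →+* Localization.AtPrime Q) = π := by
      refine IsLocalization.ringHom_ext Q.primeCompl (RingHom.ext fun b => ?_)
      change π (g (algebraMap (integralClosure V L) _ b)) =
        π (algebraMap (integralClosure V L) _ b)
      rw [hg, Ideal.Quotient.mk_eq_mk_iff_sub_mem]
      have h1 := (IsLocalization.AtPrime.to_map_mem_maximal_iff (Localization.AtPrime Q) Q _).mpr (h b)
      rwa [map_sub (algebraMap (integralClosure V L) (Localization.AtPrime Q))] at h1
    exact congrArg (fun f => f x) this
  have hb : ∀ b : (integralClosure V L), t b = b := by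
    intro b
    refine IsLocalization.injective (Localization.AtPrime Q) Q.primeCompl_le_nonZeroDivisors ?_
    rw [← hg, hgid]; rfl
  have : t = 1 := AlgEquiv.ext hb
  exact (map_eq_one_iff _ (galRestrict V K L (integralClosure V L)).injective).mp this

/-- The residue extension of an unramified maximal ideal is generated by one element. -/
theorem exists_residue_generator (Q : Ideal (integralClosure V L)) [Q.IsMaximal]
    [Algebra.IsUnramifiedAt V Q] : ∃ θ : integralClosure V L, θ ∉ Q ∧
      ∀ b, ∃ P : Polynomial V, b - Polynomial.aeval θ P ∈ Q := by
  have := IsIntegralClosure.finite V K L (integralClosure V L)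
  obtain ⟨p, hpQ⟩ : ∃ p, p = Q.under V := ⟨_, rfl⟩
  have hp : p.IsMaximal := hpQ ▸ Ideal.isMaximal_comap_of_isIntegral_of_isMaximal Q
  have : Q.LiesOver p := ⟨hpQ⟩
  let := Localization.AtPrime.algebraOfLiesOver p Q
  obtain ⟨y, hy⟩ := Field.exists_primitive_element p.ResidueField Q.ResidueField
  obtain ⟨θ, rfl⟩ := Ideal.algebraMap_residueField_surjective Q y
  have hgen : ∀ b, ∃ P : Polynomial V, b - Polynomial.aeval θ P ∈ Q := by
    intro b
    have hb : algebraMap _ Q.ResidueField b ∈ IntermediateField.adjoin p.ResidueField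
      {algebraMap _ Q.ResidueField θ} := by rw [hy]; trivial
    rw [← IntermediateField.mem_toSubalgebra, IntermediateField.adjoin_simple_toSubalgebra_of_isAlgebraic
      (Algebra.IsAlgebraic.isAlgebraic _), Algebra.adjoin_singleton_eq_range_aeval] at hb
    obtain ⟨P, hP⟩ := hb
    obtain ⟨P', rfl⟩ := Polynomial.map_surjective _ (Ideal.algebraMap_residueField_surjective p) P
    refine ⟨P', ?_⟩
    rw [← Ideal.algebraMap_residueField_eq_zero, map_sub, sub_eq_zero, ← hP]
    change Polynomial.aeval _ _ = _
    rw [Polynomial.aeval_map_algebraMap, ← Polynomial.aeval_algebraMap_apply]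
  by_cases hθ : θ ∈ Q
  · refine ⟨θ + 1, fun h => ?_, fun b => ?_⟩
    · refine ‹Q.IsMaximal›.ne_top ((Ideal.eq_top_iff_one _).mpr ?_)
      have := sub_mem h hθ
      rwa [add_sub_cancel_left] at this
    · obtain ⟨P, hP⟩ := hgen b
      refine ⟨P.comp (Polynomial.X - 1), ?_⟩
      rw [Polynomial.aeval_comp]
      simpa using hP
  · exact ⟨θ, hθ, hgen⟩

/-- The element is chosen to generate the residue field at `Q`, to be nonzero there, and to vanish
at all conjugates of `Q` other than `Q`. If `τ` stabilizes `Q` and fixes the reduction, then it acts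
trivially on the residue field, so it is 1 by triviality of inertia. If `τ` moves `Q`, then the
conjugate lies in `Q` and the element does not. -/
theorem exists_separating_element (Q : Ideal (integralClosure V L)) [Q.IsMaximal]
    [Algebra.IsUnramifiedAt V Q] : ∃ θ : integralClosure V L,
      ∀ τ : L ≃ₐ[K] L, τ ≠ 1 → galRestrict V K L (integralClosure V L) τ θ - θ ∉ Q := by
  classical
  obtain ⟨θ₀, hθ₀, hgen⟩ := exists_residue_generator (L := L) V Q
  let t : (L ≃ₐ[K] L) → (integralClosure V L) ≃ₐ[V] (integralClosure V L) := galRestrict V K L (integralClosure V L)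
  let m : (L ≃ₐ[K] L) → Ideal (integralClosure V L) := fun τ => Q.comap (t τ)
  have hmax : ∀ τ, (m τ).IsMaximal := fun τ =>
    Ideal.comap_isMaximal_of_surjective _ (t τ).surjective
  let T := Finset.univ.filter fun τ => m τ ≠ Q
  have hT : ¬ T.inf m ≤ Q := by
    rw [(inferInstance : Q.IsPrime).inf_le']
    rintro ⟨τ, hτ, hle⟩
    exact (Finset.mem_filter.mp hτ).2 ((hmax τ).eq_of_le (Ideal.IsPrime.ne_top inferInstance) hle)
  obtain ⟨z, hzT, hz⟩ := SetLike.not_le_iff_exists.mp hT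
  obtain ⟨c, i, hi, hci⟩ := ‹Q.IsMaximal›.exists_inv hz
  have hx1 : c * z - 1 ∈ Q := by
    have : c * z - 1 = -i := by rw [← hci]; ring
    rw [this]; exact neg_mem hi
  -- The factor `c * z` is 1 modulo `Q` and lies in every other conjugate of `Q`.
  set θ := c * z * θ₀ with hθ
  have hθθ₀ : θ - θ₀ ∈ Q := by
    have : θ - θ₀ = (c * z - 1) * θ₀ := by rw [hθ]; ring
    rw [this]; exact Ideal.mul_mem_right _ _ hx1
  have hdvd : ∀ (x y : integralClosure V L) (P : Polynomial V), x - y ∈ Q →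
      Polynomial.aeval x P - Polynomial.aeval y P ∈ Q := by
    intro x y P hxy
    rw [Polynomial.aeval_def, Polynomial.aeval_def, ← Polynomial.eval_map, ← Polynomial.eval_map]
    exact Ideal.mem_of_dvd _ (Polynomial.sub_dvd_eval_sub x y _) hxy
  refine ⟨θ, fun τ hτ hmem => ?_⟩
  by_cases hτQ : m τ = Q
  · refine hτ (eq_one_of_forall_sub_mem V Q τ fun b => ?_)
    obtain ⟨P, hP⟩ := hgen b
    have hP' : b - Polynomial.aeval θ P ∈ Q := by
      have h1 : Polynomial.aeval θ P - Polynomial.aeval θ₀ P ∈ Q := hdvd θ θ₀ P hθθ₀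
      have := sub_mem hP h1
      rwa [sub_sub_sub_cancel_right] at this
    have h2 : t τ (b - Polynomial.aeval θ P) ∈ Q := by
      rw [← hτQ] at hP'
      exact hP'
    have h3 : Polynomial.aeval (t τ θ) P - Polynomial.aeval θ P ∈ Q := hdvd _ _ P hmem
    have h4 : t τ b - b = t τ (b - Polynomial.aeval θ P) +
        (Polynomial.aeval (t τ θ) P - Polynomial.aeval θ P) - (b - Polynomial.aeval θ P) := by
      have h5 := Polynomial.aeval_algHom_apply (t τ) θ P
      rw [map_sub, ← h5]; ring
    change t τ b - b ∈ Q
    rw [h4]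
    exact sub_mem (add_mem h2 h3) hP'
  · have h1 : t τ θ ∈ Q := by
      have hle : T.inf m ≤ m τ := Finset.inf_le (Finset.mem_filter.mpr ⟨Finset.mem_univ _, hτQ⟩)
      have : θ ∈ m τ := Ideal.mul_mem_right _ _ (Ideal.mul_mem_left _ _ (hle hzT))
      exact this
    have h2 : θ ∈ Q := by
      have := sub_mem h1 hmem
      rwa [sub_sub_cancel] at this
    exact hθ₀ (by have := sub_mem h2 hθθ₀; rwa [sub_sub_cancel] at this)

end Unramified

open Polynomial in
theorem mem_lifts_of_invariant {p : L[X]} (hp : p ∈ lifts (algebraMap (integralClosure V L) L))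
    (hinv : ∀ τ : L ≃ₐ[K] L, p.map (τ : L →+* L) = p) : p ∈ lifts (algebraMap V L) := by
  rw [lifts_iff_coeff_lifts] at hp ⊢
  intro n
  obtain ⟨c, hc⟩ := hp n
  have h1 : p.coeff n ∈ Set.range (algebraMap K L) := by
    rw [IsGalois.mem_range_algebraMap_iff_fixed]
    intro τ
    have := congrArg (fun q => q.coeff n) (hinv τ)
    simpa using this
  obtain ⟨x, hx⟩ := h1
  have h2 : IsIntegral V x := by
    rw [← isIntegral_algebraMap_iff (algebraMap K L).injective, hx, ← hc]
    exact c.2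
  obtain ⟨o, ho⟩ := IsIntegrallyClosed.algebraMap_eq_of_integral h2
  exact ⟨o, by rw [IsScalarTower.algebraMap_apply V K L, ho, hx]⟩

-- Lagrange interpolation: `g σ` is the sum over `τ` of `τ σ θ` times the product of the factors `X
-- - τ' θ` with `τ' ≠ τ`. It is Galois invariant with integral coefficients, so it descends to `V`,
-- and at `θ` only the summand of `τ = 1` survives. Writing `σ θ` as a quotient by `F'(θ)` keeps the
-- coefficients in `V`.
open Polynomial in
theorem exists_polynomials (θ : integralClosure V L) [Fintype (L ≃ₐ[K] L)] :
    ∃ (F : V[X]) (g : (L ≃ₐ[K] L) → V[X]),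
      F.map (algebraMap V L) = ∏ τ : L ≃ₐ[K] L, (X - C (τ θ)) ∧
      ∀ σ : L ≃ₐ[K] L, aeval (θ : L) (g σ) = σ θ * aeval (θ : L) (derivative F) := by
  classical
  have hint : ∀ τ : L ≃ₐ[K] L, IsIntegral V (τ θ) := fun τ =>
    IsIntegral.map (τ.toAlgHom.restrictScalars V) θ.2
  have hlin : ∀ τ : L ≃ₐ[K] L, X - C (τ (θ : L)) ∈ lifts (algebraMap (integralClosure V L) L) := fun τ =>
    (mem_lifts _).mpr ⟨X - C ⟨_, hint τ⟩, by simp⟩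
  have hlin' : ∀ ρ τ : L ≃ₐ[K] L,
      (X - C (τ (θ : L))).map (ρ : L →+* L) = X - C ((ρ * τ) (θ : L)) := fun ρ τ => by simp
  have h1 : ∏ τ : L ≃ₐ[K] L, (X - C (τ (θ : L))) ∈ lifts (algebraMap V L) := by
    refine mem_lifts_of_invariant V (prod_mem fun τ _ => hlin τ) fun ρ => ?_
    rw [Polynomial.map_prod]
    simp_rw [hlin']
    exact Fintype.prod_equiv (Equiv.mulLeft ρ) _ _ fun τ => rfl
  have h2 : ∀ σ : L ≃ₐ[K] L, ∑ τ : L ≃ₐ[K] L, C ((τ * σ) (θ : L)) *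
      ∏ τ' ∈ Finset.univ.erase τ, (X - C (τ' (θ : L))) ∈ lifts (algebraMap V L) := by
    intro σ
    refine mem_lifts_of_invariant V (sum_mem fun τ _ => mul_mem ?_ (prod_mem fun τ' _ => hlin τ'))
      fun ρ => ?_
    · exact (mem_lifts _).mpr ⟨C ⟨_, hint (τ * σ)⟩, by simp⟩
    · rw [Polynomial.map_sum]
      refine Fintype.sum_equiv (Equiv.mulLeft ρ) _ _ fun τ => ?_
      rw [Polynomial.map_mul, Polynomial.map_prod]
      simp_rw [hlin']
      congr 1
      · simp
      · refine Finset.prod_bij (fun τ' _ => ρ * τ') ?_ ?_ ?_ ?_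
        · intro τ' hτ'
          simpa using hτ'
        · intro a _ b _ h
          exact mul_left_cancel h
        · intro b hb
          refine ⟨ρ⁻¹ * b, ?_, by simp⟩
          simp only [Equiv.coe_mulLeft, Finset.mem_erase, Finset.mem_univ, and_true] at hb ⊢
          rintro rfl
          exact hb (by simp)
        · intro τ' _; rfl
  obtain ⟨F, hF⟩ := (mem_lifts _).mp h1
  choose g hg using fun σ => (mem_lifts _).mp (h2 σ)
  refine ⟨F, g, hF, fun σ => ?_⟩
  have e1 : aeval (θ : L) (derivative F) =
      ∏ τ' ∈ Finset.univ.erase (1 : L ≃ₐ[K] L), ((θ : L) - τ' (θ : L)) := by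
    rw [aeval_def, ← Polynomial.eval_map, ← derivative_map, hF,
      ← Finset.mul_prod_erase _ _ (Finset.mem_univ (1 : L ≃ₐ[K] L)), derivative_mul]
    simp [eval_prod]
  rw [e1, aeval_def, ← Polynomial.eval_map, hg, eval_finsetSum,
    Finset.sum_eq_single (1 : L ≃ₐ[K] L)]
  · simp [eval_prod]
  · intro τ _ hτ
    rw [eval_mul, eval_prod, Finset.prod_eq_zero (i := (1 : L ≃ₐ[K] L)), mul_zero]
    · exact Finset.mem_erase.mpr ⟨hτ.symm, Finset.mem_univ _⟩
    · simp
  · simp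

end Separating

theorem exists_common_denominator {A K ι : Type*} [CommRing A] [Field K] [Algebra A K]
    (V : ValuationSubring K)
    (hloc : ∀ x ∈ V, ∃ c d : A, V.valuation (algebraMap A K d) = 1 ∧
      algebraMap A K d * x = algebraMap A K c) (s : Finset ι) (f : ι → V) :
    ∃ d : A, V.valuation (algebraMap A K d) = 1 ∧
      ∀ i ∈ s, ∃ c, algebraMap A K c = algebraMap A K d * f i := by
  classical
  induction s using Finset.induction_on with
  | empty => exact ⟨1, by simp, by simp⟩
  | insert i s _ ih =>
    obtain ⟨d, hd, h⟩ := ih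
    obtain ⟨c', d', hd', h'⟩ := hloc (f i) (f i).2
    refine ⟨d * d', by rw [map_mul, map_mul, hd, hd', one_mul], fun j hj => ?_⟩
    rcases Finset.mem_insert.mp hj with rfl | hj
    · exact ⟨d * c', by rw [map_mul, map_mul, mul_assoc, h']⟩
    · obtain ⟨c, hc⟩ := h j hj
      exact ⟨d' * c, by rw [map_mul, map_mul, hc]; ring⟩

open Polynomial in
/-- The data for `exists_isOpen_forall_conj` over a ring `A` of which `V` is a localization. -/
theorem exists_generic_root {A K L : Type*} [CommRing A] [Field K] [Field L] [Algebra A K]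
    [Algebra K L] [Algebra A L] [IsScalarTower A K L] [FiniteDimensional K L] [IsGalois K L]
    [Fintype (L ≃ₐ[K] L)]
    (V : ValuationSubring K) [IsDiscreteValuationRing V] (hunr : IsUnramifiedIn V L)
    (hloc : ∀ x ∈ V, ∃ c d : A, V.valuation (algebraMap A K d) = 1 ∧
      algebraMap A K d * x = algebraMap A K c)
    (Q : Ideal (integralClosure V L)) [Q.IsMaximal] :
    ∃ (θ : L) (d : A) (F : A[X]) (g : (L ≃ₐ[K] L) → A[X]),
      V.valuation (algebraMap A K d) = 1 ∧
      F.map (algebraMap A L) = C (algebraMap A L d) * ∏ τ : L ≃ₐ[K] L, (X - C (τ θ)) ∧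
      (∀ σ, aeval θ (g σ) = σ θ * aeval θ (derivative F)) ∧
      ∀ τ : L ≃ₐ[K] L, τ ≠ 1 →
        ∃ y : integralClosure V L, (y : L) = τ θ - θ ∧ y ∉ Q := by
  classical
  have := hunr Q
  obtain ⟨θ, hθ⟩ := exists_separating_element (L := L) V Q
  obtain ⟨F, g, hF, hg⟩ := exists_polynomials V θ
  let N := (insert F (Finset.univ.image g)).sup natDegree
  have hN : ∀ p ∈ insert F (Finset.univ.image g), p.natDegree ≤ N := fun p hp => Finset.le_sup hp
  obtain ⟨d, hd, hd'⟩ := exists_common_denominator V hloc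
    ((insert F (Finset.univ.image g)) ×ˢ Finset.range (N + 1))
    (fun q : V[X] × ℕ => q.1.coeff q.2)
  have hdesc : ∀ p ∈ insert F (Finset.univ.image g),
      ∃ q : A[X], q.map (algebraMap A K) = (C (algebraMap A K d) * p.map (algebraMap V K)) := by
    intro p hp
    rw [← mem_lifts, lifts_iff_coeff_lifts]
    intro n
    rw [coeff_C_mul, coeff_map]
    by_cases hn : n ≤ N
    · obtain ⟨c, hc⟩ := hd' (p, n) (Finset.mem_product.mpr ⟨hp, Finset.mem_range.mpr (by omega)⟩)
      exact ⟨c, hc⟩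
    · rw [coeff_eq_zero_of_natDegree_lt (lt_of_le_of_lt (hN p hp) (not_le.mp hn))]
      exact ⟨0, by simp⟩
  obtain ⟨FA, hFA⟩ := hdesc F (Finset.mem_insert_self _ _)
  choose gA hgA using fun σ => hdesc (g σ)
    (Finset.mem_insert_of_mem (Finset.mem_image_of_mem _ (Finset.mem_univ σ)))
  have hmapL : ∀ (q : A[X]) (p : V[X]),
      q.map (algebraMap A K) = C (algebraMap A K d) * p.map (algebraMap V K) →
      q.map (algebraMap A L) = C (algebraMap A L d) * p.map (algebraMap V L) := by
    intro q p h
    have := congrArg (Polynomial.map (algebraMap K L)) h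
    rw [Polynomial.map_map, Polynomial.map_mul, Polynomial.map_map, map_C,
      ← IsScalarTower.algebraMap_eq, ← IsScalarTower.algebraMap_eq,
      ← IsScalarTower.algebraMap_apply] at this
    exact this
  refine ⟨θ, d, FA, gA, hd, ?_, fun σ => ?_, fun τ hτ => ⟨_, ?_, hθ τ hτ⟩⟩
  · rw [hmapL FA F hFA, hF]
  · have h1 : aeval (θ : L) (gA σ) = algebraMap A L d * aeval (θ : L) (g σ) := by
      rw [aeval_def, ← Polynomial.eval_map, hmapL _ _ (hgA σ), eval_mul, eval_C,
        Polynomial.eval_map, ← aeval_def]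
    have h2 : aeval (θ : L) (derivative FA) =
        algebraMap A L d * aeval (θ : L) (derivative F) := by
      rw [aeval_def, ← Polynomial.eval_map, ← derivative_map, hmapL _ _ hFA, derivative_C_mul,
        eval_mul, eval_C, derivative_map, Polynomial.eval_map, ← aeval_def]
    rw [h1, h2, hg]; ring
  · rw [AddSubgroupClass.coe_sub]
    congr 1
    exact algebraMap_galRestrict_apply V τ θ

end

section

/-! ### Coefficient fields -/

-- A section is found by Zorn's lemma among subrings that contain all `p`-th powers and meet the
-- kernel trivially; the image of Frobenius is one. A maximal such `S` maps isomorphically onto a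
-- subfield. If `f a` were outside the subfield, `X ^ p - f a ^ p` would be irreducible over it, and
-- adjoining `a` to `S` would give a larger subring of the same kind.
open Polynomial in
theorem exists_section_of_pow_eq_zero {A F : Type*} [CommRing A] [Field F] (p : ℕ)
    [Fact p.Prime] [CharP A p] (f : A →+* F) (hf : Function.Surjective f)
    (hker : ∀ x, f x = 0 → x ^ p = 0) : ∃ g : F →+* A, f.comp g = RingHom.id F := by
  have hp : p.Prime := Fact.out
  have : CharP F p := (CharP.charP_iff_prime_eq_zero hp).mpr (by
    rw [← map_natCast f, CharP.cast_eq_zero, map_zero])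
  let 𝒮 : Set (Subring A) := {S | (∀ a, a ^ p ∈ S) ∧ ∀ x ∈ S, f x = 0 → x = 0}
  have h0 : (frobenius A p).range ∈ 𝒮 := by
    refine ⟨fun a => ⟨a, rfl⟩, ?_⟩
    rintro _ ⟨a, rfl⟩ ha
    rw [frobenius_def] at ha ⊢
    refine hker a ?_
    rw [map_pow] at ha
    exact eq_zero_of_pow_eq_zero ha
  obtain ⟨S, -, hS, hmax⟩ := zorn_le_nonempty₀ 𝒮 (by
    intro c hc hchain y hy
    refine ⟨sSup c, ⟨fun a => (le_sSup hy : y ≤ sSup c) ((hc hy).1 a), fun x hx => ?_⟩,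
      fun z hz => le_sSup hz⟩
    obtain ⟨z, hz, hxz⟩ := (Subring.mem_sSup_of_directedOn ⟨y, hy⟩ hchain.directedOn).mp hx
    exact (hc hz).2 x hxz) _ h0
  have hinv : ∀ x ∈ S, x ≠ 0 → ∃ y ∈ S, x * y = 1 := by
    intro x hx hx0
    have hfx : f x ≠ 0 := fun h => hx0 (hS.2 x hx h)
    obtain ⟨a, ha⟩ := hf (f x)⁻¹
    refine ⟨x ^ (p - 1) * a ^ p, S.mul_mem (S.pow_mem hx _) (hS.1 a), ?_⟩
    have h1 : (x * a - 1) ^ p = 0 := hker _ (by rw [map_sub, map_mul, ha, map_one,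
      mul_inv_cancel₀ hfx, sub_self])
    rw [sub_pow_char, one_pow, sub_eq_zero, mul_pow] at h1
    rw [← mul_assoc, ← pow_succ', Nat.sub_add_cancel hp.one_le, h1]
  let F₀ : Subfield F := { S.map f with
    inv_mem' := by
      rintro _ ⟨x, hx, rfl⟩
      by_cases hx0 : x = 0
      · exact ⟨0, S.zero_mem, by simp [hx0]⟩
      · obtain ⟨y, hy, hxy⟩ := hinv x hx hx0
        exact ⟨y, hy, eq_inv_of_mul_eq_one_right (by rw [← map_mul, hxy, map_one])⟩ }
  have hF₀ : ∀ x, x ∈ F₀ ↔ ∃ y ∈ S, f y = x := fun x => Iff.rfl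
  let fS : S →+* F₀ := f.restrict S F₀ fun x hx => ⟨x, hx, rfl⟩
  have hfS : Function.Injective fS := (injective_iff_map_eq_zero _).mpr fun x hx =>
    Subtype.ext (hS.2 x x.2 (congrArg Subtype.val hx))
  have : Nontrivial S := fS.domain_nontrivial
  have hsurj : ∀ y : F, y ∈ F₀ := by
    intro y
    by_contra hy
    obtain ⟨a, rfl⟩ := hf y
    have hirr : Irreducible (X ^ p - C (fS ⟨a ^ p, hS.1 a⟩)) := by
      refine X_pow_sub_C_irreducible_of_prime hp fun b hb => hy ?_
      have h1 : (b : F) ^ p = f a ^ p := by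
        rw [← map_pow f]; exact congrArg Subtype.val hb
      rw [← frobenius_inj F p h1]
      exact b.2
    have hmin : minpoly F₀ (f a) = X ^ p - C (fS ⟨a ^ p, hS.1 a⟩) := by
      refine (minpoly.eq_of_irreducible_of_monic hirr ?_ (monic_X_pow_sub_C _ hp.ne_zero)).symm
      rw [map_sub, map_pow, aeval_X, aeval_C, ← map_pow f, sub_eq_zero]
      rfl
    let S' : Subring A := (eval₂RingHom S.subtype a).range
    have hSS' : S ≤ S' := fun x hx => ⟨C ⟨x, hx⟩, by simp⟩
    have hS' : S' ∈ 𝒮 := by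
      refine ⟨fun b => hSS' (hS.1 b), ?_⟩
      rintro _ ⟨P, rfl⟩ hP
      let D : S[X] := X ^ p - C ⟨a ^ p, hS.1 a⟩
      have hD : D.Monic := monic_X_pow_sub_C _ hp.ne_zero
      have hDa : eval₂RingHom S.subtype a D = 0 := by simp [D]
      have hPR : eval₂RingHom S.subtype a P = eval₂RingHom S.subtype a (P %ₘ D) := by
        conv_lhs => rw [← modByMonic_add_div P D]
        rw [map_add, map_mul, hDa, zero_mul, add_zero]
      rw [hPR] at hP ⊢
      -- The remainder has degree below `p`, the degree of the minimal polynomial of `f a`, and its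
      -- image vanishes at `f a`.
      have h2 : (P %ₘ D).map fS = 0 := by
        by_contra hne
        have h3 : aeval (f a) ((P %ₘ D).map fS) = 0 := by
          rw [← hP, aeval_def, eval₂_map, coe_eval₂RingHom, hom_eval₂]
          rfl
        have h4 := minpoly.degree_le_of_ne_zero F₀ (f a) hne h3
        rw [hmin, degree_X_pow_sub_C hp.pos, degree_map_eq_of_injective hfS] at h4
        have h5 := degree_modByMonic_lt P hD
        rw [degree_X_pow_sub_C hp.pos] at h5
        exact absurd h4 (not_le.mpr h5)
      rw [(map_eq_zero_iff (mapRingHom fS) (map_injective fS hfS)).mp h2, map_zero]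
    have : a ∈ S := hmax hS' hSS' ⟨X, by simp⟩
    exact hy ⟨a, this, rfl⟩
  have hbij : Function.Bijective (f.comp S.subtype) := by
    refine ⟨(injective_iff_map_eq_zero _).mpr fun x hx => Subtype.ext (hS.2 x x.2 hx), fun y => ?_⟩
    obtain ⟨x, hx, rfl⟩ := hsurj y
    exact ⟨⟨x, hx⟩, rfl⟩
  let E := RingEquiv.ofBijective _ hbij
  exact ⟨S.subtype.comp E.symm.toRingHom, RingHom.ext fun x => E.apply_symm_apply x⟩

/-- Present the field as a quotient of the polynomial ring on its elements. Modulo the square of the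
kernel `I`, elements of `I` have vanishing `p`-th power since `p ≥ 2`, so the previous lemma splits
the square-zero extension. Any ring section is linear over the prime field. -/
theorem formallySmooth_zmod (p : ℕ) [Fact p.Prime] (F : Type*) [Field F] [Algebra (ZMod p) F] :
    Algebra.FormallySmooth (ZMod p) F := by
  let P := MvPolynomial F (ZMod p)
  let f : P →ₐ[ZMod p] F := MvPolynomial.aeval id
  let A := P ⧸ RingHom.ker f.toRingHom ^ 2
  have hf : Function.Surjective f.kerSquareLift := fun x =>
    ⟨Ideal.Quotient.mk _ (MvPolynomial.X x), by
      rw [AlgHom.kerSquareLift_mk]; exact MvPolynomial.aeval_X _ _⟩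
  have : Nontrivial A := hf.nontrivial
  have : CharP A p := charP_of_injective_algebraMap (algebraMap (ZMod p) A).injective p
  obtain ⟨g, hg⟩ := exists_section_of_pow_eq_zero p (f.kerSquareLift : A →+* F) hf (by
    intro x hx
    obtain ⟨x, rfl⟩ := Ideal.Quotient.mk_surjective x
    have hx' : x ∈ RingHom.ker f.toRingHom := (AlgHom.kerSquareLift_mk f x).symm.trans hx
    rw [← map_pow, Ideal.Quotient.eq_zero_iff_mem]
    exact Ideal.pow_le_pow_right (Fact.out : p.Prime).two_le (Ideal.pow_mem_pow hx' p))
  refine Algebra.FormallySmooth.of_split f ⟨g, fun r => ?_⟩ (AlgHom.ext fun x => RingHom.congr_fun hg x)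
  exact RingHom.congr_fun (Subsingleton.elim (g.comp (algebraMap (ZMod p) F)) (algebraMap (ZMod p) A)) r

/-- In characteristic zero a field is separable algebraic over the field generated by a
transcendence basis. -/
theorem formallySmooth_rat (F : Type*) [Field F] [Algebra ℚ F] : Algebra.FormallySmooth ℚ F := by
  obtain ⟨s, hs⟩ := exists_isTranscendenceBasis ℚ F
  have := hs.isAlgebraic_field
  exact .of_algebraicIndependent_of_isSeparable hs.1

/-- Coefficient fields exist in equal characteristic. -/
theorem exists_coefficientField (k : Type*) {R : Type*} [Field k] [CommRing R] [Algebra k R]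
    (I : Ideal R) [I.IsMaximal] [IsAdicComplete I R] :
    ∃ g : R ⧸ I →+* R, ∀ x, Ideal.Quotient.mk I (g x) = x := by
  let := Ideal.Quotient.field I
  rcases CharP.exists k with ⟨p, hp⟩
  rcases CharP.char_is_prime_or_zero k p with hp' | rfl
  · have : Fact p.Prime := ⟨hp'⟩
    let := ZMod.algebra k p
    let : Algebra (ZMod p) R := ((algebraMap k R).comp (algebraMap (ZMod p) k)).toAlgebra
    have := formallySmooth_zmod p (R ⧸ I)
    obtain ⟨g, hg⟩ := Algebra.FormallySmooth.exists_mkₐ_comp_eq_of_isAdicComplete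
      (I := I) (AlgHom.id (ZMod p) (R ⧸ I))
    exact ⟨g, fun x => AlgHom.congr_fun hg x⟩
  · have : CharZero k := CharP.charP_to_charZero k
    let : Algebra ℚ R := ((algebraMap k R).comp (algebraMap ℚ k)).toAlgebra
    have := formallySmooth_rat (R ⧸ I)
    obtain ⟨g, hg⟩ := Algebra.FormallySmooth.exists_mkₐ_comp_eq_of_isAdicComplete
      (I := I) (AlgHom.id ℚ (R ⧸ I))
    exact ⟨g, fun x => AlgHom.congr_fun hg x⟩

/-! ### Complete discrete valuation rings with a coefficient field -/

section PowerSeries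

variable {κ R : Type*} [Field κ] [CommRing R] [IsLocalRing R]
  [IsAdicComplete (IsLocalRing.maximalIdeal R) R] (s : κ →+* R) {π : R}

open Polynomial in
/-- The evaluation of power series at an element of the maximal ideal. -/
theorem exists_powerSeries_eval (hπ : π ∈ IsLocalRing.maximalIdeal R) :
    ∃ φ : PowerSeries κ →+* R, ∀ (f : PowerSeries κ) (n : ℕ) (P : κ[X]),
      PowerSeries.X ^ n ∣ f - (P : PowerSeries κ) → φ f - P.eval₂ s π ∈ IsLocalRing.maximalIdeal R ^ n := by
  set m := IsLocalRing.maximalIdeal R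
  have key : ∀ (n : ℕ) (P Q : κ[X]), PowerSeries.X ^ n ∣ (P - Q : PowerSeries κ) →
      P.eval₂ s π - Q.eval₂ s π ∈ m ^ n := by
    intro n P Q h
    have h1 : X ^ n ∣ P - Q := by
      rw [X_pow_dvd_iff]
      intro d hd
      have := PowerSeries.X_pow_dvd_iff.mp h d hd
      rwa [← Polynomial.coe_sub, Polynomial.coeff_coe] at this
    obtain ⟨T, hT⟩ := h1
    rw [← eval₂_sub, hT, eval₂_mul, eval₂_pow, eval₂_X]
    exact Ideal.mul_mem_right _ _ (Ideal.pow_mem_pow hπ n)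
  have htr : ∀ (f : PowerSeries κ) (n : ℕ), PowerSeries.X ^ n ∣ f - (PowerSeries.trunc n f : PowerSeries κ) := by
    intro f n
    refine PowerSeries.X_pow_dvd_iff.mpr fun d hd => ?_
    rw [map_sub, PowerSeries.coeff_coe_trunc_of_lt hd, sub_self]
  -- The value is the limit of the evaluated truncations. The congruence is required for every
  -- approximating polynomial, so that sums and products can be tested on sums and products of
  -- truncations.
  have hex : ∀ f : PowerSeries κ, ∃ x : R, ∀ (n : ℕ) (P : κ[X]),
      PowerSeries.X ^ n ∣ f - (P : PowerSeries κ) → x - P.eval₂ s π ∈ m ^ n := by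
    intro f
    obtain ⟨x, hx⟩ := IsPrecomplete.prec (I := m) (M := R) inferInstance
      (f := fun n => (PowerSeries.trunc n f).eval₂ s π) (by
        intro a b hab
        rw [SModEq.sub_mem, smul_eq_mul, Ideal.mul_top]
        refine key _ _ _ ?_
        have := dvd_sub ((pow_dvd_pow _ hab).trans (htr f b)) (htr f a)
        rwa [sub_sub_sub_cancel_left] at this)
    refine ⟨x, fun n P h => ?_⟩
    have h1 := hx n
    rw [SModEq.sub_mem, smul_eq_mul, Ideal.mul_top] at h1
    have h2 := key n (PowerSeries.trunc n f) P (by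
      have := dvd_sub h (htr f n)
      convert this using 1
      ring)
    have := sub_mem h2 h1
    have := add_mem (neg_mem h1) h2
    convert this using 1
    ring
  choose φ hφ using hex
  have hhaus : ∀ x y : R, (∀ n, x - y ∈ m ^ n) → x = y := by
    intro x y h
    refine IsHausdorff.eq_iff_smodEq (I := m).mpr fun n => ?_
    rw [SModEq.sub_mem, smul_eq_mul, Ideal.mul_top]
    exact h n
  refine ⟨{ toFun := φ, map_one' := ?_, map_mul' := ?_, map_zero' := ?_, map_add' := ?_ }, hφ⟩
  · refine hhaus _ _ fun n => ?_
    simpa using hφ 1 n 1 (by simp)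
  · intro f g
    refine hhaus _ _ fun n => ?_
    have h1 := hφ f n _ (htr f n)
    have h2 := hφ g n _ (htr g n)
    have h3 := hφ (f * g) n (PowerSeries.trunc n f * PowerSeries.trunc n g) (by
      have := dvd_add ((htr f n).mul_right g) ((htr g n).mul_left (PowerSeries.trunc n f : PowerSeries κ))
      convert this using 1
      push_cast
      ring)
    rw [eval₂_mul] at h3
    have := add_mem h3 (neg_mem (add_mem (Ideal.mul_mem_right (φ g) _ h1)
      (Ideal.mul_mem_left _ ((PowerSeries.trunc n f).eval₂ s π) h2)))
    convert this using 1
    ring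
  · refine hhaus _ _ fun n => ?_
    simpa using hφ 0 n 0 (by simp)
  · intro f g
    refine hhaus _ _ fun n => ?_
    have h1 := hφ f n _ (htr f n)
    have h2 := hφ g n _ (htr g n)
    have h3 := hφ (f + g) n (PowerSeries.trunc n f + PowerSeries.trunc n g) (by
      have := dvd_add (htr f n) (htr g n)
      convert this using 1
      push_cast
      ring)
    rw [eval₂_add] at h3
    have := add_mem h3 (neg_mem (add_mem h1 h2))
    convert this using 1
    ring

end PowerSeries

section Equiv

variable {κ R : Type*} [Field κ] [CommRing R] [IsDomain R] [IsDiscreteValuationRing R]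
  [IsAdicComplete (IsLocalRing.maximalIdeal R) R]

open Polynomial in
/-- A complete discrete valuation ring with a coefficient field is a ring of power series. -/
theorem exists_powerSeries_equiv (s : κ →+* R) (r : R →+* κ) (hr : ∀ x, r (s x) = x)
    (hker : RingHom.ker r = IsLocalRing.maximalIdeal R) :
    ∃ φ : PowerSeries κ ≃+* R, ∀ f, r (φ f) = PowerSeries.constantCoeff f := by
  obtain ⟨π, hπ⟩ := IsDiscreteValuationRing.exists_irreducible R
  have hm := hπ.maximalIdeal_eq
  have hπm : π ∈ IsLocalRing.maximalIdeal R := hm ▸ Ideal.mem_span_singleton_self π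
  obtain ⟨φ, hφ⟩ := exists_powerSeries_eval s hπm
  have hdvd : ∀ n (x : R), x ∈ IsLocalRing.maximalIdeal R ^ n ↔ π ^ n ∣ x := by
    intro n x
    rw [hm, Ideal.span_singleton_pow, Ideal.mem_span_singleton]
  have hhaus : ∀ x y : R, (∀ n, x - y ∈ IsLocalRing.maximalIdeal R ^ n) → x = y := by
    intro x y h
    refine IsHausdorff.eq_iff_smodEq (I := IsLocalRing.maximalIdeal R).mpr fun n => ?_
    rw [SModEq.sub_mem, smul_eq_mul, Ideal.mul_top]
    exact h n
  have hX : φ PowerSeries.X = π := by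
    refine hhaus _ _ fun n => ?_
    simpa using hφ PowerSeries.X n X (by simp)
  have hres : ∀ f, r (φ f) = PowerSeries.constantCoeff f := by
    intro f
    have h1 := hφ f 1 (C (PowerSeries.constantCoeff f)) (by
      rw [pow_one, PowerSeries.X_dvd_iff]; simp)
    rw [pow_one, ← hker, RingHom.mem_ker, map_sub, sub_eq_zero, eval₂_C, hr] at h1
    exact h1
  have hinj : Function.Injective φ := by
    refine (injective_iff_map_eq_zero _).mpr fun f hf => ?_
    by_contra hf0
    rw [← PowerSeries.X_pow_order_mul_divXPowOrder (f := f), map_mul, map_pow, hX] at hf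
    exact mul_ne_zero (pow_ne_zero _ hπ.ne_zero)
      ((PowerSeries.isUnit_divided_by_X_pow_order hf0).map φ).ne_zero hf
  have hsurj : Function.Surjective φ := by
    intro x
    have hstep : ∀ y : R, ∃ z, y = s (r y) + π * z := by
      intro y
      have : y - s (r y) ∈ IsLocalRing.maximalIdeal R := by
        rw [← hker, RingHom.mem_ker, map_sub, hr, sub_self]
      obtain ⟨z, hz⟩ := (hdvd 1 _).mp (by rwa [pow_one])
      exact ⟨z, by rw [← pow_one π, ← hz]; ring⟩
    choose t ht using hstep
    -- These are the digits of the `π`-adic expansion of `x` with respect to the coefficient field.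
    let a : ℕ → κ := fun n => r (t^[n] x)
    have hx : ∀ n, x = (PowerSeries.trunc n (PowerSeries.mk a)).eval₂ s π + π ^ n * t^[n] x := by
      intro n
      induction n with
      | zero => simp
      | succ n ih =>
        rw [PowerSeries.trunc_succ, eval₂_add, eval₂_monomial, PowerSeries.coeff_mk,
          Function.iterate_succ_apply']
        conv_lhs => rw [ih, ht (t^[n] x)]
        simp only [a]
        ring
    refine ⟨PowerSeries.mk a, hhaus _ _ fun n => ?_⟩
    have h1 := hφ (PowerSeries.mk a) n (PowerSeries.trunc n (PowerSeries.mk a)) (by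
      refine PowerSeries.X_pow_dvd_iff.mpr fun d hd => ?_
      rw [map_sub, PowerSeries.coeff_coe_trunc_of_lt hd, sub_self])
    have h2 : π ^ n * t^[n] x ∈ IsLocalRing.maximalIdeal R ^ n :=
      Ideal.mul_mem_right _ _ (Ideal.pow_mem_pow hπm n)
    have := add_mem h1 (neg_mem h2)
    convert this using 1
    conv_lhs => rw [hx n]
    ring
  exact ⟨RingEquiv.ofBijective φ ⟨hinj, hsurj⟩, hres⟩

end Equiv

/-- By the Frobenius identity each coefficient of `f ^ p ^ n` is a `p ^ n`-th power. The uniform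
exponent matters: it makes the extension of power series rings purely inseparable, although
infinitely many coefficients occur. -/
theorem pow_mem_range_map {κ₁ κ₂ : Type*} [Field κ₁] [Field κ₂] (h : κ₁ →+* κ₂) (p n : ℕ)
    [ExpChar κ₂ p] (hh : ∀ y, y ^ p ^ n ∈ h.range) (f : PowerSeries κ₂) :
    f ^ p ^ n ∈ (PowerSeries.map h).range := by
  have hc : ∀ i, ∃ d, h d = PowerSeries.coeff i (f ^ p ^ n) := by
    intro i
    have h1 : PowerSeries.coeff i (f ^ p ^ n) =
        ((PowerSeries.trunc (i + 1) f) ^ p ^ n).coeff i := by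
      rw [← PowerSeries.coeff_coe_trunc_of_lt (Nat.lt_succ_self i), ← PowerSeries.trunc_trunc_pow,
        PowerSeries.coeff_coe_trunc_of_lt (Nat.lt_succ_self i), ← Polynomial.coe_pow,
        Polynomial.coeff_coe]
    rw [h1, ← Polynomial.map_iterateFrobenius_expand p, Polynomial.coeff_map,
      iterateFrobenius_def]
    exact hh _
  choose d hd using hc
  refine ⟨PowerSeries.mk d, PowerSeries.ext fun i => ?_⟩
  rw [PowerSeries.coeff_map, PowerSeries.coeff_mk, hd]

/-- The field `k` serves only to force equal characteristic, so that a coefficient field exists; the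
isomorphism need not be `k`-linear. -/
theorem exists_powerSeries_equiv_of_surjective (k : Type*) {κ R : Type*} [Field k] [Field κ]
    [CommRing R] [IsDomain R] [IsDiscreteValuationRing R]
    [IsAdicComplete (IsLocalRing.maximalIdeal R) R] [Algebra k R] (r : R →+* κ)
    (hr : Function.Surjective r) :
    ∃ φ : PowerSeries κ ≃+* R, ∀ f, r (φ f) = PowerSeries.constantCoeff f := by
  have hker : RingHom.ker r = IsLocalRing.maximalIdeal R :=
    IsLocalRing.eq_maximalIdeal (RingHom.ker_isMaximal_of_surjective r hr)
  obtain ⟨g, hg⟩ := exists_coefficientField k (IsLocalRing.maximalIdeal R)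
  let E : R ⧸ IsLocalRing.maximalIdeal R ≃+* κ :=
    (Ideal.quotEquivOfEq hker.symm).trans (RingHom.quotientKerEquivOfSurjective hr)
  have hE : ∀ x, E (Ideal.Quotient.mk _ x) = r x := fun x => rfl
  refine exists_powerSeries_equiv (g.comp E.symm.toRingHom) r (fun x => ?_) hker
  rw [← hE]
  simp [hg]

/-- Lifting a purely inseparable residue field extension to complete discrete valuation rings. -/
theorem exists_lift_of_residue (k₁ k₂ : Type*) {κ₁ κ₂ R₁ R₂ : Type*} [Field k₁] [Field k₂]
    [Field κ₁] [Field κ₂] [CommRing R₁]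
    [IsDomain R₁] [IsDiscreteValuationRing R₁] [IsAdicComplete (IsLocalRing.maximalIdeal R₁) R₁]
    [CommRing R₂] [IsDomain R₂] [IsDiscreteValuationRing R₂]
    [IsAdicComplete (IsLocalRing.maximalIdeal R₂) R₂] [Algebra k₁ R₁] [Algebra k₂ R₂]
    (r₁ : R₁ →+* κ₁) (hr₁ : Function.Surjective r₁) (r₂ : R₂ →+* κ₂) (hr₂ : Function.Surjective r₂)
    (h : κ₁ →+* κ₂) (p n : ℕ) [ExpChar κ₂ p] (hh : ∀ y, y ^ p ^ n ∈ h.range) :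
    ∃ ψ : R₁ →+* R₂, Function.Injective ψ ∧ (∀ x, r₂ (ψ x) = h (r₁ x)) ∧
      ∀ y, y ^ p ^ n ∈ ψ.range := by
  obtain ⟨φ₁, h₁⟩ := exists_powerSeries_equiv_of_surjective k₁ r₁ hr₁
  obtain ⟨φ₂, h₂⟩ := exists_powerSeries_equiv_of_surjective k₂ r₂ hr₂
  refine ⟨(φ₂.toRingHom.comp (PowerSeries.map h)).comp φ₁.symm.toRingHom, ?_, fun x => ?_, fun y => ?_⟩
  · exact φ₂.injective.comp ((PowerSeries.map_injective h h.injective).comp φ₁.symm.injective)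
  · obtain ⟨f, rfl⟩ := φ₁.surjective x
    simp only [RingEquiv.toRingHom_eq_coe, RingHom.comp_apply, RingHom.coe_coe,
      RingEquiv.symm_apply_apply, h₁, h₂, ← PowerSeries.coeff_zero_eq_constantCoeff_apply,
      PowerSeries.coeff_map]
  · obtain ⟨f, rfl⟩ := φ₂.surjective y
    obtain ⟨g, hg⟩ := pow_mem_range_map h p n hh f
    exact ⟨φ₁ g, by simp [hg]⟩

end

section

/-! ### Complete discretely valued fields -/

section CompleteValued

variable {E Γ : Type*} [Field E] [LinearOrderedCommGroupWithZero Γ] [Valued E Γ] {π : E}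

variable (E Γ) in
abbrev valuedRing : ValuationSubring E := (Valued.v : Valuation E Γ).valuationSubring

theorem isUnit_valuedRing_iff {x : valuedRing E Γ} : IsUnit x ↔ Valued.v (x : E) = 1 := by
  refine ⟨fun ⟨u, hu⟩ => ?_, fun h => ?_⟩
  · have h1 : (u : valuedRing E Γ).1 * (u⁻¹ : (valuedRing E Γ)ˣ).1.1 = 1 := congrArg Subtype.val (Units.mul_inv u)
    have h2 := congrArg (Valued.v (R := E)) h1
    rw [map_mul, map_one] at h2
    have h3 : Valued.v (u : valuedRing E Γ).1 ≤ 1 := (u : valuedRing E Γ).2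
    have h4 : Valued.v (u⁻¹ : (valuedRing E Γ)ˣ).1.1 ≤ 1 := (u⁻¹ : (valuedRing E Γ)ˣ).1.2
    rw [← hu]
    refine le_antisymm h3 ?_
    rw [← h2]
    exact mul_le_of_le_one_right' h4
  · have h0 : (x : E) ≠ 0 := fun h0 => by simp [h0] at h
    refine IsUnit.of_mul_eq_one ⟨(x : E)⁻¹, ?_⟩ (Subtype.ext (mul_inv_cancel₀ h0))
    rw [Valuation.mem_valuationSubring_iff, map_inv₀, h, inv_one]

theorem valuedRing_dvd_iff {x y : valuedRing E Γ} : x ∣ y ↔ Valued.v (y : E) ≤ Valued.v (x : E) := by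
  refine ⟨?_, fun h => ?_⟩
  · rintro ⟨z, rfl⟩
    rw [MulMemClass.coe_mul, map_mul]
    exact mul_le_of_le_one_right' z.2
  · by_cases hx : (x : E) = 0
    · rw [hx, map_zero, le_zero_iff, Valuation.zero_iff] at h
      rw [show y = 0 from Subtype.ext h]
      exact dvd_zero x
    · refine ⟨⟨y / x, ?_⟩, Subtype.ext (mul_div_cancel₀ _ hx).symm⟩
      rw [Valuation.mem_valuationSubring_iff, map_div₀]
      exact div_le_one_of_le₀ h zero_le

theorem exists_valuation_eq_pow (hπ0 : π ≠ 0) (hπ1 : Valued.v π < 1)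
    (hval : ∀ x : E, x ≠ 0 → ∃ n : ℤ, Valued.v x = Valued.v π ^ n) {x : E} (hx : x ≠ 0) (hx1 : Valued.v x ≤ 1) :
    ∃ n : ℕ, Valued.v x = Valued.v π ^ n := by
  obtain ⟨n, hn⟩ := hval x hx
  have h0 : 0 < Valued.v π := zero_lt_iff.mpr ((Valuation.ne_zero_iff _).mpr hπ0)
  rcases le_or_gt 0 n with h | h
  · lift n to ℕ using h
    exact ⟨n, by rw [hn, zpow_natCast]⟩
  · exfalso
    rw [hn] at hx1
    exact absurd hx1 (not_le.mpr (one_lt_zpow_of_neg₀ h0 hπ1 h))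

theorem isDiscreteValuationRing_valuedRing (hπ0 : π ≠ 0) (hπ1 : Valued.v π < 1)
    (hval : ∀ x : E, x ≠ 0 → ∃ n : ℤ, Valued.v x = Valued.v π ^ n) :
    IsDiscreteValuationRing (valuedRing E Γ) := by
  let ϖ : (valuedRing E Γ) := ⟨π, hπ1.le⟩
  have hdvd : ∀ x : valuedRing E Γ, x ≠ 0 → ∃ n : ℕ, Associated (ϖ ^ n) x := by
    intro x hx
    obtain ⟨n, hn⟩ := exists_valuation_eq_pow hπ0 hπ1 hval
      (fun h => hx (Subtype.ext h)) x.2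
    refine ⟨n, associated_of_dvd_dvd ?_ ?_⟩ <;> rw [valuedRing_dvd_iff] <;>
      simp [ϖ, hn]
  have hϖ : ¬ IsUnit ϖ := fun h => hπ1.ne (isUnit_valuedRing_iff.mp h)
  have hϖ0 : ϖ ≠ 0 := fun h => hπ0 (congrArg Subtype.val h)
  refine IsDiscreteValuationRing.ofHasUnitMulPowIrreducibleFactorization
    ⟨ϖ, ⟨hϖ, fun a b hab => ?_⟩, fun {x} hx => hdvd x hx⟩
  have ha : a ≠ 0 := by rintro rfl; exact hϖ0 (by simpa using hab)
  have hb : b ≠ 0 := by rintro rfl; exact hϖ0 (by simpa using hab)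
  by_contra! h
  have key : ∀ x : valuedRing E Γ, x ≠ 0 → ¬ IsUnit x → ϖ ∣ x := by
    intro x hx hxu
    obtain ⟨n, hn⟩ := hdvd x hx
    rcases n with - | n
    · exact absurd (hn.isUnit (by simp)) hxu
    · exact (dvd_pow_self ϖ n.succ_ne_zero).trans hn.dvd
  obtain ⟨c, hc⟩ := key a ha h.1
  rw [hc, mul_assoc] at hab
  have := mul_left_cancel₀ hϖ0 ((mul_one ϖ).trans hab)
  exact h.2 (IsUnit.of_mul_eq_one c (by rw [this]; ring))

/-- Powers of the value of `π` are cofinal among the values, so adic Cauchy sequences are Cauchy for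
the uniform structure; the ultrametric inequality keeps the congruences in the limit. -/
theorem isAdicComplete_valuedRing [CompleteSpace E] (hπ0 : π ≠ 0) (hπ1 : Valued.v π < 1)
    (hval : ∀ x : E, x ≠ 0 → ∃ n : ℤ, Valued.v x = Valued.v π ^ n) :
    IsAdicComplete (IsLocalRing.maximalIdeal (valuedRing E Γ)) (valuedRing E Γ) := by
  have := isDiscreteValuationRing_valuedRing hπ0 hπ1 hval
  let ϖ : (valuedRing E Γ) := ⟨π, hπ1.le⟩
  have hm : IsLocalRing.maximalIdeal (valuedRing E Γ) = Ideal.span {ϖ} := by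
    refine le_antisymm (fun x hx => ?_) ?_
    · rw [Ideal.mem_span_singleton, valuedRing_dvd_iff]
      by_cases hx0 : (x : E) = 0
      · simp [hx0]
      obtain ⟨n, hn⟩ := exists_valuation_eq_pow hπ0 hπ1 hval hx0 x.2
      rcases n with - | n
      · exact absurd (isUnit_valuedRing_iff.mpr (by simpa using hn)) hx
      · rw [hn, pow_succ']
        exact mul_le_of_le_one_right' (pow_le_one' hπ1.le n)
    · rw [Ideal.span_singleton_le_iff_mem]
      exact fun h => hπ1.ne (isUnit_valuedRing_iff.mp h)
  have hmn : ∀ (n : ℕ) (x : valuedRing E Γ), x ∈ IsLocalRing.maximalIdeal (valuedRing E Γ) ^ n ↔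
      Valued.v (x : E) ≤ Valued.v π ^ n := by
    intro n x
    rw [hm, Ideal.span_singleton_pow, Ideal.mem_span_singleton, valuedRing_dvd_iff]
    simp [ϖ]
  have hball : ∀ (n : ℕ) (r : E), {x : E | Valued.v (x - r) < Valued.v π ^ n} ∈ nhds r := by
    intro n r
    simpa using valued_ball_mem_nhds (Γ := Γ) r (pow_ne_zero n hπ0)
  refine { toIsHausdorff := ?_, toIsPrecomplete := ⟨fun f hf => ?_⟩ }
  · refine ⟨fun x hx => ?_⟩
    have h1 := Ideal.iInf_pow_eq_bot_of_isLocalRing (IsLocalRing.maximalIdeal (valuedRing E Γ))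
      (Ideal.IsPrime.ne_top inferInstance)
    rw [← Ideal.mem_bot, ← h1, Ideal.mem_iInf]
    intro n
    have := hx n
    rwa [SModEq.zero, smul_eq_mul, Ideal.mul_top] at this
  · have hf' : ∀ {m n : ℕ}, m ≤ n → Valued.v ((f m : E) - f n) ≤ Valued.v π ^ m := by
      intro m n hmn'
      have := hf hmn'
      rw [SModEq.sub_mem, smul_eq_mul, Ideal.mul_top, hmn] at this
      exact this
    have hc : CauchySeq (fun n => (f n : E)) := by
      refine Valued.cauchy_iff.mpr ⟨inferInstance, fun γ => ?_⟩
      obtain ⟨e, he⟩ := MonoidWithZeroHom.ValueGroup₀.restrict₀_surjective _ γ.1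
      rw [← Valuation.restrict_def] at he
      have he0 : e ≠ 0 := by
        rintro rfl
        exact γ.ne_zero (by rw [← he, map_zero])
      obtain ⟨m, hme⟩ := hval e he0
      have h0 : 0 < Valued.v π := zero_lt_iff.mpr ((Valuation.ne_zero_iff _).mpr hπ0)
      refine ⟨(fun n => (f n : E)) '' Set.Ici (m.toNat + 1), Filter.image_mem_map
        (Filter.Ici_mem_atTop _), ?_⟩
      rintro _ ⟨a, ha, rfl⟩ _ ⟨b, hb, rfl⟩
      have hlt : Valued.v π ^ (m.toNat + 1) < Valued.v e := by
        rw [hme, ← zpow_natCast]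
        exact zpow_lt_zpow_right_of_lt_one₀ h0 hπ1 (by push_cast; have := Int.self_le_toNat m; omega)
      rw [← he, Valuation.restrict_lt_iff]
      refine lt_of_le_of_lt ?_ hlt
      have : (f b : E) - f a = (f (m.toNat + 1) - f a) - (f (m.toNat + 1) - f b) := by ring
      rw [this]
      exact (Valuation.map_sub _ _ _).trans (max_le (hf' ha) (hf' hb))
    obtain ⟨L, hL⟩ := cauchySeq_tendsto_of_complete hc
    have hLf : ∀ n, Valued.v ((f n : E) - L) ≤ Valued.v π ^ n := by
      intro n
      obtain ⟨N, hN⟩ := Filter.eventually_atTop.mp (hL.eventually (hball n L))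
      have h1 := hN (max n N) (le_max_right _ _)
      have h2 := hf' (le_max_left n N)
      have : (f n : E) - L = (f n - f (max n N)) + (f (max n N) - L) := by ring
      rw [this]
      exact (Valuation.map_add _ _ _).trans (max_le h2 h1.le)
    have hLR : L ∈ (valuedRing E Γ) := by
      have h1 := hLf 0
      have : L = f 0 - (f 0 - L) := by ring
      rw [this]
      exact sub_mem (f 0).2 (by simpa using h1)
    refine ⟨⟨L, hLR⟩, fun n => ?_⟩
    rw [SModEq.sub_mem, smul_eq_mul, Ideal.mul_top, hmn]
    exact hLf n

end CompleteValued

section Completion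

variable {K : Type*} [Field K] (V : ValuationSubring K)

/-- The map from a field to its completion. -/
def toCompletion : K →+* V.valuation.Completion :=
  (UniformSpace.Completion.coeRingHom : WithVal V.valuation →+* _).comp
    (WithVal.equiv V.valuation).symm.toRingHom

theorem valued_toCompletion (x : K) : Valued.v (toCompletion V x) = V.valuation x :=
  Valued.valuedCompletion_apply _

theorem exists_valued_sub_lt (x : V.valuation.Completion) {e : K} (he : e ≠ 0) :
    ∃ y : K, Valued.v (x - toCompletion V y) < V.valuation e := by
  have h1 := valued_ball_mem_nhds (Γ := V.ValueGroup) x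
    ((map_ne_zero (toCompletion V)).mpr he)
  obtain ⟨y, hy⟩ := UniformSpace.Completion.denseRange_coe.exists_mem_open isOpen_interior
    ⟨x, mem_interior_iff_mem_nhds.mpr h1⟩
  have h2 := interior_subset hy
  refine ⟨y.ofVal, ?_⟩
  rw [Valuation.map_sub_swap, ← valued_toCompletion]
  exact h2

/-- The ring of integers of the completion. -/
abbrev completionRing : ValuationSubring V.valuation.Completion :=
  valuedRing V.valuation.Completion V.ValueGroup

theorem toCompletion_mem_iff {x : K} : toCompletion V x ∈ completionRing V ↔ x ∈ V := by
  rw [Valuation.mem_valuationSubring_iff, valued_toCompletion, V.valuation_le_one_iff]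

theorem exists_sub_toCompletion_lt_one {x : V.valuation.Completion} (hx : x ∈ completionRing V) :
    ∃ y ∈ V, Valued.v (x - toCompletion V y) < 1 := by
  obtain ⟨y, hy⟩ := exists_valued_sub_lt V x one_ne_zero
  rw [map_one] at hy
  refine ⟨y, (toCompletion_mem_iff V).mp ?_, hy⟩
  have : toCompletion V y = x - (x - toCompletion V y) := by ring
  rw [this]
  exact sub_mem hx hy.le

variable [IsDiscreteValuationRing V]

theorem exists_uniformizer : ∃ π : V.valuation.Completion, π ≠ 0 ∧ Valued.v π < 1 ∧
    ∀ x : V.valuation.Completion, x ≠ 0 → ∃ n : ℤ, Valued.v x = Valued.v π ^ n := by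
  obtain ⟨π, hπ⟩ := IsDiscreteValuationRing.exists_irreducible V
  have hπ0 : (π : K) ≠ 0 := fun h => hπ.ne_zero (Subtype.ext h)
  have hπ1 : V.valuation π < 1 := (V.valuation_lt_one_iff π).mp hπ.not_isUnit
  refine ⟨toCompletion V π, (map_ne_zero _).mpr hπ0, by rwa [valued_toCompletion], fun x hx => ?_⟩
  have hK : ∀ y : K, y ≠ 0 → ∃ n : ℤ, V.valuation y = V.valuation π ^ n := by
    have hV : ∀ y : V, y ≠ 0 → ∃ n : ℤ, V.valuation y = V.valuation π ^ n := by
      intro y hy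
      obtain ⟨n, u, hu⟩ := IsDiscreteValuationRing.eq_unit_mul_pow_irreducible hy hπ
      refine ⟨n, ?_⟩
      rw [hu]
      simp [V.valuation_unit]
    intro y hy
    rcases V.mem_or_inv_mem y with h | h
    · exact hV ⟨y, h⟩ fun h0 => hy (congrArg Subtype.val h0)
    · obtain ⟨n, hn⟩ := hV ⟨y⁻¹, h⟩ fun h0 => hy (inv_eq_zero.mp (congrArg Subtype.val h0))
      exact ⟨-n, by rw [zpow_neg, ← hn, map_inv₀, inv_inv]⟩
  obtain ⟨z, hz⟩ := Valued.exists_coe_eq_v (K := WithVal V.valuation) x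
  have hz' : Valued.v x = V.valuation z.ofVal := hz
  obtain ⟨n, hn⟩ := hK z.ofVal (by
    intro h
    rw [h, map_zero, Valuation.zero_iff] at hz'
    exact hx hz')
  exact ⟨n, by rw [valued_toCompletion, hz', hn]⟩

instance : IsDiscreteValuationRing (completionRing V) := by
  obtain ⟨π, h0, h1, h⟩ := exists_uniformizer V
  exact isDiscreteValuationRing_valuedRing h0 h1 h

instance : IsAdicComplete (IsLocalRing.maximalIdeal (completionRing V)) (completionRing V) := by
  obtain ⟨π, h0, h1, h⟩ := exists_uniformizer V
  exact isAdicComplete_valuedRing h0 h1 h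

end Completion

end

section

/-! ### Absolute Galois groups and purely inseparable extensions -/

/-- To fix a finite subextension it is enough to fix a basis of it. Transported by `Ψ`, this asks
that finitely many algebraic elements be fixed, which is an open condition. -/
theorem continuous_of_comm {F Ω F' Ω' : Type*} [Field F] [Field Ω] [Algebra F Ω]
    [Algebra.IsAlgebraic F Ω] [Field F'] [Field Ω'] [Algebra F' Ω'] (Ψ : Ω' →+* Ω)
    (f : (Ω ≃ₐ[F] Ω) →* (Ω' ≃ₐ[F'] Ω')) (h : ∀ s x, Ψ (f s x) = s (Ψ x)) : Continuous f := by
  refine continuous_of_continuousAt_one f ?_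
  rw [ContinuousAt, map_one]
  intro N hN
  obtain ⟨M, hM, hMN⟩ := (krullTopology_mem_nhds_one_iff F' Ω' N).mp hN
  let b := Module.finBasis F' M
  have h1 : (⋂ i, {s : Ω ≃ₐ[F] Ω | s (Ψ (b i)) = Ψ (b i)}) ∈ nhds 1 := by
    refine (isOpen_iInter_of_finite fun i => ?_).mem_nhds (Set.mem_iInter.mpr fun i => rfl)
    exact stabilizer_isOpen_of_isIntegral (K := F) (Ψ (b i : Ω'))
  refine Filter.mem_map.mpr (Filter.mem_of_superset h1 fun s hs => hMN ?_)
  rw [SetLike.mem_coe, IntermediateField.mem_fixingSubgroup_iff]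
  intro x hx
  have h2 : ∀ i, f s (b i) = b i := fun i => Ψ.injective ((h s _).trans (Set.mem_iInter.mp hs i))
  have h3 : (f s).toLinearMap ∘ₗ M.val.toLinearMap = M.val.toLinearMap :=
    b.ext fun i => h2 i
  exact LinearMap.congr_fun h3 ⟨x, hx⟩

/-- `E₂` is purely inseparable over the image of `E₁`, so an algebraic closure of `E₂` is one of
`E₁`, and an automorphism over `E₁` fixes `E₂` because `p ^ n`-th roots are unique. The isomorphism
`Ψ` of algebraic closures is kept in the conclusion, since it later transports embeddings of `L`. -/
theorem exists_autEquiv_of_pow_mem_range {E₁ E₂ Ω₁ Ω₂ : Type*} [Field E₁] [Field E₂] [Field Ω₁]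
    [Field Ω₂] [Algebra E₁ Ω₁] [Algebra E₂ Ω₂] [IsAlgClosure E₁ Ω₁] [IsAlgClosure E₂ Ω₂]
    (ψ : E₁ →+* E₂) (p n : ℕ) [ExpChar E₂ p] (hψ : ∀ y, y ^ p ^ n ∈ ψ.range) :
    ∃ Ψ : Ω₁ ≃+* Ω₂, (∀ x, Ψ (algebraMap _ _ x) = algebraMap _ _ (ψ x)) ∧
      ∃ φ : (Ω₂ ≃ₐ[E₂] Ω₂) ≃ₜ* (Ω₁ ≃ₐ[E₁] Ω₁), ∀ s x, Ψ (φ s x) = s (Ψ x) := by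
  let : Algebra E₁ E₂ := ψ.toAlgebra
  let : Algebra E₁ Ω₂ := ((algebraMap E₂ _).comp ψ).toAlgebra
  have : IsScalarTower E₁ E₂ Ω₂ := .of_algebraMap_eq fun _ => rfl
  have : IsAlgClosed Ω₂ := IsAlgClosure.isAlgClosed E₂
  have : Algebra.IsAlgebraic E₂ Ω₂ := IsAlgClosure.isAlgebraic
  have : Algebra.IsAlgebraic E₁ Ω₁ := IsAlgClosure.isAlgebraic
  have hq : 0 < p ^ n := pow_pos (expChar_pos E₂ p) n
  have : Algebra.IsAlgebraic E₁ E₂ := ⟨fun y => by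
    obtain ⟨x, hx⟩ := hψ y
    exact IsAlgebraic.of_pow hq (hx ▸ isAlgebraic_algebraMap (A := E₂) x)⟩
  have : Algebra.IsAlgebraic E₁ Ω₂ := Algebra.IsAlgebraic.trans E₁ E₂ _
  have : IsAlgClosure E₁ Ω₂ := ⟨inferInstance, inferInstance⟩
  let Ψ : Ω₁ ≃ₐ[E₁] Ω₂ := IsAlgClosure.equiv E₁ _ _
  have hΨ : ∀ x, Ψ (algebraMap E₁ _ x) = algebraMap E₂ _ (ψ x) := Ψ.commutes
  have : ExpChar Ω₂ p := expChar_of_injective_algebraMap (algebraMap E₂ _).injective p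
  have hfix : ∀ (t : Ω₂ ≃ₐ[E₁] Ω₂) (y : E₂), t (algebraMap E₂ _ y) = algebraMap E₂ _ y := by
    intro t y
    obtain ⟨x, hx⟩ := hψ y
    refine iterateFrobenius_inj _ p n ?_
    rw [iterateFrobenius_def, iterateFrobenius_def, ← map_pow, ← map_pow, ← hx]
    exact t.commutes x
  let φ : (Ω₂ ≃ₐ[E₂] Ω₂) ≃* (Ω₁ ≃ₐ[E₁] Ω₁) :=
    { toFun := fun s => (Ψ.trans (s.restrictScalars E₁)).trans Ψ.symm
      invFun := fun t => { ((Ψ.symm.trans t).trans Ψ).toRingEquiv with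
        commutes' := hfix ((Ψ.symm.trans t).trans Ψ) }
      left_inv := fun s => AlgEquiv.ext fun x => by simp
      right_inv := fun t => AlgEquiv.ext fun x => by simp
      map_mul' := fun s t => AlgEquiv.ext fun x => by simp }
  have hφ : ∀ s x, Ψ (φ s x) = s (Ψ x) := fun s x => Ψ.apply_symm_apply _
  refine ⟨Ψ, hΨ, { φ with
    continuous_toFun := continuous_of_comm (Ψ : Ω₁ →+* Ω₂) φ.toMonoidHom hφ
    continuous_invFun := continuous_of_comm (Ψ.symm : Ω₂ →+* Ω₁) φ.symm.toMonoidHom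
      fun t x => ?_ }, hφ⟩
  change Ψ.symm (Ψ (t (Ψ.symm x))) = t (Ψ.symm x)
  exact Ψ.symm_apply_apply _

/-! ### Completions and residue fields -/

section

variable {K : Type*} [Field K] (V : ValuationSubring K)

/-- Completion does not change the residue field, by density of `V`. -/
theorem exists_residue_extension {κ : Type*} [Field κ] (r : V →+* κ)
    (hr : Function.Surjective r) : ∃ r' : completionRing V →+* κ, Function.Surjective r' ∧
      ∀ x : V, r' ⟨toCompletion V x, (toCompletion_mem_iff V).mpr x.2⟩ = r x := by
  let c : V →+* completionRing V := ((toCompletion V).comp V.subtype).codRestrict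
    (completionRing V).toSubring fun x => (toCompletion_mem_iff V).mpr x.2
  let f : V →+* IsLocalRing.ResidueField (completionRing V) := (IsLocalRing.residue _).comp c
  have hf : Function.Surjective f := by
    intro z
    obtain ⟨x, rfl⟩ := IsLocalRing.residue_surjective z
    obtain ⟨y, hy, hxy⟩ := exists_sub_toCompletion_lt_one V x.2
    refine ⟨⟨y, hy⟩, ?_⟩
    symm
    rw [← sub_eq_zero, RingHom.comp_apply, ← map_sub, IsLocalRing.residue_eq_zero_iff]
    exact fun h => hxy.ne (isUnit_valuedRing_iff.mp h)
  have hker : RingHom.ker f = RingHom.ker r :=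
    (IsLocalRing.eq_maximalIdeal (RingHom.ker_isMaximal_of_surjective f hf)).trans
      (IsLocalRing.eq_maximalIdeal (RingHom.ker_isMaximal_of_surjective r hr)).symm
  let e : IsLocalRing.ResidueField (completionRing V) ≃+* κ :=
    (RingHom.quotientKerEquivOfSurjective hf).symm.trans
      ((Ideal.quotEquivOfEq hker).trans (RingHom.quotientKerEquivOfSurjective hr))
  have he : ∀ x, e (f x) = r x := by
    intro x
    have : (RingHom.quotientKerEquivOfSurjective hf).symm (f x) = Ideal.Quotient.mk _ x := by
      rw [RingEquiv.symm_apply_eq]; rfl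
    simp only [e, RingEquiv.trans_apply, this]
    rfl
  exact ⟨e.toRingHom.comp (IsLocalRing.residue _), e.surjective.comp IsLocalRing.residue_surjective, he⟩

end

/-- The common subring `k` puts both completions in equal characteristic, so they have coefficient
fields. The resulting map controls only residues: it does not respect the two embeddings of `K`. -/
theorem exists_completion_lift {k K κ₁ κ₂ : Type*} [Field k] [Field K] [Field κ₁] [Field κ₂]
    (V₁ V₂ : ValuationSubring K) [IsDiscreteValuationRing V₁] [IsDiscreteValuationRing V₂]
    (c : k →+* K) (hc₁ : ∀ x, c x ∈ V₁) (hc₂ : ∀ x, c x ∈ V₂)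
    (r₁ : V₁ →+* κ₁) (hr₁ : Function.Surjective r₁)
    (r₂ : completionRing V₂ →+* κ₂) (hr₂ : Function.Surjective r₂)
    (h : κ₁ →+* κ₂) (p n : ℕ) [ExpChar κ₂ p] (hh : ∀ y, y ^ p ^ n ∈ h.range) :
    ∃ ψ : V₁.valuation.Completion →+* V₂.valuation.Completion,
      (∀ y, y ^ p ^ n ∈ ψ.range) ∧
      ∀ x : V₁, ∃ hx : ψ (toCompletion V₁ x) ∈ completionRing V₂, r₂ ⟨_, hx⟩ = h (r₁ x) := by
  obtain ⟨r₁', hr₁', hr⟩ := exists_residue_extension V₁ r₁ hr₁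
  let : Algebra k (completionRing V₁) := (((toCompletion V₁).comp c).codRestrict
    (completionRing V₁).toSubring fun x => (toCompletion_mem_iff V₁).mpr (hc₁ x)).toAlgebra
  let : Algebra k (completionRing V₂) := (((toCompletion V₂).comp c).codRestrict
    (completionRing V₂).toSubring fun x => (toCompletion_mem_iff V₂).mpr (hc₂ x)).toAlgebra
  obtain ⟨ψ, hψi, hψr, hψp⟩ := exists_lift_of_residue k k r₁' hr₁' r₂ hr₂ h p n hh
  have hinj : Function.Injective ((algebraMap (completionRing V₂) V₂.valuation.Completion).comp ψ) :=
    Subtype.val_injective.comp hψi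
  let ψ' : V₁.valuation.Completion →+* V₂.valuation.Completion := IsFractionRing.lift hinj
  have hψ' : ∀ x : completionRing V₁, ψ' x = ψ x := fun x => IsFractionRing.lift_algebraMap hinj x
  have hpos : ∀ y : completionRing V₂, (y : V₂.valuation.Completion) ^ p ^ n ∈ ψ'.range := by
    intro y
    obtain ⟨x, hx⟩ := hψp y
    exact ⟨x, by rw [hψ', hx]; rfl⟩
  refine ⟨ψ', fun y => ?_, fun x => ?_⟩
  · rcases (completionRing V₂).mem_or_inv_mem y with hy | hy
    · exact hpos ⟨y, hy⟩
    · obtain ⟨x, hx⟩ := hpos ⟨y⁻¹, hy⟩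
      exact ⟨x⁻¹, by rw [map_inv₀, hx, inv_pow, inv_inv]⟩
  · have h1 := hψ' ⟨toCompletion V₁ x, (toCompletion_mem_iff V₁).mpr x.2⟩
    have h2 : ψ' (toCompletion V₁ x) ∈ completionRing V₂ := by
      rw [h1]; exact Subtype.mem _
    refine ⟨h2, ?_⟩
    rw [← hr, ← hψr]
    congr 1
    exact Subtype.ext h1

end

section

/-! ### The topology on the set of rational points -/

section Points

variable {k : Type u} [Field k] {X : Scheme.{u}} {π : X ⟶ Spec (.of k)}
  {ℓ : Type u} [Field ℓ] [Algebra k ℓ]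

theorem Points.liesIn_iff (p : Points π ℓ) (V : X.Opens) : p.LiesIn V ↔ p.pt ∈ V := by
  refine ⟨fun h => h (Set.mem_univ _), fun h x _ => ?_⟩
  have : x = IsLocalRing.closedPoint ℓ := Subsingleton.elim (α := PrimeSpectrum ℓ) _ _
  rw [this]
  exact h

/-- The evaluation of sections at a rational point, as a ring homomorphism. -/
def Points.evalHom (p : Points π ℓ) (V : X.Opens) (h : p.LiesIn V) : Γ(X, V) →+* ℓ :=
  ((Scheme.ΓSpecIso (.of ℓ)).hom.hom).comp (p.1.appLE V ⊤ h).hom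

theorem Points.evalHom_res (p : Points π ℓ) {V D : X.Opens} (hD : p.LiesIn D) (hDV : D ≤ V)
    (hV : p.LiesIn V) (f : Γ(X, V)) :
    p.evalHom D hD (X.presheaf.map (homOfLE hDV).op f) = p.evalHom V hV f := by
  have := Scheme.Hom.map_appLE p.1 hD (homOfLE hDV).op
  change (Scheme.ΓSpecIso (.of ℓ)).hom.hom ((X.presheaf.map (homOfLE hDV).op ≫ p.1.appLE D ⊤ hD).hom f) = _
  rw [this]
  rfl

theorem Points.pt_mem_basicOpen_iff (p : Points π ℓ) (V : X.Opens) (h : p.LiesIn V) (g : Γ(X, V)) :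
    p.pt ∈ X.basicOpen g ↔ p.evalHom V h g ≠ 0 := by
  refine ⟨fun hg => ?_, fun hg => ?_⟩
  · have hD := (p.liesIn_iff (X.basicOpen g)).mpr hg
    rw [← p.evalHom_res hD (X.basicOpen_le g) h]
    exact ((X.toRingedSpace.isUnit_res_basicOpen g).map (p.evalHom _ hD)).ne_zero
  · have h1 : IsUnit (p.1.appLE V ⊤ h g) := by
      have : p.1.appLE V ⊤ h g = (Scheme.ΓSpecIso (.of ℓ)).inv.hom (p.evalHom V h g) := by
        simp [evalHom]
      rw [this]
      exact (Ne.isUnit hg).map _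
    have h2 := (Scheme.basicOpen_appLE p.1 ⊤ V h g).symm.trans (Scheme.basicOpen_of_isUnit _ h1)
    exact (h2.ge (Set.mem_univ (IsLocalRing.closedPoint ℓ))).2

theorem Points.continuous_evalHom [TopologicalSpace ℓ] (V : X.Opens) (f : Γ(X, V)) :
    @Continuous _ _ (sectionTopology π ℓ V) _ fun p => p.1.evalHom V p.2 f :=
  continuous_iInf_dom continuous_induced_dom

/-- Openness in the glued topology has to be tested on every affine `V'`. Near a point of `V ∩ V'`
one passes to a basic open set of `V'` inside `V`, where a section over `V` is a fraction `h / g ^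
n` of sections over `V'`. The division is performed in `κ`, because no continuity of the field
operations of `ℓ` is assumed. -/
theorem Points.isOpen_setOf_evalHom_mem [TopologicalSpace ℓ] {κ : Type*} [Field κ]
    [TopologicalSpace κ] [IsTopologicalDivisionRing κ] [T1Space κ] (ι : ℓ →+* κ) (hι : Continuous ι)
    {V : X.Opens} {N : Set (Γ(X, V) → κ)} (hN : IsOpen N) :
    IsOpen {p : Points π ℓ | ∃ h : p.LiesIn V, (fun f => ι (p.evalHom V h f)) ∈ N} := by
  refine isOpen_iSup_iff.mpr fun V' => isOpen_coinduced.mpr ?_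
  let := sectionTopology π ℓ V'.1
  refine isOpen_iff_mem_nhds.mpr ?_
  rintro ⟨p₀, hp₀'⟩ ⟨hp₀, hpN⟩
  obtain ⟨g, hgV, hg⟩ := V'.2.exists_basicOpen_le ⟨p₀.pt, (p₀.liesIn_iff V).mp hp₀⟩
    ((p₀.liesIn_iff _).mp hp₀')
  have hloc := V'.2.isLocalization_basicOpen g
  have hres : ∀ f : Γ(X, V), ∃ (h : Γ(X, V'.1)) (n : ℕ),
      X.presheaf.map (homOfLE (X.basicOpen_le g)).op h =
        X.presheaf.map (homOfLE (X.basicOpen_le g)).op g ^ n *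
          X.presheaf.map (homOfLE hgV).op f := by
    intro f
    obtain ⟨⟨h, ⟨_, n, rfl⟩⟩, hh⟩ := IsLocalization.surj (Submonoid.powers g)
      (X.presheaf.map (homOfLE hgV).op f)
    refine ⟨h, n, ?_⟩
    rw [mul_comm, ← map_pow]
    exact hh.symm
  choose h n hh using hres
  have hval : ∀ p : {p : Points π ℓ // p.LiesIn V'.1}, p.1.evalHom V'.1 p.2 g ≠ 0 →
      ∃ hp : p.1.LiesIn V, ∀ f, p.1.evalHom V hp f =
        p.1.evalHom V'.1 p.2 (h f) / p.1.evalHom V'.1 p.2 g ^ n f := by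
    rintro ⟨p, hp'⟩ hpg
    have hD : p.LiesIn (X.basicOpen g) :=
      (p.liesIn_iff _).mpr ((p.pt_mem_basicOpen_iff _ hp' g).mpr hpg)
    have hp : p.LiesIn V := (p.liesIn_iff _).mpr (hgV ((p.liesIn_iff _).mp hD))
    refine ⟨hp, fun f => ?_⟩
    rw [eq_div_iff (pow_ne_zero _ hpg), mul_comm]
    have := congrArg (p.evalHom _ hD) (hh f)
    rw [map_mul, map_pow, p.evalHom_res hD _ hp', p.evalHom_res hD _ hp',
      p.evalHom_res hD _ hp] at this
    exact this.symm
  have hc : ∀ f : Γ(X, V'.1), Continuous fun p : {p : Points π ℓ // p.LiesIn V'.1} =>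
      ι (p.1.evalHom V'.1 p.2 f) := fun f => hι.comp (Points.continuous_evalHom V'.1 f)
  have hg0 : ι (p₀.evalHom V'.1 hp₀' g) ≠ 0 :=
    (map_ne_zero ι).mpr ((p₀.pt_mem_basicOpen_iff _ hp₀' g).mp hg)
  have h1 : ∀ᶠ p : {p : Points π ℓ // p.LiesIn V'.1} in nhds ⟨p₀, hp₀'⟩,
      ι (p.1.evalHom V'.1 p.2 g) ≠ 0 := (hc g).continuousAt.eventually_ne hg0
  let q : {p : Points π ℓ // p.LiesIn V'.1} → Γ(X, V) → κ := fun p f =>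
    ι (p.1.evalHom V'.1 p.2 (h f)) / ι (p.1.evalHom V'.1 p.2 g) ^ n f
  have hq : ContinuousAt q ⟨p₀, hp₀'⟩ := continuousAt_pi.mpr fun f =>
    (hc (h f)).continuousAt.div ((hc g).continuousAt.pow _) (pow_ne_zero _ hg0)
  have hqe : ∀ p : {p : Points π ℓ // p.LiesIn V'.1}, ι (p.1.evalHom V'.1 p.2 g) ≠ 0 →
      ∃ hp : p.1.LiesIn V, (fun f => ι (p.1.evalHom V hp f)) = q p := by
    intro p hp
    obtain ⟨hpV, hf⟩ := hval p ((map_ne_zero ι).mp hp)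
    exact ⟨hpV, funext fun f => by rw [hf, map_div₀, map_pow]⟩
  have h2 : ∀ᶠ p in nhds ⟨p₀, hp₀'⟩, q p ∈ N := by
    refine hq.eventually_mem (hN.mem_nhds ?_)
    obtain ⟨_, hf⟩ := hqe ⟨p₀, hp₀'⟩ hg0
    rw [← hf]
    exact hpN
  filter_upwards [h1, h2] with p hp1 hp2
  obtain ⟨hp, hf⟩ := hqe p hp1
  exact ⟨hp, by rw [hf]; exact hp2⟩

end Points

end

section

/-! ### Extensions of valuation rings to algebraic extensions -/

section Extension

variable {E Ω : Type*} [Field E] [Field Ω] [Algebra E Ω]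

/-- Take a valuation ring dominating the image of `O`. An element outside `O` has its inverse in the
maximal ideal of `O`; if it entered `W`, that inverse would become a unit, against domination. -/
theorem exists_valuationSubring_comap_eq (O : ValuationSubring E) :
    ∃ W : ValuationSubring Ω, W.comap (algebraMap E Ω) = O := by
  obtain ⟨W, hW, hloc⟩ := IsLocalRing.exists_factor_valuationRing
    ((algebraMap E Ω).comp O.subtype)
  have hOW : ∀ x ∈ O, algebraMap E Ω x ∈ W := fun x hx => hW ⟨x, hx⟩
  refine ⟨W, le_antisymm (fun x hx => ?_) hOW⟩
  rcases O.mem_or_inv_mem x with h | h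
  · exact h
  · by_cases h0 : x = 0
    · rw [h0]; exact O.zero_mem
    have hu : IsUnit (⟨x⁻¹, h⟩ : O) := by
      refine hloc.map_nonunit _ (IsUnit.of_mul_eq_one ⟨algebraMap E Ω x, hx⟩ (Subtype.ext ?_))
      change algebraMap E Ω x⁻¹ * algebraMap E Ω x = 1
      rw [← map_mul, inv_mul_cancel₀ h0, map_one]
    obtain ⟨y, hy⟩ := hu.exists_right_inv
    have : x = y := (eq_inv_of_mul_eq_one_right (congrArg Subtype.val hy)).symm ▸ (inv_inv x).symm
    rw [this]
    exact y.2

variable {O : ValuationSubring E} {W : ValuationSubring Ω}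

theorem algebraMap_mem_iff_of_comap_eq (hW : W.comap (algebraMap E Ω) = O) {x : E} :
    algebraMap E Ω x ∈ W ↔ x ∈ O := by
  rw [← hW]; rfl

theorem valuation_algebraMap_le_iff (hW : W.comap (algebraMap E Ω) = O) {x y : E} :
    W.valuation (algebraMap E Ω x) ≤ W.valuation (algebraMap E Ω y) ↔
      O.valuation x ≤ O.valuation y := by
  by_cases hy : y = 0
  · simp [hy]
  have h1 : O.valuation y ≠ 0 := (Valuation.ne_zero_iff _).mpr hy
  have h2 : W.valuation (algebraMap E Ω y) ≠ 0 :=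
    (Valuation.ne_zero_iff _).mpr ((map_ne_zero _).mpr hy)
  rw [← div_le_one₀ (zero_lt_iff.mpr h1), ← div_le_one₀ (zero_lt_iff.mpr h2), ← map_div₀,
    ← map_div₀, ← map_div₀, W.valuation_le_one_iff, O.valuation_le_one_iff,
    algebraMap_mem_iff_of_comap_eq hW]

theorem isAlgClosed_residueField [IsAlgClosed Ω] (W : ValuationSubring Ω) :
    IsAlgClosed (IsLocalRing.ResidueField W) := by
  refine IsAlgClosed.of_exists_root _ fun p hp hirr => ?_
  obtain ⟨q, hq, hdeg, hqm⟩ := Polynomial.lifts_and_degree_eq_and_monic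
    ((Polynomial.mem_lifts _).mpr (Polynomial.map_surjective _ IsLocalRing.residue_surjective p)) hp
  obtain ⟨x, hx⟩ := IsAlgClosed.exists_root (q.map W.subtype) (by
    rw [hqm.degree_map, hdeg]; exact hirr.degree_pos.ne')
  have hxW : x ∈ W := mem_valuationSubring_of_isIntegral (O := W) W (fun o => o.2)
    ⟨q, hqm, by rw [← Polynomial.eval_map]; exact hx⟩
  refine ⟨IsLocalRing.residue W ⟨x, hxW⟩, ?_⟩
  rw [← hq, Polynomial.eval_map, Polynomial.eval₂_hom]
  have : Polynomial.eval ⟨x, hxW⟩ q = 0 := by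
    refine Subtype.ext ?_
    have h2 : W.subtype (Polynomial.eval ⟨x, hxW⟩ q) = (q.map W.subtype).eval x := by
      rw [Polynomial.eval_map, ← Polynomial.eval₂_hom]; rfl
    exact h2.trans hx
  rw [this, map_zero]

theorem exists_residue_hom (hW : W.comap (algebraMap E Ω) = O) {κ : Type*} [Field κ] (r : O →+* κ)
    (hr : Function.Surjective r) :
    ∃ ι : κ →+* IsLocalRing.ResidueField W, ∀ z : O, ι (r z) =
      IsLocalRing.residue W ⟨algebraMap E Ω z, (algebraMap_mem_iff_of_comap_eq hW).mpr z.2⟩ := by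
  let c : O →+* W := ((algebraMap E Ω).comp O.subtype).codRestrict W.toSubring fun x =>
    (algebraMap_mem_iff_of_comap_eq hW).mpr x.2
  have hker : RingHom.ker r ≤ RingHom.ker ((IsLocalRing.residue W).comp c) := by
    intro z hz
    rw [RingHom.mem_ker, RingHom.comp_apply, IsLocalRing.residue_eq_zero_iff]
    intro hu
    have hz' : IsUnit z := by
      obtain ⟨y, hy⟩ := hu.exists_right_inv
      have hz0 : (z : E) ≠ 0 := by
        intro h0
        have h1 : algebraMap E Ω z * y = 1 := congrArg Subtype.val hy
        rw [h0, map_zero, zero_mul] at h1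
        exact zero_ne_one h1
      have h1 : algebraMap E Ω z * y = 1 := congrArg Subtype.val hy
      refine IsUnit.of_mul_eq_one ⟨(z : E)⁻¹, ?_⟩ (Subtype.ext (mul_inv_cancel₀ hz0))
      rw [← algebraMap_mem_iff_of_comap_eq hW, map_inv₀, ← eq_inv_of_mul_eq_one_right h1]
      exact y.2
    exact (hz'.map r).ne_zero hz
  refine ⟨RingHom.liftOfSurjective r hr ⟨_, hker⟩, fun z => ?_⟩
  exact RingHom.liftOfRightInverse_comp_apply r _ _ ⟨_, hker⟩ z

/-- A polynomial relation over `O` with a coefficient equal to one stays nonzero after reduction. -/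
theorem isAlgebraic_residueField [Algebra.IsAlgebraic E Ω] (hW : W.comap (algebraMap E Ω) = O)
    {κ : Type*} [Field κ] (r : O →+* κ) (ι : κ →+* IsLocalRing.ResidueField W)
    (hι : ∀ z : O, ι (r z) =
      IsLocalRing.residue W ⟨algebraMap E Ω z, (algebraMap_mem_iff_of_comap_eq hW).mpr z.2⟩)
    (y : IsLocalRing.ResidueField W) :
    ∃ P : Polynomial κ, P ≠ 0 ∧ P.eval₂ ι y = 0 := by
  obtain ⟨y, rfl⟩ := IsLocalRing.residue_surjective y
  obtain ⟨P, ⟨i, hi⟩, hP⟩ := exists_primitive_aeval_eq_zero O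
    (Algebra.IsAlgebraic.isAlgebraic (R := E) (y : Ω))
  refine ⟨P.map r, fun h => ?_, ?_⟩
  · have := congrArg (fun q => q.coeff i) h
    simp [hi] at this
  · let c : O →+* W := ((algebraMap E Ω).comp O.subtype).codRestrict W.toSubring fun x =>
      (algebraMap_mem_iff_of_comap_eq hW).mpr x.2
    have h1 : ι.comp r = (IsLocalRing.residue W).comp c := RingHom.ext hι
    have h2 : P.eval₂ c y = 0 := by
      refine Subtype.ext ?_
      have : W.subtype (P.eval₂ c y) = P.eval₂ ((algebraMap E Ω).comp O.subtype) y := by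
        rw [Polynomial.hom_eval₂]; rfl
      exact this.trans hP
    rw [Polynomial.eval₂_map, h1, ← Polynomial.hom_eval₂, h2, map_zero]

theorem exists_pow_apply_eq (σ : Ω ≃ₐ[E] Ω) {x : Ω} (hx : IsIntegral E x) :
    ∃ m, 0 < m ∧ σ^[m] x = x := by
  have hfin : ((minpoly E x).rootSet Ω).Finite := Polynomial.rootSet_finite _ _
  have hmem : ∀ m, σ^[m] x ∈ (minpoly E x).rootSet Ω := by
    intro m
    rw [Polynomial.mem_rootSet]
    refine ⟨minpoly.ne_zero hx, ?_⟩
    induction m with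
    | zero => exact minpoly.aeval E x
    | succ m ih =>
      rw [Function.iterate_succ_apply', Polynomial.aeval_algHom_apply, ih, map_zero]
  obtain ⟨a, b, hab, h⟩ := Set.Finite.exists_lt_map_eq_of_forall_mem hmem hfin
  refine ⟨b - a, by omega, ?_⟩
  refine (σ.injective.iterate a) ?_
  rw [← Function.iterate_add_apply, Nat.add_sub_cancel' hab.le]
  exact h.symm

/-- The valuation of an extension of a henselian field is invariant under automorphisms. -/
theorem valuation_apply_of_henselian [Normal E Ω] [HenselianLocalRing O]
    (hW : W.comap (algebraMap E Ω) = O) (σ : Ω ≃ₐ[E] Ω) (x : Ω) :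
    W.valuation (σ x) = W.valuation x := by
  have hle : ∀ (τ : Ω ≃ₐ[E] Ω) {a b : Ω}, W.valuation a ≤ W.valuation b →
      W.valuation (τ a) ≤ W.valuation (τ b) := by
    intro τ a b hab
    by_cases hb : b = 0
    · rw [hb, map_zero, le_zero_iff, Valuation.zero_iff] at hab
      rw [hab, hb]
    have h2 : W.valuation b ≠ 0 := (Valuation.ne_zero_iff _).mpr hb
    have h3 : W.valuation (τ b) ≠ 0 := (Valuation.ne_zero_iff _).mpr ((map_ne_zero τ).mpr hb)
    rw [← div_le_one₀ (zero_lt_iff.mpr h2), ← map_div₀, W.valuation_le_one_iff] at hab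
    rw [← div_le_one₀ (zero_lt_iff.mpr h3), ← map_div₀, ← map_div₀, W.valuation_le_one_iff]
    exact map_mem_of_henselian O W hW τ hab
  -- Stability of the valuation ring only shows that `τ` preserves the order of values. The orbit of
  -- `x` under `τ` is finite, so a decreasing chain of values along it returns to its start.
  have key : ∀ (τ : Ω ≃ₐ[E] Ω), W.valuation (τ x) ≤ W.valuation x →
      W.valuation x ≤ W.valuation (τ x) := by
    intro τ h
    obtain ⟨m, hm, hmx⟩ := exists_pow_apply_eq τ (Normal.isIntegral (F := E) ‹_› x)
    have h1 : ∀ n, W.valuation (τ^[n + 1] x) ≤ W.valuation (τ x) := by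
      intro n
      induction n with
      | zero => exact le_rfl
      | succ n ih =>
        refine le_trans ?_ ih
        clear ih
        induction n with
        | zero => exact hle τ h
        | succ n ih =>
          have := hle τ ih
          rwa [← Function.iterate_succ_apply' τ, ← Function.iterate_succ_apply' τ] at this
    obtain ⟨n, rfl⟩ := Nat.exists_eq_succ_of_ne_zero hm.ne'
    have := h1 n
    rwa [hmx] at this
  rcases le_total (W.valuation (σ x)) (W.valuation x) with h | h
  · exact le_antisymm h (key σ h)
  · have h2 := hle σ.symm h
    rw [AlgEquiv.symm_apply_apply] at h2
    have h3 := hle σ (key σ.symm h2)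
    rw [AlgEquiv.apply_symm_apply] at h3
    exact le_antisymm h3 h

end Extension

/-- Algebraic extensions of a valued field carry a continuous structure map. -/
theorem continuous_algebraMap_of_comap_eq {k κ Γ₀ : Type*} [Field k] [Field κ] [Algebra k κ]
    [Algebra.IsAlgebraic k κ] [LinearOrderedCommGroupWithZero Γ₀] [Valued k Γ₀]
    (W : ValuationSubring κ)
    (hW : W.comap (algebraMap k κ) = (Valued.v : Valuation k Γ₀).valuationSubring)
    [Valued κ W.ValueGroup] (hv : (Valued.v : Valuation κ W.ValueGroup) = W.valuation) :
    Continuous (algebraMap k κ) := by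
  refine continuous_of_continuousAt_zero (algebraMap k κ) ?_
  rw [ContinuousAt, map_zero]
  intro s hs
  obtain ⟨γ, hγ⟩ := Valued.mem_nhds_zero.mp hs
  obtain ⟨e, he⟩ := MonoidWithZeroHom.ValueGroup₀.restrict₀_surjective _ γ.1
  rw [← Valuation.restrict_def] at he
  have he0 : e ≠ 0 := by
    rintro rfl
    exact γ.ne_zero (by rw [← he, map_zero])
  set O := (Valued.v : Valuation k Γ₀).valuationSubring
  -- A nonzero multiple of the algebraic element `e⁻¹` is integral; its multiplier `d` lies in `k`
  -- and has value at most that of `e`, so a ball of `k` maps into the given ball of `κ`.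
  obtain ⟨d, hd0, hd⟩ : ∃ d : O, d ≠ 0 ∧ algebraMap k κ d * e⁻¹ ∈ W := by
    have halg : IsAlgebraic O e⁻¹ :=
      (IsFractionRing.isAlgebraic_iff O k κ).mpr (Algebra.IsAlgebraic.isAlgebraic _)
    obtain ⟨d, hd0, hd⟩ := halg.exists_integral_multiple
    refine ⟨d, hd0, ?_⟩
    have := mem_valuationSubring_of_isIntegral W
      (fun o : O => (algebraMap_mem_iff_of_comap_eq hW).mpr o.2) hd
    rwa [Algebra.smul_def] at this
  have hdk : (d : k) ≠ 0 := fun h => hd0 (Subtype.ext h)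
  have hball := valued_ball_mem_nhds (Γ := Γ₀) (0 : k) hdk
  refine Filter.mem_map.mpr (Filter.mem_of_superset hball fun x hx => hγ ?_)
  have hx' : Valued.v x < Valued.v (d : k) := by simpa using hx
  rw [Set.mem_ofPred_eq, ← he, Valuation.restrict_lt_iff, hv]
  have h1 : W.valuation (algebraMap k κ d) ≤ W.valuation e := by
    have h2 : W.valuation e ≠ 0 := (Valuation.ne_zero_iff _).mpr he0
    rw [← div_le_one₀ (zero_lt_iff.mpr h2), ← map_div₀, W.valuation_le_one_iff, div_eq_mul_inv]
    exact hd
  refine lt_of_lt_of_le ?_ h1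
  rw [lt_iff_not_ge, valuation_algebraMap_le_iff hW, ← lt_iff_not_ge]
  exact (Valuation.isEquiv_valuation_valuationSubring (Valued.v : Valuation k Γ₀)).lt_iff_lt.mp hx'

end

section

/-! ### Krasner's lemma for residue fields -/

/-- Krasner's argument: the condition `N` makes an element `u` of `F'` closer to a basis vector `b`
of `F` than any other conjugate of `b`. For an automorphism `σ` over `F'`, `σ b - b = (u - b) - σ (u
- b)` has value at most that of `u - b`, so `σ b = b`. As `b` may be inseparable, this yields only
that a `p`-power of it lies in `F'`; the finitely many exponents are then made uniform. -/
theorem exists_isOpen_forall_purelyInseparable {k F κ A Γ : Type*} [Field k] [Field F] [Field κ]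
    [Algebra k F] [FiniteDimensional k F] [Algebra k κ] [IsAlgClosed κ] [Algebra.IsAlgebraic k κ]
    [LinearOrderedCommGroupWithZero Γ] [Valued κ Γ]
    (hinv : ∀ (σ : κ ≃ₐ[k] κ) x, Valued.v (σ x) = Valued.v x) (ι : F →ₐ[k] κ) (r : A → F)
    (hr : Function.Surjective r) :
    ∃ N : Set (A → κ), IsOpen N ∧ (fun a => ι (r a)) ∈ N ∧
      ∀ (F' : Type w) [Field F'] (h : F' →+* F) (r' : A → F') (c : k →+* F'),
        (∀ x, h (c x) = algebraMap k F x) → (fun a => ι (h (r' a))) ∈ N →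
        ∃ p n : ℕ, ExpChar F p ∧ ∀ y : F, y ^ p ^ n ∈ h.range := by
  classical
  let b := Module.finBasis k F
  choose t ht using fun i => hr (b i)
  let T : Fin (Module.finrank k F) → Finset κ := fun i =>
    ((minpoly k (ι (b i))).rootSet_finite κ).toFinset.filter fun z => z ≠ ι (b i)
  let N : Set (A → κ) := ⋂ i, ⋂ z ∈ T i,
    {c | Valued.v (c (t i) - ι (b i)) < Valued.v (z - ι (b i))}
  have hT : ∀ i, ∀ z ∈ T i, z - ι (b i) ≠ 0 := fun i z hz => sub_ne_zero.mpr
    (Finset.mem_filter.mp hz).2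
  refine ⟨N, ?_, ?_, ?_⟩
  · refine isOpen_iInter_of_finite fun i => isOpen_biInter_finset fun z hz => ?_
    refine isOpen_iff_mem_nhds.mpr fun c hc => ?_
    have h1 := valued_ball_mem_nhds (Γ := Γ) (c (t i)) (hT i z hz)
    filter_upwards [(continuous_apply (t i)).continuousAt.preimage_mem_nhds h1] with c' hc'
    have : c' (t i) - ι (b i) = (c' (t i) - c (t i)) + (c (t i) - ι (b i)) := by ring
    change Valued.v (c' (t i) - ι (b i)) < _
    rw [this]
    exact lt_of_le_of_lt (Valuation.map_add _ _ _) (max_lt hc' hc)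
  · refine Set.mem_iInter.mpr fun i => Set.mem_iInter₂.mpr fun z hz => ?_
    change Valued.v (ι (r (t i)) - ι (b i)) < _
    rw [ht, sub_self, map_zero]
    exact zero_lt_iff.mpr ((Valuation.ne_zero_iff _).mpr (hT i z hz))
  · intro F' _ h r' c hc hN
    let : Algebra F' κ := ((ι : F →+* κ).comp h).toAlgebra
    have hcι : ∀ x, algebraMap F' κ (c x) = algebraMap k κ x := fun x => by
      change ι (h (c x)) = _
      rw [hc, ι.commutes]
    let : Algebra k F' := c.toAlgebra
    have : IsScalarTower k F' κ := .of_algebraMap_eq fun x => (hcι x).symm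
    have : Algebra.IsAlgebraic F' κ := Algebra.IsAlgebraic.tower_top (K := k) F'
    have : IsAlgClosure F' κ := ⟨inferInstance, inferInstance⟩
    have : Normal F' κ := IsAlgClosure.normal F' κ
    obtain ⟨p, hp⟩ := ExpChar.exists F'
    have hpF : ExpChar F p := expChar_of_injective_ringHom h.injective p
    have hb : ∀ i, ∃ n, b i ^ p ^ n ∈ h.range := by
      intro i
      obtain ⟨n, x, hx⟩ := exists_pow_mem_range_of_forall_aut (k := F') (M := κ) p (ι (b i)) (by
        intro σ
        by_contra hne
        have hz : σ (ι (b i)) ∈ T i := by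
          refine Finset.mem_filter.mpr ⟨(Set.Finite.mem_toFinset _).mpr ?_, hne⟩
          rw [Polynomial.mem_rootSet]
          refine ⟨minpoly.ne_zero (Algebra.IsIntegral.isIntegral _), ?_⟩
          have := Polynomial.aeval_algHom_apply (σ.restrictScalars k) (ι (b i))
            (minpoly k (ι (b i)))
          rw [minpoly.aeval, map_zero] at this
          exact this
        have h1 : Valued.v (ι (h (r' (t i))) - ι (b i)) < Valued.v (σ (ι (b i)) - ι (b i)) :=
          Set.mem_iInter₂.mp (Set.mem_iInter.mp hN i) _ hz
        have h2 : σ (ι (h (r' (t i)))) = ι (h (r' (t i))) := σ.commutes (r' (t i))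
        have h3 : σ (ι (b i)) - ι (b i) =
            (ι (h (r' (t i))) - ι (b i)) - σ (ι (h (r' (t i))) - ι (b i)) := by
          rw [map_sub, h2]; ring
        rw [h3] at h1
        refine absurd ((Valuation.map_sub _ _ _).trans (max_le le_rfl ?_)) (not_le.mpr h1)
        exact (hinv (σ.restrictScalars k) _).le)
      refine ⟨n, x, ι.injective ?_⟩
      rw [map_pow]
      exact hx
    choose n hn using hb
    refine ⟨p, Finset.univ.sup n, hpF, fun y => ?_⟩
    rw [← b.sum_repr y, sum_pow_char_pow]
    refine sum_mem fun i _ => ?_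
    rw [Algebra.smul_def, mul_pow, ← hc]
    refine mul_mem (pow_mem (RingHom.mem_range_self _ _) _) ?_
    rw [← Nat.add_sub_cancel' (Finset.le_sup (f := n) (Finset.mem_univ i)), pow_add, pow_mul]
    exact pow_mem (hn i) _

theorem henselianLocalRing_of_isAdicComplete (R : Type*) [CommRing R] [IsLocalRing R]
    [IsAdicComplete (IsLocalRing.maximalIdeal R) R] : HenselianLocalRing R where
  is_henselian f hf a₀ h₁ h₂ := HenselianRing.is_henselian f hf a₀ h₁ (h₂.map _)

/-! ### Reocurrence over a ring of functions -/

/-- By normality, embeddings of `L` that agree on `K` differ by an automorphism; this absorbs the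
arbitrary choices of embeddings. -/
theorem exists_aut_comp_eq {K L Ω : Type*} [Field K] [Field L] [Field Ω] [Algebra K L]
    [Normal K L] (a a₁ : L →+* Ω)
    (h : ∀ x, a (algebraMap K L x) = a₁ (algebraMap K L x)) :
    ∃ τ : L ≃ₐ[K] L, ∀ x, a x = a₁ (τ x) := by
  let : Algebra K Ω := (a₁.comp (algebraMap K L)).toAlgebra
  let : Algebra L Ω := a₁.toAlgebra
  have : IsScalarTower K L Ω := .of_algebraMap_eq fun _ => rfl
  let a' : L →ₐ[K] Ω := { a with commutes' := h }
  exact ⟨a'.restrictNormal' L, fun x => (a'.restrictNormal_commutes L x).symm⟩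

theorem valuation_eq_one_iff_mem_and_inv_mem {K : Type*} [Field K] (U : ValuationSubring K)
    {y : K} (hy : y ≠ 0) : U.valuation y = 1 ↔ y ∈ U ∧ y⁻¹ ∈ U := by
  rw [← U.valuation_le_one_iff, ← U.valuation_le_one_iff, map_inv₀,
    inv_le_one₀ (zero_lt_iff.mpr ((Valuation.ne_zero_iff _).mpr hy)), le_antisymm_iff]

theorem valuation_eq_one_iff_of_comap_eq {K Ω : Type*} [Field K] [Field Ω]
    {V : ValuationSubring K} {W : ValuationSubring Ω} (f : K →+* Ω) (h : W.comap f = V) (x : K) :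
    W.valuation (f x) = 1 ↔ V.valuation x = 1 := by
  rcases eq_or_ne x 0 with rfl | hx
  · simp
  rw [valuation_eq_one_iff_mem_and_inv_mem W ((map_ne_zero f).mpr hx),
    valuation_eq_one_iff_mem_and_inv_mem V hx, ← map_inv₀, ← h]
  rfl

/-- Two valuations are superposed. The ring `W` extends the valuation ring of `E` to `Ω`, and its
residue field `κ` is an algebraic closure of `k`, which itself carries an extension `W'` of the
henselian valuation of `k`. Henselianity of `R` makes the automorphisms of `Ω` act on `κ`, and
henselianity of the valuation of `k` makes them act by isometries. Krasner's condition and the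
separation of roots are imposed together, so that a single `κ` and a single open set serve for both.
-/
theorem exists_isOpen_forall_conj_of_henselian {k A K L F E : Type*} {Ω : Type u} {Γ₀ : Type v}
    [Field k] [LinearOrderedCommGroupWithZero Γ₀] [Valued k Γ₀]
    [HenselianLocalRing (Valued.v : Valuation k Γ₀).valuationSubring]
    [CommRing A] [Field K] [Field L] [Field F] [Algebra A K] [Algebra K L] [Algebra A L]
    [IsScalarTower A K L] [FiniteDimensional K L] [IsGalois K L]
    [Algebra k F] [FiniteDimensional k F] [TopologicalSpace F] [IsModuleTopology k F]
    [Field E] [Field Ω] [Algebra E Ω] [IsAlgClosed Ω] [Algebra.IsAlgebraic E Ω]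
    (V : ValuationSubring K) [IsDiscreteValuationRing V] (hunr : IsUnramifiedIn V L)
    (hloc : ∀ x ∈ V, ∃ c d : A, V.valuation (algebraMap A K d) = 1 ∧
      algebraMap A K d * x = algebraMap A K c)
    (R : ValuationSubring E) [HenselianLocalRing R] (t : K →+* E) (ht : R.comap t = V)
    (r : R →+* F) (hr : Function.Surjective r)
    (α : A →+* R) (hα : ∀ x, (α x : E) = t (algebraMap A K x))
    (hrα : Function.Surjective (r.comp α))
    (a : L →+* Ω) (ha : ∀ x, a (algebraMap K L x) = algebraMap E Ω (t x)) :
    ∃ (κ : Type u) (_ : Field κ) (_ : TopologicalSpace κ) (_ : IsTopologicalDivisionRing κ)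
      (_ : T1Space κ) (ι : F →+* κ), Continuous ι ∧ ∃ N : Set (A → κ), IsOpen N ∧
      (fun x => ι (r (α x))) ∈ N ∧
      ∀ ξ : A → F, (fun x => ι (ξ x)) ∈ N →
        (∀ (F' : Type w) [Field F'] (h : F' →+* F) (r' : A → F') (c : k →+* F'),
          (∀ x, h (c x) = algebraMap k F x) → (∀ x, ξ x = h (r' x)) →
          ∃ p n : ℕ, ExpChar F p ∧ ∀ y : F, y ^ p ^ n ∈ h.range) ∧
        ∀ (b : L →+* Ω) (β : A →+* R), (∀ x, b (algebraMap A L x) = algebraMap E Ω (β x)) →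
          (∀ x, r (β x) = ξ x) → ∃ σ₁ : L ≃ₐ[K] L, ∀ (s : Ω ≃ₐ[E] Ω) (σ σ' : L ≃ₐ[K] L),
            (∀ x, s (a x) = a (σ x)) → (∀ x, s (b (σ₁ x)) = b (σ₁ (σ' x))) → σ = σ' := by
  classical
  obtain ⟨W, hW⟩ := exists_valuationSubring_comap_eq (Ω := Ω) R
  have : IsAlgClosure E Ω := ⟨inferInstance, inferInstance⟩
  have : Normal E Ω := IsAlgClosure.normal E Ω
  have hRW : ∀ x : R, algebraMap E Ω x ∈ W := fun x => (algebraMap_mem_iff_of_comap_eq hW).mpr x.2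
  let RW : R →+* W := ((algebraMap E Ω).comp R.subtype).codRestrict W.toSubring hRW
  let κ := IsLocalRing.ResidueField W
  obtain ⟨ι, hι⟩ := exists_residue_hom hW r hr
  have hι' : ∀ z : R, ι (r z) = IsLocalRing.residue W (RW z) := hι
  have : IsAlgClosed κ := isAlgClosed_residueField W
  have halg := isAlgebraic_residueField hW r ι hι
  let : Algebra F κ := ι.toAlgebra
  let : Algebra k κ := (ι.comp (algebraMap k F)).toAlgebra
  have : IsScalarTower k F κ := .of_algebraMap_eq fun _ => rfl
  have : Algebra.IsAlgebraic F κ := ⟨fun y => halg y⟩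
  have : Algebra.IsAlgebraic k κ := Algebra.IsAlgebraic.trans k F κ
  have : IsAlgClosure k κ := ⟨inferInstance, inferInstance⟩
  have : Normal k κ := IsAlgClosure.normal k κ
  obtain ⟨W', hW'⟩ := exists_valuationSubring_comap_eq (Ω := κ)
    (Valued.v : Valuation k Γ₀).valuationSubring
  let : Valued κ W'.ValueGroup := Valued.mk' W'.valuation
  have hk : Continuous (algebraMap k κ) := continuous_algebraMap_of_comap_eq (Γ₀ := Γ₀) W' hW' rfl
  have : ContinuousSMul k κ := continuousSMul_of_algebraMap k κ hk
  have hιc : Continuous ι :=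
    IsModuleTopology.continuous_of_linearMap (IsScalarTower.toAlgHom k F κ).toLinearMap
  have hinv : ∀ (σ : κ ≃ₐ[k] κ) x, (Valued.v : Valuation κ W'.ValueGroup) (σ x) = Valued.v x :=
    fun σ x => valuation_apply_of_henselian hW' σ x
  obtain ⟨N₁, hN₁, hN₁m, hN₁'⟩ := exists_isOpen_forall_purelyInseparable.{w} hinv
    (IsScalarTower.toAlgHom k F κ) (r.comp α) hrα
  -- the maximal ideal of the integral closure
  have hWV : W.comap (a.comp (algebraMap K L)) = V := by
    ext x
    rw [ValuationSubring.mem_comap, RingHom.comp_apply, ha, algebraMap_mem_iff_of_comap_eq hW]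
    exact SetLike.ext_iff.mp ht x
  have hVW : ∀ x : V, a (algebraMap K L x) ∈ W := fun x =>
    (SetLike.ext_iff.mp hWV (x : K)).mpr x.2
  have hBW : ∀ y : integralClosure V L, a y ∈ W := by
    intro y
    let : Algebra V Ω := ((a.comp (algebraMap K L)).comp V.subtype).toAlgebra
    have hy : IsIntegral V (a y) := by
      obtain ⟨P, hP, hPy⟩ := y.2
      refine ⟨P, hP, ?_⟩
      have := congrArg a hPy
      rw [Polynomial.hom_eval₂, map_zero] at this
      exact this
    exact mem_valuationSubring_of_isIntegral W hVW hy
  let q : integralClosure V L →+* W :=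
    (a.comp (algebraMap (integralClosure V L) L)).codRestrict W.toSubring hBW
  let Q : Ideal (integralClosure V L) := (IsLocalRing.maximalIdeal W).comap q
  have hQV : Q.comap (algebraMap V (integralClosure V L)) = IsLocalRing.maximalIdeal V := by
    ext x
    have h := valuation_eq_one_iff_of_comap_eq (a.comp (algebraMap K L)) hWV (x : K)
    have h₁ := W.valuation_eq_one_iff (q (algebraMap V (integralClosure V L) x))
    have h₂ := V.valuation_eq_one_iff x
    rw [Ideal.mem_comap, Ideal.mem_comap, IsLocalRing.mem_maximalIdeal,
      IsLocalRing.mem_maximalIdeal, mem_nonunits_iff, mem_nonunits_iff, h₁, h₂]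
    exact not_congr h
  have hQ : Q.IsMaximal := by
    refine Ideal.isMaximal_of_isIntegral_of_isMaximal_comap (R := V) Q ?_
    rw [hQV]; infer_instance
  have : Fintype (L ≃ₐ[K] L) := Fintype.ofFinite _
  obtain ⟨θ, d, P, g, hd, hP, hg, hsep⟩ := exists_generic_root V hunr hloc Q
  have hdW : IsLocalRing.residue W (RW (α d)) ≠ 0 := by
    rw [ne_eq, IsLocalRing.residue_eq_zero_iff, IsLocalRing.mem_maximalIdeal, mem_nonunits_iff,
      not_not, W.valuation_eq_one_iff]
    have := (valuation_eq_one_iff_of_comap_eq (a.comp (algebraMap K L)) hWV _).mpr hd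
    rw [RingHom.comp_apply, ha, ← hα] at this
    exact this
  obtain ⟨N₂, hN₂, hN₂m, hN₂'⟩ := exists_isOpen_forall_conj (Γ := W'.ValueGroup) W
    (IsLocalRing.residue W)
    (fun x hx => by rwa [ne_eq, IsLocalRing.residue_eq_zero_iff, IsLocalRing.mem_maximalIdeal,
      mem_nonunits_iff, not_not] at hx) hP hg a (RW.comp α)
    (fun x => by
      rw [IsScalarTower.algebraMap_apply A K L, ha, ← hα]; rfl) hdW
    (fun τ hτ x hx => by
      obtain ⟨y, hy, hyQ⟩ := hsep τ hτ
      rw [ne_eq, IsLocalRing.residue_eq_zero_iff]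
      have : x = q y := Subtype.ext (by rw [hx, ← hy]; rfl)
      rw [this]
      exact hyQ)
  refine ⟨κ, inferInstance, inferInstance, inferInstance, inferInstance, ι, hιc, N₁ ∩ N₂,
    hN₁.inter hN₂, ⟨hN₁m, ?_⟩, fun ξ hξ => ⟨fun F' _ h r' c hc hr' => ?_, fun b β hb hβ => ?_⟩⟩
  · convert hN₂m using 2 with x
    exact hι' _
  · refine hN₁' F' h r' c hc ?_
    convert hξ.1 using 2 with x
    rw [hr']; rfl
  · obtain ⟨σ₁, h₁⟩ := hN₂' b (RW.comp β) (fun x => (hb x).symm) (by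
      convert hξ.2 using 2 with x
      rw [← hβ, hι']; rfl)
    refine ⟨σ₁, fun s σ σ' hσ hσ' => ?_⟩
    have hsW : ∀ (s : Ω ≃ₐ[E] Ω) (x : W), s x ∈ W := fun s x => map_mem_of_henselian R W hW s x.2
    let sW : W ≃+* W :=
      { toFun := fun x => ⟨s x, hsW s x⟩
        invFun := fun x => ⟨s.symm x, hsW s.symm x⟩
        left_inv := fun x => Subtype.ext (s.symm_apply_apply x)
        right_inv := fun x => Subtype.ext (s.apply_symm_apply x)
        map_mul' := fun x y => Subtype.ext (map_mul s (x : Ω) y)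
        map_add' := fun x y => Subtype.ext (map_add s (x : Ω) y) }
    let s' : κ ≃+* κ := IsLocalRing.ResidueField.mapEquiv sW
    have hs' : ∀ x, s' (IsLocalRing.residue W x) = IsLocalRing.residue W (sW x) := fun x => rfl
    -- The automorphism fixes `E`, hence the residue field `F` of `R`, hence `k`; this is what makes
    -- it an isometry of `κ`.
    let s'' : κ ≃ₐ[k] κ := { s' with
      commutes' := fun x => by
        obtain ⟨z, hz⟩ := hr (algebraMap k F x)
        change s' (ι (algebraMap k F x)) = ι (algebraMap k F x)
        rw [← hz, hι', hs']
        congr 1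
        exact Subtype.ext (s.commutes z) }
    exact h₁ (s : Ω →+* Ω) (s' : κ →+* κ) (fun x => ⟨sW x, rfl, (hs' x).symm⟩)
      (fun x => hinv s'' x) σ σ' hσ hσ'

end

/-! ### Reocurrence for discrete valuation rings above an affine coordinate ring -/

section

/-- The image of `A` is a `k`-subalgebra of an algebraic extension of `k`, so it contains the
inverses of its nonzero elements, in particular those of the denominators. Krasner's lemma needs
this to realize a basis of `F` by elements of `A`. -/
theorem surjective_comp_of_forall_exists_mul_eq {k A K F : Type*} [Field k] [CommRing A] [Field K]
    [Field F] [Algebra A K] [Algebra k F] [Algebra.IsAlgebraic k F] (V : ValuationSubring K)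
    (hloc : ∀ x ∈ V, ∃ c d : A, V.valuation (algebraMap A K d) = 1 ∧
      algebraMap A K d * x = algebraMap A K c)
    (f : A →+* V) (hf : ∀ x, (f x : K) = algebraMap A K x) (r : V →+* F)
    (hr : Function.Surjective r) (c : k →+* A) (hc : ∀ x, r (f (c x)) = algebraMap k F x) :
    Function.Surjective (r.comp f) := by
  intro z
  obtain ⟨x, rfl⟩ := hr z
  obtain ⟨y, d, hd, hy⟩ := hloc x x.2
  let S : Subalgebra k F := { (r.comp f).range with
    algebraMap_mem' := fun x => ⟨c x, hc x⟩ }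
  have hd' : IsUnit (f d) := by rwa [V.valuation_eq_one_iff, hf]
  have h1 : f d * x = f y := Subtype.ext (by rw [MulMemClass.coe_mul, hf, hf, hy])
  have h2 : r x = (r (f d))⁻¹ * r (f y) := by
    rw [← h1, map_mul, inv_mul_cancel_left₀ (hd'.map r).ne_zero]
  have h3 : r x ∈ S := by
    rw [h2]
    exact mul_mem (S.inv_mem_of_algebraic (x := ⟨r (f d), ⟨d, rfl⟩⟩)
      (Algebra.IsAlgebraic.isAlgebraic _)) ⟨y, rfl⟩
  exact h3

/-- The reocurrence theorem for discrete valuation rings of `K` above a `k`-algebra `A`. -/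
theorem exists_isOpen_reocurrence {k A F : Type*} {K : Type u} {L : Type*} {Γ₀ : Type v}
    [Field k] [LinearOrderedCommGroupWithZero Γ₀] [Valued k Γ₀]
    [HenselianLocalRing (Valued.v : Valuation k Γ₀).valuationSubring]
    [CommRing A] [Field K] [Field L] [Field F] [Algebra A K] [Algebra K L]
    [FiniteDimensional K L] [IsGalois K L]
    [Algebra k F] [FiniteDimensional k F] [TopologicalSpace F] [IsModuleTopology k F]
    (V : ValuationSubring K) [IsDiscreteValuationRing V] (hunr : IsUnramifiedIn V L)
    (hloc : ∀ x ∈ V, ∃ c d : A, V.valuation (algebraMap A K d) = 1 ∧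
      algebraMap A K d * x = algebraMap A K c)
    (f : A →+* V) (hf : ∀ x, (f x : K) = algebraMap A K x) (r : V →+* F)
    (hr : Function.Surjective r) (c : k →+* A) (hc : ∀ x, r (f (c x)) = algebraMap k F x) :
    ∃ (κ : Type u) (_ : Field κ) (_ : TopologicalSpace κ) (_ : IsTopologicalDivisionRing κ)
      (_ : T1Space κ) (ι : F →+* κ), Continuous ι ∧ ∃ N : Set (A → κ), IsOpen N ∧
      (fun x => ι (r (f x))) ∈ N ∧
      ∀ (V' : ValuationSubring K) [IsDiscreteValuationRing V'] (f' : A →+* V')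
        (_ : ∀ x, (f' x : K) = algebraMap A K x) (F' : Type w) [Field F'] (r' : V' →+* F')
        (_ : Function.Surjective r') (h : F' →+* F)
        (_ : ∀ x, h (r' (f' (c x))) = algebraMap k F x),
        (fun x => ι (h (r' (f' x)))) ∈ N →
      ∀ (a : L →+* AlgebraicClosure V.valuation.Completion)
        (b : L →+* AlgebraicClosure V'.valuation.Completion),
        (∀ x, a (algebraMap K L x) = algebraMap _ _ (toCompletion V x)) →
        (∀ x, b (algebraMap K L x) = algebraMap _ _ (toCompletion V' x)) →
        ∃ (φ : (AlgebraicClosure V.valuation.Completion ≃ₐ[V.valuation.Completion]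
              AlgebraicClosure V.valuation.Completion) ≃ₜ*
            (AlgebraicClosure V'.valuation.Completion ≃ₐ[V'.valuation.Completion]
              AlgebraicClosure V'.valuation.Completion)) (ρ : L ≃ₐ[K] L),
          ∀ s (σ σ' : L ≃ₐ[K] L), (∀ x, s (a x) = a (σ x)) → (∀ x, φ s (b x) = b (σ' x)) →
            σ' = ρ * σ * ρ⁻¹ := by
  let E := V.valuation.Completion
  let : Algebra A L := ((algebraMap K L).comp (algebraMap A K)).toAlgebra
  have : IsScalarTower A K L := .of_algebraMap_eq fun _ => rfl
  -- The open set has to be chosen before the embedding `a` is given, so it is built from a fixed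
  -- `a₁`; `a` is compared with `a₁` afterwards.
  obtain ⟨a₁, ha₁⟩ : ∃ a₁ : L →+* AlgebraicClosure E,
      ∀ x, a₁ (algebraMap K L x) = algebraMap _ _ (toCompletion V x) := by
    let : Algebra K (AlgebraicClosure E) :=
      ((algebraMap E (AlgebraicClosure E)).comp (toCompletion V)).toAlgebra
    let a₁ : L →ₐ[K] AlgebraicClosure E := IsAlgClosed.lift
    exact ⟨a₁, fun x => a₁.commutes x⟩
  obtain ⟨r₂, hr₂, hr₂r⟩ := exists_residue_extension V r hr
  let α : A →+* completionRing V := (((toCompletion V).comp V.subtype).comp f).codRestrict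
    (completionRing V).toSubring fun x => (toCompletion_mem_iff V).mpr (f x).2
  have hα : ∀ x, r₂ (α x) = r (f x) := fun x => hr₂r (f x)
  have : HenselianLocalRing (completionRing V) := henselianLocalRing_of_isAdicComplete _
  have hsurj : Function.Surjective (r₂.comp α) := by
    have h1 := surjective_comp_of_forall_exists_mul_eq V hloc f hf r hr c hc
    rwa [show r.comp f = r₂.comp α from RingHom.ext fun x => (hα x).symm] at h1
  obtain ⟨κ, i₁, i₂, i₃, i₄, ι, hι, N, hN, hNm, H⟩ :=
    exists_isOpen_forall_conj_of_henselian.{u, v, w} (k := k) V hunr hloc (completionRing V)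
      (toCompletion V) (by ext x; exact toCompletion_mem_iff V) r₂ hr₂ α
      (fun x => congrArg (toCompletion V) (hf x)) hsurj a₁ ha₁
  refine ⟨κ, i₁, i₂, i₃, i₄, ι, hι, N, hN, ?_, ?_⟩
  · convert hNm using 2 with x
    rw [hα]
  intro V' _ f' hf' F' _ r' hr' h hhc hh a b ha hb
  obtain ⟨h₁, h₂⟩ := H _ hh
  obtain ⟨p, n, hp, hpn⟩ := h₁ F' h (fun x => r' (f' x)) ((r'.comp f').comp c) hhc fun _ => rfl
  obtain ⟨ψ, hψ, hψr⟩ := exists_completion_lift V' V ((algebraMap A K).comp c)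
    (fun x => (hf' (c x)) ▸ (f' (c x)).2) (fun x => (hf (c x)) ▸ (f (c x)).2) r' hr' r₂ hr₂ h p n hpn
  have : ExpChar k p := (algebraMap k F).expChar (algebraMap k F).injective p
  have : ExpChar V.valuation.Completion p := expChar_of_injective_ringHom
    ((toCompletion V).comp ((algebraMap A K).comp c)).injective p
  -- The residue map goes from `F'` to `F`, so the completions are mapped from `V'` to `V`.
  -- Transport by `Ψ` puts both embeddings of `L` in the algebraic closure of the completion at `V`.
  obtain ⟨Ψ, hΨ, φ, hφ⟩ := exists_autEquiv_of_pow_mem_range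
    (Ω₁ := AlgebraicClosure V'.valuation.Completion)
    (Ω₂ := AlgebraicClosure V.valuation.Completion) ψ p n hψ
  obtain ⟨τ, hτ⟩ := exists_aut_comp_eq (K := K) a a₁ fun x => (ha x).trans (ha₁ x).symm
  have hβ : ∀ x, ψ (toCompletion V' (f' x)) ∈ completionRing V := fun x => (hψr (f' x)).choose
  let β : A →+* completionRing V :=
    ((ψ.comp ((toCompletion V').comp V'.subtype)).comp f').codRestrict
      (completionRing V).toSubring hβ
  obtain ⟨σ₁, hσ₁⟩ := h₂ ((Ψ : _ →+* _).comp b) β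
    (fun x => by
      rw [IsScalarTower.algebraMap_apply A K L, RingHom.comp_apply, hb, ← hf']
      exact hΨ _)
    (fun x => (hψr (f' x)).choose_spec)
  -- Passing from `a` to `a₁` conjugates by `τ`, and the relabelling of the roots at `b` conjugates
  -- by `σ₁`.
  refine ⟨φ, σ₁ * τ, fun s σ σ' hσ hσ' => ?_⟩
  have key := hσ₁ s (τ * σ * τ⁻¹) (σ₁⁻¹ * σ' * σ₁)
    (fun x => by
      have := hσ (τ⁻¹ x)
      rw [hτ, hτ, ← AlgEquiv.mul_apply, mul_inv_cancel] at this
      exact this)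
    (fun x => by
      have := congrArg Ψ (hσ' (σ₁ x))
      rw [hφ] at this
      refine this.trans (congrArg (fun z => Ψ (b z)) ?_)
      rw [← AlgEquiv.mul_apply, ← AlgEquiv.mul_apply]
      group)
  rw [mul_inv_rev, show σ₁ * τ * σ * (τ⁻¹ * σ₁⁻¹) = σ₁ * (τ * σ * τ⁻¹) * σ₁⁻¹ by group, key]
  group

end

/-! ### Values at rational points, residue fields and places -/

section

section Points

variable {k : Type u} [Field k] {X : Scheme.{u}} {π : X ⟶ Spec (.of k)}
  {ℓ : Type u} [Field ℓ] [Algebra k ℓ]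

/-- An arbitrary factorization through a stalk covers both the canonical one at `p.pt` and the
residue map that defines the tautological point, without transport along `(tautPoint π x).pt = x`.
-/
theorem Points.evalHom_eq_of_fac (p : Points π ℓ) {x : X} (φ : X.presheaf.stalk x ⟶ .of ℓ)
    [IsLocalHom φ.hom] (hp : p.1 = Spec.map φ ≫ X.fromSpecStalk x) (V : X.Opens)
    (h : p.LiesIn V) (hx : x ∈ V) (g : Γ(X, V)) :
    p.evalHom V h g = φ (X.presheaf.germ V x hx g) := by
  obtain ⟨p, hp'⟩ := p
  dsimp only at hp
  subst hp
  have hm : (Spec.map φ ≫ X.fromSpecStalk x) (IsLocalRing.closedPoint ℓ) ∈ V :=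
    h (Set.mem_univ _)
  have h1 := Scheme.germ_stalkClosedPointTo_Spec_fromSpecStalk φ V hm
  rw [Scheme.germ_stalkClosedPointTo] at h1
  refine Eq.trans ?_ congr($h1 g)
  simp only [Functor.mapIso_hom, Iso.trans_hom]
  rfl

/-- The embedding of residue fields defined by a rational point. -/
def Points.residueHom (p : Points π ℓ) : X.residueField p.pt →+* ℓ :=
  (Scheme.descResidueField (Scheme.stalkClosedPointTo p.1)).hom

theorem Points.evalHom_eq_residueHom (p : Points π ℓ) (V : X.Opens) (h : p.LiesIn V)
    (hx : p.pt ∈ V) (g : Γ(X, V)) :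
    p.evalHom V h g = p.residueHom (X.residue p.pt (X.presheaf.germ V p.pt hx g)) :=
  p.evalHom_eq_of_fac (Scheme.stalkClosedPointTo p.1)
    (Scheme.Spec_stalkClosedPointTo_fromSpecStalk p.1).symm V h hx g

theorem evalHom_tautPoint {x : X} (V : X.Opens) (h : (tautPoint π x).LiesIn V) (hx : x ∈ V)
    (g : Γ(X, V)) : (tautPoint π x).evalHom V h g = X.residue x (X.presheaf.germ V x hx g) := by
  let φ : X.presheaf.stalk x ⟶ .of (ResidueField π x) := X.residue x
  have : IsLocalHom φ.hom :=
    inferInstanceAs (IsLocalHom (IsLocalRing.residue (X.presheaf.stalk x)))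
  exact (tautPoint π x).evalHom_eq_of_fac φ rfl V h hx g

variable (π) in
/-- The structure of `k`-algebra on the sections of a `k`-scheme. -/
def sectionsHom (V : X.Opens) : k →+* Γ(X, V) :=
  (π.appLE ⊤ V le_top).hom.comp (Scheme.ΓSpecIso (.of k)).inv.hom

theorem Points.evalHom_sectionsHom (p : Points π ℓ) (V : X.Opens) (h : p.LiesIn V) (x : k) :
    p.evalHom V h (sectionsHom π V x) = algebraMap k ℓ x := by
  have h1 : (Scheme.ΓSpecIso (.of k)).inv ≫ (π.appLE ⊤ V le_top ≫ p.1.appLE V ⊤ h) ≫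
      (Scheme.ΓSpecIso (.of ℓ)).hom = CommRingCat.ofHom (algebraMap k ℓ) := by
    have h2 := Scheme.Hom.appLE_comp_appLE p.1 π ⊤ V ⊤ le_top h
    rw [h2, Iso.inv_comp_eq, ← Scheme.ΓSpecIso_naturality]
    congr 1
    simp only [p.2]
    exact Scheme.Hom.appLE_eq_app _
  exact congr($h1 x)

end Points

/-! ### Local rings of an integral scheme as valuation rings of its function field -/

section Places

variable {C : Scheme.{u}} [IsIntegral C] {K : Type u} [Field K] (e : C.functionField ≃+* K)

/-- The embedding of a local ring of `C` in the function field. -/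
def stalkHom (y : C) : C.presheaf.stalk y →+* K :=
  e.toRingHom.comp (algebraMap (C.presheaf.stalk y) C.functionField)

theorem stalkHom_injective (y : C) : Function.Injective (stalkHom e y) :=
  e.injective.comp (IsFractionRing.injective (C.presheaf.stalk y) C.functionField)

theorem mem_place_iff (y : C) [ValuationRing (C.presheaf.stalk y)] (x : K) :
    x ∈ place e y ↔ ∃ s, stalkHom e y s = x := by
  let V : ValuationSubring K := { (stalkHom e y).range with
    mem_or_inv_mem' := fun x => by
      rcases ValuationRing.isInteger_or_isInteger (C.presheaf.stalk y) (e.symm x) with h | h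
      · obtain ⟨s, hs⟩ := h
        exact Or.inl ⟨s, by simp [stalkHom, hs]⟩
      · obtain ⟨s, hs⟩ := h
        exact Or.inr ⟨s, by simp [stalkHom, hs]⟩ }
  rw [place_eq e y V (LocalSubring.ext (by rfl))]
  rfl

/-- A local ring of `C` which is a valuation ring, as a valuation subring of `K`. -/
def stalkEquivPlace (y : C) [ValuationRing (C.presheaf.stalk y)] :
    C.presheaf.stalk y ≃+* place e y :=
  RingEquiv.ofBijective ((stalkHom e y).codRestrict (place e y).toSubring fun s =>
    (mem_place_iff e y _).mpr ⟨s, rfl⟩) ⟨fun _ _ h => stalkHom_injective e y congr($h),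
      fun x => by
        obtain ⟨s, hs⟩ := (mem_place_iff e y _).mp x.2
        exact ⟨s, Subtype.ext hs⟩⟩

theorem coe_stalkEquivPlace (y : C) [ValuationRing (C.presheaf.stalk y)]
    (s : C.presheaf.stalk y) : (stalkEquivPlace e y s : K) = stalkHom e y s := rfl

theorem isDiscreteValuationRing_place (y : C) [IsDiscreteValuationRing (C.presheaf.stalk y)] :
    IsDiscreteValuationRing (place e y) :=
  IsDiscreteValuationRing.RingEquivClass.isDiscreteValuationRing (stalkEquivPlace e y)

end Places

theorem toGal_surjective {K L : Type*} [Field K] [Field L] [Algebra K L] [Normal K L]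
    (j : L →ₐ[K] AlgebraicClosure K) : Function.Surjective (toGal j) := by
  intro ρ
  let : Algebra L (AlgebraicClosure K) := j.toRingHom.toAlgebra
  have : IsScalarTower K L (AlgebraicClosure K) := .of_algebraMap_eq fun x => (j.commutes x).symm
  obtain ⟨σ, hσ⟩ := AlgEquiv.restrictNormalHom_surjective (F := K) (K₁ := L) (AlgebraicClosure K) ρ
  exact ⟨σ, hσ⟩

theorem apply_toGal_absGaloisMap {K K' L : Type*} [Field K] [Field K'] [Field L] [Algebra K K']
    [Algebra K L] [Normal K L] (j : L →ₐ[K] AlgebraicClosure K)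
    (i : AlgebraicClosure K →ₐ[K] AlgebraicClosure K')
    (s : AlgebraicClosure K' ≃ₐ[K'] AlgebraicClosure K') (x : L) :
    i (j (toGal j (absGaloisMap i s) x)) = s (i (j x)) :=
  (congrArg i (apply_restrictAlong (K' := K) j (absGaloisMap i s) x)).trans
    (apply_restrictAlong (K' := K') i s (j x))

/-- The common endpoint of both cases. On an affine open `V` around `v`, sections play the role of
`A`, evaluation at a point is reduction followed by its residue embedding in k(v), and the condition
`N` on values is open on points. Discreteness is required at every `w` since k(w) may be smaller
than k(v). -/
theorem reocursAt_of_isDiscreteValuationRing {k : Type u} [Field k] {Γ₀ : Type v}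
    [LinearOrderedCommGroupWithZero Γ₀] [Valued k Γ₀]
    [HenselianLocalRing (Valued.v : Valuation k Γ₀).valuationSubring]
    {C : Scheme.{u}} [IsIntegral C] (π : C ⟶ Spec (.of k)) {K : Type u} [Field K]
    (e : C.functionField ≃+* K) (L : Type w) [Field L] [Algebra K L] [FiniteDimensional K L]
    [IsGalois K L] (v : C) [FiniteDimensional k (ResidueField π v)]
    (hD : ∀ w : Points π (ResidueField π v), IsDiscreteValuationRing (C.presheaf.stalk w.pt))
    (hunr : IsUnramifiedIn (place e v) L) : ReocursAt π e L v := by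
  have hDv : IsDiscreteValuationRing (C.presheaf.stalk v) := tautPoint_pt (π := π) v ▸ hD (tautPoint π v)
  have := isDiscreteValuationRing_place e v
  obtain ⟨_, ⟨V, hV, rfl⟩, hvV, -⟩ :=
    C.isBasis_affineOpens.exists_subset_of_mem_open (Set.mem_univ v) isOpen_univ
  replace hvV : v ∈ V := hvV
  have : Nonempty V := ⟨⟨v, hvV⟩⟩
  let : Algebra Γ(C, V) K := (e.toRingHom.comp (C.germToFunctionField V).hom).toAlgebra
  have hgerm : ∀ (y : C) (hy : y ∈ V) (x : Γ(C, V)),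
      stalkHom e y (C.presheaf.germ V y hy x) = algebraMap Γ(C, V) K x := fun y hy x =>
    congrArg e (Scheme.algebraMap_germ_eq_germToFunctionField (X := C) hy x)
  have : IsModuleTopology k (ResidueField π v) := ⟨rfl⟩
  have htaut : (tautPoint π v).LiesIn V :=
    (Points.liesIn_iff _ _).mpr ((tautPoint_pt (π := π) v).symm ▸ hvV)
  have hloc : ∀ x ∈ place e v, ∃ c d : Γ(C, V),
      (place e v).valuation (algebraMap Γ(C, V) K d) = 1 ∧
      algebraMap Γ(C, V) K d * x = algebraMap Γ(C, V) K c := by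
    intro x hx
    obtain ⟨s, rfl⟩ := (mem_place_iff e v x).mp hx
    let : Algebra Γ(C, V) (C.presheaf.stalk v) := (C.presheaf.germ V v hvV).hom.toAlgebra
    have : IsLocalization.AtPrime (C.presheaf.stalk v) (hV.primeIdealOf ⟨v, hvV⟩).asIdeal :=
      hV.isLocalization_stalk ⟨v, hvV⟩
    obtain ⟨⟨c, d⟩, hcd⟩ := IsLocalization.surj
      (hV.primeIdealOf ⟨v, hvV⟩).asIdeal.primeCompl s
    refine ⟨c, d, ?_, ?_⟩
    · have h1 := (IsLocalization.map_units (C.presheaf.stalk v) d).map (stalkEquivPlace e v)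
      rw [(place e v).valuation_eq_one_iff, coe_stalkEquivPlace] at h1
      rw [← hgerm v hvV]
      exact h1
    · have h1 := congrArg (stalkHom e v) hcd
      rw [map_mul, mul_comm] at h1
      rw [← hgerm v hvV, ← hgerm v hvV]
      exact h1
  obtain ⟨κ, _, _, _, _, ι, hι, N, hN, hNm, H⟩ := exists_isOpen_reocurrence.{u, v, u} (k := k)
    (F := ResidueField π v) (place e v) hunr hloc
    ((stalkEquivPlace e v : _ →+* _).comp (C.presheaf.germ V v hvV).hom)
    (fun x => hgerm v hvV x)
    ((C.residue v).hom.comp ((stalkEquivPlace e v).symm : _ →+* _))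
    ((C.residue_surjective v).comp (stalkEquivPlace e v).symm.surjective) (sectionsHom π V)
    (fun x => by
      rw [← (tautPoint π v).evalHom_sectionsHom V htaut, evalHom_tautPoint V htaut hvV]
      exact congrArg (C.residue v) ((stalkEquivPlace e v).symm_apply_apply _))
  refine ⟨_, Points.isOpen_setOf_evalHom_mem ι hι hN, ⟨htaut, ?_⟩, ?_⟩
  · convert hNm using 2 with x
    rw [evalHom_tautPoint V htaut hvV]
    exact congrArg (fun z => ι (C.residue v z)) ((stalkEquivPlace e v).symm_apply_apply _).symm
  rintro p ⟨hp, hpN⟩ j iv iw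
  have := hD p
  have := isDiscreteValuationRing_place e p.pt
  have hpV : p.pt ∈ V := (p.liesIn_iff V).mp hp
  let f' : Γ(C, V) →+* place e p.pt :=
    (stalkEquivPlace e p.pt : _ →+* _).comp (C.presheaf.germ V p.pt hpV).hom
  let r' : place e p.pt →+* C.residueField p.pt :=
    (C.residue p.pt).hom.comp ((stalkEquivPlace e p.pt).symm : _ →+* _)
  have hev : ∀ x : Γ(C, V), p.residueHom (r' (f' x)) = p.evalHom V hp x := fun x => by
    rw [p.evalHom_eq_residueHom V hp hpV]
    exact congrArg (fun z => p.residueHom (C.residue p.pt z))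
      ((stalkEquivPlace e p.pt).symm_apply_apply _)
  obtain ⟨φ, ρ, hφ⟩ := H (place e p.pt) f' (fun x => hgerm p.pt hpV x) (C.residueField p.pt) r'
     ((C.residue_surjective p.pt).comp (stalkEquivPlace e p.pt).symm.surjective)
     p.residueHom (fun x => (hev _).trans (p.evalHom_sectionsHom V hp x))
    ((congrArg (· ∈ N) (funext fun x => congrArg ι (hev x))).mpr hpN)
    (iv.comp j).toRingHom (iw.comp j).toRingHom 
    (fun x => ((iv.comp j).commutes x).trans
      (IsScalarTower.algebraMap_apply K (Completion e v) (AlgebraicClosure (Completion e v)) x))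
    (fun x => ((iw.comp j).commutes x).trans (IsScalarTower.algebraMap_apply K
      (Completion e p.pt) (AlgebraicClosure (Completion e p.pt)) x))
  obtain ⟨ρ', hρ'⟩ := toGal_surjective j ρ
  refine ⟨φ, ρ', fun s => ?_⟩
  rw [map_mul, map_mul, map_inv, hρ']
  exact hφ s _ _ (fun x => (apply_toGal_absGaloisMap j iv s x).symm)
    (fun x => (apply_toGal_absGaloisMap j iw (φ s) x).symm)

end

section

/-! ### Smooth curves -/

/-- Unramifiedness says that the maximal ideal of the localization is generated by the prime of `P`
below, which is principal; the element `x` shows that the localization is not a field. -/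
theorem isDiscreteValuationRing_localization_of_etale {P B : Type*} [CommRing P] [IsDomain P]
    [IsPrincipalIdealRing P] [CommRing B] [IsDomain B] [Algebra P B] [Algebra.Etale P B]
    (q : Ideal B) [q.IsPrime] {x : P} (hx : x ≠ 0) (hxq : algebraMap P B x ∈ q) :
    IsDiscreteValuationRing (Localization.AtPrime q) := by
  have : IsNoetherianRing B := Algebra.FiniteType.isNoetherianRing P B
  have hinj : Function.Injective (algebraMap P B) := FaithfulSMul.algebraMap_injective P B
  have : IsDomain (Localization.AtPrime q) :=
    IsLocalization.isDomain_localization q.primeCompl_le_nonZeroDivisors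
  have hf : ¬ IsField (Localization.AtPrime q) := fun h => hx <| hinj <|
    IsLocalization.injective (Localization.AtPrime q) q.primeCompl_le_nonZeroDivisors <| by
    rw [map_zero, map_zero, ← Ideal.mem_bot, ← IsLocalRing.isField_iff_maximalIdeal_eq.mp h]
    exact (IsLocalization.AtPrime.to_map_mem_maximal_iff _ q _).mpr hxq
  have : q.LiesOver (q.under P) := ⟨rfl⟩
  let := Localization.AtPrime.algebraOfLiesOver (q.under P) q
  have h := ((Algebra.isUnramifiedAt_iff_map_eq P (q.under P) q).mp inferInstance).2
  refine ((IsDiscreteValuationRing.TFAE _ hf).out 0 4).mpr ?_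
  rw [← h]
  obtain ⟨y, hy⟩ := IsPrincipalIdealRing.principal (q.under P)
  rw [hy]
  exact ⟨algebraMap P _ y, by
    rw [Ideal.submodule_span_eq, Ideal.submodule_span_eq, Ideal.map_span, Set.image_singleton]⟩

instance (k : Type*) [Field k] : IsPrincipalIdealRing (MvPolynomial (Fin 1) k) :=
  let e := MvPolynomial.uniqueAlgEquiv k (Fin 1)
  .of_surjective e.symm.toRingEquiv.toRingHom e.symm.surjective

section

variable {k : Type u} [Field k] {C : Scheme.{u}} (π : C ⟶ Spec (.of k))

theorem finiteDimensional_residueField_of_isClosed [LocallyOfFiniteType π] {v : C}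
    (hv : IsClosed {v}) : FiniteDimensional k (ResidueField π v) := by
  have := isClosed_singleton_iff_isClosedImmersion.mp hv
  let f := Spec.preimage (C.fromSpecResidueField v ≫ π)
  have h : LocallyOfFiniteType (Spec.map f) := by
    rw [Spec.map_preimage]
    infer_instance
  have h1 : f.hom.FiniteType := (HasRingHomProperty.Spec_iff (P := @LocallyOfFiniteType)).mp h
  have : Algebra.FiniteType k (ResidueField π v) := h1
  exact finite_of_finite_type_of_isJacobsonRing k (ResidueField π v)

theorem exists_etale_sectionsHom [SmoothOfRelativeDimension 1 π] (y : C) :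
    ∃ V : C.Opens, IsAffineOpen V ∧ y ∈ V ∧ ∃ g : MvPolynomial (Fin 1) k →+* Γ(C, V),
      g.comp MvPolynomial.C = sectionsHom π V ∧ g.Etale := by
  obtain ⟨U, hU, V, hV, hy, e, h⟩ :=
    SmoothOfRelativeDimension.exists_isStandardSmoothOfRelativeDimension (n := 1) (f := π) y
  have hUt : U = ⊤ := by
    refine top_le_iff.mp fun x _ => ?_
    have : x = π y := Subsingleton.elim (α := PrimeSpectrum k) _ _
    rw [this]
    exact e hy
  subst hUt
  refine ⟨V, hV, hy, RingHom.IsStandardSmoothOfRelativeDimension.exists_etale_mvPolynomial ?_⟩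
  exact RingHom.isStandardSmoothOfRelativeDimension_respectsIso.2 _
    (Scheme.ΓSpecIso (.of k)).symm.commRingCatIsoToRingEquiv h

/-- In an étale chart over the affine line the coordinate takes at the point a value algebraic over
`k`. A polynomial annihilating this value gives the nonzero element of the prime that excludes the
generic point. -/
theorem isDiscreteValuationRing_stalk_of_smooth [IsIntegral C] [SmoothOfRelativeDimension 1 π]
    {ℓ : Type u} [Field ℓ] [Algebra k ℓ] [Algebra.IsAlgebraic k ℓ] (p : Points π ℓ) :
    IsDiscreteValuationRing (C.presheaf.stalk p.pt) := by
  obtain ⟨V, hV, hy, g, hg, het⟩ := exists_etale_sectionsHom π p.pt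
  have : Nonempty V := ⟨⟨p.pt, hy⟩⟩
  have hp := (p.liesIn_iff V).mpr hy
  let : Algebra (MvPolynomial (Fin 1) k) Γ(C, V) := g.toAlgebra
  have : Algebra.Etale (MvPolynomial (Fin 1) k) Γ(C, V) := het
  let : Algebra Γ(C, V) (C.presheaf.stalk p.pt) := (C.presheaf.germ V p.pt hy).hom.toAlgebra
  let q := (hV.primeIdealOf ⟨p.pt, hy⟩).asIdeal
  have : IsLocalization.AtPrime (C.presheaf.stalk p.pt) q := hV.isLocalization_stalk ⟨p.pt, hy⟩
  let r : MvPolynomial (Fin 1) k →ₐ[k] ℓ := { (p.evalHom V hp).comp g with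
    commutes' := fun x => by
      have := RingHom.congr_fun hg x
      exact (congrArg (p.evalHom V hp) this).trans (p.evalHom_sectionsHom V hp x) }
  obtain ⟨f, hf, hfr⟩ := Algebra.IsAlgebraic.isAlgebraic (R := k) (r (MvPolynomial.X 0))
  have hf0 : Polynomial.aeval (MvPolynomial.X 0 : MvPolynomial (Fin 1) k) f ≠ 0 := fun h =>
    hf (transcendental_iff.mp (MvPolynomial.transcendental_X k 0) f h)
  rw [Polynomial.aeval_algHom_apply] at hfr
  have hq : algebraMap _ Γ(C, V) (Polynomial.aeval (MvPolynomial.X 0 : MvPolynomial (Fin 1) k) f) ∈ q := by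
    rw [← IsLocalization.AtPrime.to_map_mem_maximal_iff (C.presheaf.stalk p.pt) q,
      ← IsLocalRing.residue_eq_zero_iff]
    have h1 : p.evalHom V hp (g (Polynomial.aeval (MvPolynomial.X 0) f)) = 0 := hfr
    rw [p.evalHom_eq_residueHom V hp hy, map_eq_zero] at h1
    exact h1
  have := isDiscreteValuationRing_localization_of_etale q hf0 hq
  exact IsDiscreteValuationRing.RingEquivClass.isDiscreteValuationRing
    (IsLocalization.algEquiv q.primeCompl (Localization.AtPrime q) (C.presheaf.stalk p.pt))

end

end

section

/-! ### Power series in two variables -/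

section PowerSeries

open PowerSeries

instance (k : Type*) [Field k] :
    IsAdicComplete (IsLocalRing.maximalIdeal (PowerSeries k)) (PowerSeries k) where
  prec' := fun f hf => by
    have key : ∀ n (x y : PowerSeries k),
        x ≡ y [SMOD (IsLocalRing.maximalIdeal (PowerSeries k) ^ n • ⊤ : Ideal (PowerSeries k))] ↔
          ∀ m < n, coeff m x = coeff m y := fun n x y => by
      rw [SModEq.sub_mem, smul_eq_mul, Ideal.mul_top, maximalIdeal_eq_span_X,
        Ideal.span_singleton_pow, Ideal.mem_span_singleton, X_pow_dvd_iff]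
      simp only [map_sub, sub_eq_zero]
    refine ⟨PowerSeries.mk fun i => coeff i (f (i + 1)), fun n => (key _ _ _).mpr fun m hm => ?_⟩
    rw [coeff_mk]
    exact ((key _ _ _).mp (hf (Nat.succ_le_of_lt hm)) m (Nat.lt_succ_self m)).symm

/-- Removing the `ϖ`-content makes a series fit for Weierstrass division. -/
theorem exists_eq_C_pow_mul {A : Type*} [CommRing A] [IsDomain A] [IsDiscreteValuationRing A]
    {ϖ : A} (hϖ : Irreducible ϖ) {g : A⟦X⟧} (hg : g ≠ 0) :
    ∃ (m : ℕ) (g₀ : A⟦X⟧), g = C ϖ ^ m * g₀ ∧ g₀.map (IsLocalRing.residue A) ≠ 0 := by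
  have hu : ¬ IsUnit (C ϖ : A⟦X⟧) := fun h => hϖ.not_isUnit (by
    simpa using h.map (constantCoeff (R := A)))
  obtain ⟨g₀, h₁, h₂⟩ := (FiniteMultiplicity.of_not_isUnit hu hg).exists_eq_pow_mul_and_not_dvd
  refine ⟨_, g₀, h₁, fun h => h₂ ?_⟩
  have h3 : ∀ i, ϖ ∣ coeff i g₀ := fun i => by
    have := congrArg (coeff i) h
    rw [coeff_map, map_zero, IsLocalRing.residue_eq_zero_iff, hϖ.maximalIdeal_eq,
      Ideal.mem_span_singleton] at this
    exact this
  choose c hc using h3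
  exact ⟨PowerSeries.mk c, by ext i; rw [coeff_C_mul, coeff_mk, ← hc]⟩

/-- Choose `f` in `P` whose reduction has the least order `n`, and divide by it. A nonzero remainder
in `P`, freed from its `ϖ`-content, would stay in `P` because `ϖ ∉ P`, and its reduction would have
order below `n`. So `f` generates `P`, and the remainders bound the quotient over `A`. -/
theorem exists_eq_span_singleton_of_isPrime {A : Type*} [CommRing A] [IsDomain A]
    [IsDiscreteValuationRing A] [IsAdicComplete (IsLocalRing.maximalIdeal A) A]
    {ϖ : A} (hϖ : Irreducible ϖ) (P : Ideal A⟦X⟧) [P.IsPrime] (hP : P ≠ ⊥) (hϖP : C ϖ ∉ P) :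
    ∃ f, P = Ideal.span {f} ∧ ∃ d : ℕ, ∀ g : A⟦X⟧, ∃ r : Polynomial A, r.degree < d ∧
      g - r ∈ P := by
  have hmem : ∀ {m : ℕ} {g : A⟦X⟧}, C ϖ ^ m * g ∈ P → g ∈ P := fun h =>
    (Ideal.IsPrime.mem_or_mem ‹_› h).resolve_left fun h => hϖP (Ideal.IsPrime.mem_of_pow_mem ‹_› _ h)
  let S : Set ℕ := {n | ∃ f ∈ P, f.map (IsLocalRing.residue A) ≠ 0 ∧
    (f.map (IsLocalRing.residue A)).order.toNat = n}
  have hS : S.Nonempty := by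
    obtain ⟨g, hgP, hg⟩ := Submodule.exists_mem_ne_zero_of_ne_bot hP
    obtain ⟨m, g₀, rfl, hg₀⟩ := exists_eq_C_pow_mul hϖ hg
    exact ⟨_, g₀, hmem hgP, hg₀, rfl⟩
  obtain ⟨f, hfP, hf, hfn⟩ := WellFounded.min_mem Nat.lt_wfRel.wf S hS
  have hmin : ∀ n ∈ S, ¬ n < WellFounded.min Nat.lt_wfRel.wf S hS := fun n hn =>
    WellFounded.not_lt_min Nat.lt_wfRel.wf S hn
  set n := WellFounded.min Nat.lt_wfRel.wf S hS
  have hdiv : ∀ g : A⟦X⟧, ∃ (q : A⟦X⟧) (r : Polynomial A), r.degree < n ∧ g = f * q + r := fun g => by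
    obtain ⟨q, r, h⟩ := exists_isWeierstrassDivision g hf
    exact ⟨q, r, hfn ▸ h.degree_lt, h.eq_mul_add⟩
  refine ⟨f, le_antisymm (fun g hg => ?_) ((Ideal.span_singleton_le_iff_mem _).mpr hfP), n,
    fun g => ?_⟩
  · obtain ⟨q, r, hr, rfl⟩ := hdiv g
    have hrP : (r : A⟦X⟧) ∈ P := (Submodule.add_mem_iff_right P (Ideal.mul_mem_right _ _ hfP)).mp hg
    by_cases hr0 : (r : A⟦X⟧) = 0
    · rw [hr0, add_zero]
      exact Ideal.mul_mem_right _ _ (Ideal.mem_span_singleton_self f)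
    exfalso
    obtain ⟨m, r₀, hr₀, hne⟩ := exists_eq_C_pow_mul hϖ hr0
    refine hmin _ ⟨r₀, hmem (hr₀ ▸ hrP), hne, rfl⟩ ?_
    obtain ⟨i, hi⟩ : ∃ i, coeff i (r₀.map (IsLocalRing.residue A)) ≠ 0 := by
      by_contra! h
      exact hne (PowerSeries.ext h)
    have hin : i < n := by
      by_contra! hni
      have h1 : coeff i (r : A⟦X⟧) = 0 := by
        rw [Polynomial.coeff_coe]
        exact Polynomial.coeff_eq_zero_of_degree_lt (hr.trans_le (by exact_mod_cast hni))
      rw [hr₀, ← map_pow, coeff_C_mul, mul_eq_zero] at h1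
      refine hi ?_
      rw [coeff_map, h1.resolve_left (pow_ne_zero _ hϖ.ne_zero), map_zero]
    refine lt_of_le_of_lt ?_ hin
    have h2 := order_le i hi
    exact ENat.toNat_le_of_le_natCast h2
  · obtain ⟨q, r, hr, rfl⟩ := hdiv g
    refine ⟨r, hr, ?_⟩
    rw [add_sub_cancel_right]
    exact Ideal.mul_mem_right _ _ hfP

end PowerSeries

section PowerSeriesXY

variable (k₀ : Type u) [Field k₀]

/-- The indices of the variables `x`, `y`, where `y` is listed as the additional variable. -/
def finTwoEquivOption : Fin 2 ≃ Option Unit where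
  toFun i := if i = 0 then some () else none
  invFun o := o.elim 1 fun _ => 0
  left_inv i := by fin_cases i <;> rfl
  right_inv o := by rcases o with _ | _ <;> rfl

/-- The identification of `k₀[[x, y]]` with `k₀[[x]][[y]]`. -/
def powerSeriesXYEquiv : PowerSeriesXY k₀ ≃ₐ[k₀] PowerSeries (PowerSeries k₀) :=
  (MvPowerSeries.renameEquiv k₀ finTwoEquivOption).trans (MvPowerSeries.optionEquivLeft Unit k₀)

theorem powerSeriesXYEquiv_X_one : powerSeriesXYEquiv k₀ (MvPowerSeries.X 1) = PowerSeries.X := by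
  have : MvPowerSeries.renameEquiv k₀ finTwoEquivOption (MvPowerSeries.X 1) =
    MvPowerSeries.X none := MvPowerSeries.rename_X (f := finTwoEquivOption) (1 : Fin 2)
  rw [powerSeriesXYEquiv, AlgEquiv.trans_apply, this, MvPowerSeries.optionEquivLeft_X_none]

theorem powerSeriesXYEquiv_toMvPowerSeries (c : PowerSeries k₀) :
    powerSeriesXYEquiv k₀ (c.toMvPowerSeries 0) = PowerSeries.C c := by
  have : MvPowerSeries.renameEquiv k₀ finTwoEquivOption (c.toMvPowerSeries 0) =
      MvPowerSeries.rename (Function.Embedding.some : Unit ↪ Option Unit) c :=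
    MvPowerSeries.rename_rename _ _ _
  rw [powerSeriesXYEquiv, AlgEquiv.trans_apply, this]
  ext n : 1
  refine MvPowerSeries.ext fun x => ?_
  rw [MvPowerSeries.coeff_coeff_optionEquivLeft, PowerSeries.coeff_C]
  split_ifs with h
  · subst h
    rw [← MvPowerSeries.coeff_embDomain_rename Function.Embedding.some c x]
    congr 2
    ext i
    rcases i with _ | i
    · simp
    · simp
  · rw [MvPowerSeries.coeff_rename_eq_zero, map_zero]
    rintro ⟨y, hy⟩
    refine h ?_
    have := DFunLike.congr_fun hy none
    rw [Finsupp.optionElim_apply_none, Finsupp.mapDomain_of_notMem_range] at this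
    · exact this.symm
    · rintro ⟨_, h⟩
      exact Option.some_ne_none _ h

theorem powerSeriesXYEquiv_X_zero :
    powerSeriesXYEquiv k₀ (MvPowerSeries.X 0) = PowerSeries.C PowerSeries.X := by
  rw [← PowerSeries.toMvPowerSeries_X, powerSeriesXYEquiv_toMvPowerSeries]

/-- Weierstrass division with k₀[[x]] as coefficient ring and `x` as uniformizer. The generator
leads to discreteness of the local rings, the finite spanning set to finiteness of the residue
fields. -/
theorem exists_eq_span_singleton_of_X_notMem (P : Ideal (PowerSeriesXY k₀)) [P.IsPrime]
    (hP : P ≠ ⊥) (hx : MvPowerSeries.X 0 ∉ P) :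
    ∃ f, P = Ideal.span {f} ∧ ∃ d : ℕ, ∀ g : PowerSeriesXY k₀, ∃ c : Fin d → PowerSeries k₀,
      g - ∑ i, (c i).toMvPowerSeries 0 * MvPowerSeries.X 1 ^ (i : ℕ) ∈ P := by
  let Φ := powerSeriesXYEquiv k₀
  let P' := P.comap (Φ.symm : PowerSeries (PowerSeries k₀) →+* PowerSeriesXY k₀)
  have hP' : ∀ g, g ∈ P ↔ Φ g ∈ P' := fun g => by
    change g ∈ P ↔ Φ.symm (Φ g) ∈ P
    rw [AlgEquiv.symm_apply_apply]
  have hne : P' ≠ ⊥ := by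
    obtain ⟨g, hgP, hg⟩ := Submodule.exists_mem_ne_zero_of_ne_bot hP
    exact fun h => hg (Φ.injective (by rwa [map_zero, ← Ideal.mem_bot, ← h, ← hP']))
  obtain ⟨f, hf, d, hd⟩ := exists_eq_span_singleton_of_isPrime
    (PowerSeries.X_prime (R := k₀)).irreducible P' hne
      (by rwa [← powerSeriesXYEquiv_X_zero, ← hP'])
  refine ⟨Φ.symm f, ?_, d, fun g => ?_⟩
  · ext g
    rw [hP', hf, Ideal.mem_span_singleton, Ideal.mem_span_singleton, ← map_dvd_iff Φ,
      AlgEquiv.apply_symm_apply]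
  · obtain ⟨r, hr, h⟩ := hd (Φ g)
    refine ⟨fun i => r.coeff i, ?_⟩
    rw [hP', map_sub, map_sum]
    convert h using 2
    have h1 : r = ∑ i : Fin d, Polynomial.C (r.coeff i) * Polynomial.X ^ (i : ℕ) := by
      rcases eq_or_ne r 0 with rfl | h0
      · simp
      · rw [← Finset.sum_range fun i => Polynomial.C (r.coeff i) * Polynomial.X ^ i]
        exact r.as_sum_range_C_mul_X_pow' ((Polynomial.natDegree_lt_iff_degree_lt h0).mpr hr)
    have h2 := congrArg (Polynomial.coeToPowerSeries.ringHom (R := PowerSeries k₀)) h1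
    rw [map_sum] at h2
    refine Eq.trans (Finset.sum_congr rfl fun i _ => ?_) h2.symm
    rw [map_mul, map_pow, powerSeriesXYEquiv_toMvPowerSeries, powerSeriesXYEquiv_X_one, map_mul,
      map_pow]
    simp

end PowerSeriesXY

section Laurent

variable (k₀ : Type u) [Field k₀]

open scoped WithZero in
instance : HenselianLocalRing
    (Valued.v : Valuation (LaurentSeries k₀) ℤᵐ⁰).valuationSubring := by
  have hX : (HahnSeries.single (1 : ℤ) (1 : k₀) : LaurentSeries k₀) ≠ 0 := by simp
  have hX1 : (Valued.v (HahnSeries.single (1 : ℤ) (1 : k₀) : LaurentSeries k₀) : ℤᵐ⁰) < 1 := by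
    rw [LaurentSeries.valuation_single_zpow, ← WithZero.exp_zero, WithZero.exp_lt_exp]
    simp
  have hval : ∀ x : LaurentSeries k₀, x ≠ 0 → ∃ n : ℤ, (Valued.v x : ℤᵐ⁰) =
      Valued.v (HahnSeries.single (1 : ℤ) (1 : k₀) : LaurentSeries k₀) ^ n := fun x hx => by
    refine ⟨-WithZero.log (Valued.v x : ℤᵐ⁰), ?_⟩
    rw [LaurentSeries.valuation_single_zpow, ← WithZero.exp_zsmul, smul_neg, smul_eq_mul]
    have h0 : (Valued.v x : ℤᵐ⁰) ≠ 0 := (Valuation.ne_zero_iff _).mpr hx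
    simp [WithZero.exp_log h0]
  have := isAdicComplete_valuedRing (E := LaurentSeries k₀) (Γ := ℤᵐ⁰) hX hX1 hval
  exact henselianLocalRing_of_isAdicComplete _

end Laurent

end

section

/-! ### Discrete valuation rings in finite extensions -/

/-- A linear relation among 1, x, …, x^n with n = [K : F] must have two terms of the same maximal
value, and their quotient is the desired power. -/
theorem exists_pow_valuation_eq {F K : Type*} {Γ : Type*} [Field F] [Field K] [Algebra F K]
    [FiniteDimensional F K] [LinearOrderedCommGroupWithZero Γ] (v : Valuation K Γ) {x : K}
    (hx : x ≠ 0) : ∃ m, 0 < m ∧ m ≤ Module.finrank F K ∧ ∃ a : F, a ≠ 0 ∧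
      v x ^ m = v (algebraMap F K a) := by
  classical
  have hdep : ¬ LinearIndependent F fun i : Fin (Module.finrank F K + 1) => x ^ (i : ℕ) := fun h => by
    have := h.fintype_card_le_finrank
    simp at this
  obtain ⟨g, hg, i₁, hi₁⟩ := Fintype.not_linearIndependent_iff.mp hdep
  let T : Finset (Fin (Module.finrank F K + 1)) := Finset.univ.filter fun i => g i ≠ 0
  have hT : ∀ i, i ∈ T ↔ g i ≠ 0 := fun i => by simp [T]
  have hne : ∀ i ∈ T, v (g i • x ^ (i : ℕ)) ≠ 0 := fun i hi => by
    rw [Valuation.ne_zero_iff]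
    exact smul_ne_zero ((hT i).mp hi) (pow_ne_zero _ hx)
  obtain ⟨i, hi, hmax⟩ := T.exists_max_image (fun i => v (g i • x ^ (i : ℕ))) ⟨i₁, (hT _).mpr hi₁⟩
  have hsum : ∑ j ∈ T, g j • x ^ (j : ℕ) = 0 := by
    rw [← hg]
    refine Finset.sum_filter_of_ne fun j _ hj h => hj (by rw [h, zero_smul])
  obtain ⟨j, hj, hji, hij⟩ : ∃ j ∈ T, j ≠ i ∧ v (g j • x ^ (j : ℕ)) = v (g i • x ^ (i : ℕ)) := by
    by_contra! h
    rw [← Finset.add_sum_erase _ _ hi, add_eq_zero_iff_eq_neg] at hsum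
    have h1 : v (∑ j ∈ T.erase i, g j • x ^ (j : ℕ)) < v (g i • x ^ (i : ℕ)) :=
      Valuation.map_sum_lt v (hne i hi) fun j hj =>
        lt_of_le_of_ne (hmax j (Finset.mem_of_mem_erase hj))
          (h j (Finset.mem_of_mem_erase hj) (Finset.ne_of_mem_erase hj))
    rw [hsum, Valuation.map_neg] at h1
    exact lt_irrefl _ h1
  have key : ∀ i j : Fin (Module.finrank F K + 1), g i ≠ 0 → g j ≠ 0 → i < j →
      v (g j • x ^ (j : ℕ)) = v (g i • x ^ (i : ℕ)) → ∃ m, 0 < m ∧ m ≤ Module.finrank F K ∧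
      ∃ a : F, a ≠ 0 ∧ v x ^ m = v (algebraMap F K a) := by
    intro i j hi hj hij h
    refine ⟨j - i, Nat.sub_pos_of_lt hij, by omega, g i / g j, div_ne_zero hi hj, ?_⟩
    have hj' : v (algebraMap F K (g j)) ≠ 0 := by
      rwa [Valuation.ne_zero_iff, map_ne_zero]
    have hx' : v x ^ (i : ℕ) ≠ 0 := pow_ne_zero _ ((Valuation.ne_zero_iff v).mpr hx)
    rw [Algebra.smul_def, Algebra.smul_def, map_mul, map_mul, map_pow, map_pow,
      ← Nat.sub_add_cancel hij.le, pow_add, ← mul_assoc] at h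
    rw [map_div₀, map_div₀, eq_div_iff hj', mul_comm]
    exact mul_right_cancel₀ hx' h
  rcases lt_or_gt_of_ne hji with h | h
  · exact key j i ((hT j).mp hj) ((hT i).mp hi) h hij.symm
  · exact key i j ((hT i).mp hi) ((hT j).mp hj) h hij

/-- With N = [K : F]!, all N-th powers of values are powers of `q`. An element with the least
positive exponent is a uniformizer, by division with remainder and torsion-freeness of the value
group. -/
theorem isDiscreteValuationRing_of_finiteDimensional {F K : Type*} [Field F] [Field K] [Algebra F K]
    [FiniteDimensional F K] (W : ValuationSubring K) {π : F} (hπ : π ≠ 0)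
    (hπ1 : W.valuation (algebraMap F K π) < 1) (hval : ∀ z : F, z ≠ 0 → ∃ n : ℤ,
      W.valuation (algebraMap F K z) = W.valuation (algebraMap F K π) ^ n) :
    IsDiscreteValuationRing W := by
  set N := (Module.finrank F K).factorial with hN
  have hN0 : N ≠ 0 := Nat.factorial_ne_zero _
  set q := W.valuation (algebraMap F K π) with hq
  have hq0 : 0 < q := zero_lt_iff.mpr (by rwa [hq, Valuation.ne_zero_iff, map_ne_zero])
  have hpow : ∀ x : K, x ≠ 0 → ∃ e : ℤ, W.valuation x ^ N = q ^ e := fun x hx => by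
    obtain ⟨m, hm, hmn, a, ha, h⟩ := exists_pow_valuation_eq (F := F) W.valuation hx
    obtain ⟨n, hn⟩ := hval a ha
    obtain ⟨l, hl⟩ := Nat.dvd_factorial hm hmn
    refine ⟨n * l, ?_⟩
    rw [hN, hl, pow_mul, h, hn, zpow_mul, zpow_natCast]
  let S : Set ℕ := {e | 0 < e ∧ ∃ x : K, x ≠ 0 ∧ W.valuation x ^ N = q ^ e}
  have hS : S.Nonempty := ⟨N, Nat.pos_of_ne_zero hN0, algebraMap F K π, (map_ne_zero _).mpr hπ, rfl⟩
  obtain ⟨he, x₀, hx₀, hv⟩ := WellFounded.min_mem Nat.lt_wfRel.wf S hS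
  have hmin : ∀ n ∈ S, ¬ n < WellFounded.min Nat.lt_wfRel.wf S hS := fun n hn =>
    WellFounded.not_lt_min Nat.lt_wfRel.wf S hn
  set e := WellFounded.min Nat.lt_wfRel.wf S hS
  let : Valued K W.ValueGroup := Valued.mk' W.valuation
  have hvv : ∀ x : K, (Valued.v x : W.ValueGroup) = W.valuation x := fun _ => rfl
  have hx₀1 : (Valued.v x₀ : W.ValueGroup) < 1 := by
    rw [hvv]
    refine lt_of_not_ge fun h => ?_
    have h1 := one_le_pow_of_one_le' h N
    rw [hv] at h1
    exact absurd (pow_lt_one' hπ1 he.ne') (not_lt.mpr h1)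
  have := isDiscreteValuationRing_valuedRing (Γ := W.ValueGroup) hx₀ hx₀1 fun x hx => by
    obtain ⟨a, ha⟩ := hpow x hx
    have he' : (e : ℤ) ≠ 0 := by exact_mod_cast he.ne'
    refine ⟨a / e, ?_⟩
    rw [hvv, hvv]
    have hx₀' : W.valuation x₀ ≠ 0 := (Valuation.ne_zero_iff _).mpr hx₀
    obtain ⟨r, hr⟩ := Int.eq_ofNat_of_zero_le (Int.emod_nonneg a he')
    have hy : W.valuation (x / x₀ ^ (a / (e : ℤ))) ^ N = q ^ r := by
      rw [map_div₀, map_zpow₀, div_pow, ha, ← zpow_natCast, ← zpow_natCast, ← zpow_mul, mul_comm,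
        zpow_mul, zpow_natCast, hv, ← zpow_natCast q e, ← zpow_mul, ← zpow_sub₀ hq0.ne', ← hr]
      congr 1
      have := Int.emod_add_mul_ediv a e
      linarith
    have hr0 : r = 0 := by
      by_contra h0
      refine hmin r ⟨Nat.pos_of_ne_zero h0, _, div_ne_zero hx (zpow_ne_zero _ hx₀), hy⟩ ?_
      have := Int.emod_lt_of_pos a (by exact_mod_cast he : (0 : ℤ) < e)
      rw [hr] at this
      exact_mod_cast this
    rw [hr0, pow_zero, pow_eq_one_iff_left hN0, map_div₀, map_zpow₀,
      div_eq_one_iff_eq (zpow_ne_zero _ hx₀')] at hy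
    exact hy
  have h2 : valuedRing K W.ValueGroup = W := W.valuationSubring_valuation
  exact h2 ▸ this

/-- Lifts of linearly independent residues are independent over `F`: divide a relation by a
coefficient of largest value and reduce; the coefficients then reduce into `κ₀`, and one of them to
1. -/
theorem finiteDimensional_of_residue {F K κ κ₀ : Type*} [Field F] [Field K] [Algebra F K]
    [FiniteDimensional F K] [Field κ] [Field κ₀] [Algebra κ₀ κ] (W : ValuationSubring K)
    (r : W →+* κ) (hr : Function.Surjective r)
    (h : ∀ z (hz : algebraMap F K z ∈ W), ∃ c, algebraMap κ₀ κ c = r ⟨_, hz⟩) :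
    FiniteDimensional κ₀ κ := by
  let B := Module.Basis.ofVectorSpace κ₀ κ
  choose b hb using fun i => hr (B i)
  have hli : LinearIndependent F fun i => (b i : K) := by
    rw [linearIndependent_iff']
    intro s g hg
    by_contra! hne
    obtain ⟨i₁, hi₁, hgi₁⟩ := hne
    obtain ⟨i, hi, hmax⟩ := s.exists_max_image (fun i => W.valuation (algebraMap F K (g i)))
      ⟨i₁, hi₁⟩
    have hi0 : algebraMap F K (g i) ≠ 0 := fun h0 => by
      have := hmax i₁ hi₁
      rw [h0, map_zero, le_zero_iff, Valuation.zero_iff, map_eq_zero] at this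
      exact hgi₁ this
    have hW : ∀ j ∈ s, algebraMap F K (g j / g i) ∈ W := fun j hj => by
      rw [← W.valuation_le_one_iff, map_div₀, map_div₀]
      exact div_le_one_of_le₀ (hmax j hj) zero_le
    choose! c hc using fun j (hj : j ∈ s) => h _ (hW j hj)
    have h1 : ∑ j ∈ s.attach, (⟨_, hW j j.2⟩ : W) * b j = 0 := by
      refine Subtype.ext ?_
      have h2 : ∀ j : s, algebraMap F K (g j / g i) * (b j : K) =
          (algebraMap F K (g i))⁻¹ * (g j • (b j : K)) := fun j => by
        rw [Algebra.smul_def, map_div₀, div_eq_mul_inv]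
        ring
      refine (AddSubmonoidClass.coe_finsetSum _ _).trans ?_
      rw [ZeroMemClass.coe_zero, ← mul_zero (algebraMap F K (g i))⁻¹, ← hg,
        ← Finset.sum_attach s fun j => g j • (b j : K), Finset.mul_sum]
      exact Finset.sum_congr rfl fun j _ => h2 j
    have h2 := congrArg r h1
    rw [map_sum, map_zero] at h2
    have h3 : ∑ j ∈ s, c j • B j = 0 := by
      rw [← h2, ← Finset.sum_attach]
      refine Finset.sum_congr rfl fun j _ => ?_
      rw [map_mul, hb, ← hc j j.2, Algebra.smul_def]
    have h4 := linearIndependent_iff'.mp B.linearIndependent s c h3 i hi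
    have h5 := hc i hi
    have h6 : (⟨_, hW i hi⟩ : W) = 1 := Subtype.ext (by
      change algebraMap F K (g i / g i) = 1
      rw [div_self fun h0 => hi0 (by rw [h0, map_zero]), map_one])
    rw [h4, map_zero, h6, map_one] at h5
    exact zero_ne_one h5
  have := hli.finite
  exact Module.Finite.of_basis B


/-- Let `W` dominate the local ring `S`. As the prime of `R` below is generated by `f`, every value
on `F` is a power of that of `f`; this gives both the discreteness of `W` and that `W ∩ F` is the
localization of `R` at `(f)`. An element of `W` is a quotient of elements integral over `W ∩ F` with
unit denominator; clearing denominators from `R` puts numerator and denominator in `S`, so `W` is no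
larger than `S`. -/
theorem exists_valuationSubring_eq_range {R F K S : Type*} [CommRing R] [IsDomain R]
    [IsNoetherianRing R] [Field F] [Algebra R F] [IsFractionRing R F] [Field K] [Algebra F K]
    [Algebra R K] [IsScalarTower R F K] [FiniteDimensional F K] [CommRing S] [IsLocalRing S]
    [Algebra R S] (g : S →+* K) (hginj : Function.Injective g)
    (hg : ∀ x : R, g (algebraMap R S x) = algebraMap R K x)
    (hint : ∀ z : K, IsIntegral R z → z ∈ g.range) {f : R} (hf0 : f ≠ 0)
    (hf : ∀ x, algebraMap R S x ∈ IsLocalRing.maximalIdeal S ↔ f ∣ x) :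
    ∃ W : ValuationSubring K, IsDiscreteValuationRing W ∧ (∀ x, x ∈ W ↔ x ∈ g.range) ∧
      ∀ z : F, algebraMap F K z ∈ W →
        ∃ a b : R, ¬ f ∣ b ∧ z = algebraMap R F a / algebraMap R F b := by
  obtain ⟨W, hWr, hWl⟩ := (LocalSubring.range g).exists_le_valuationSubring
  have hgW : ∀ s, g s ∈ W := fun s => hWr ⟨s, rfl⟩
  have hunit : ∀ s, W.valuation (g s) = 1 ↔ IsUnit s := by
    intro s
    have h1 := W.valuation_eq_one_iff ⟨g s, hgW s⟩
    rw [← h1]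
    refine ⟨fun h => ?_, fun h => h.map (g.codRestrict W.toSubring hgW)⟩
    have h2 : IsUnit (⟨g s, ⟨s, rfl⟩⟩ : (LocalSubring.range g).toSubring) := hWl.map_nonunit _ h
    obtain ⟨⟨_, s', rfl⟩, hs'⟩ := isUnit_iff_exists_inv.mp h2
    refine isUnit_iff_exists_inv.mpr ⟨s', hginj ?_⟩
    rw [map_mul, map_one]
    exact congrArg Subtype.val hs'
  have hR : ∀ x : R, W.valuation (algebraMap R K x) = 1 ↔ ¬ f ∣ x := fun x => by
    rw [← hg, hunit, ← hf, IsLocalRing.mem_maximalIdeal, mem_nonunits_iff, not_not]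
  have hR1 : ∀ x : R, W.valuation (algebraMap R K x) ≤ 1 := fun x => by
    rw [← hg, W.valuation_le_one_iff]
    exact hgW _
  set q := W.valuation (algebraMap R K f) with hq
  have hinj : Function.Injective (algebraMap R K) := by
    rw [IsScalarTower.algebraMap_eq R F K]
    exact (algebraMap F K).injective.comp (IsFractionRing.injective R F)
  have hq1 : q < 1 := lt_of_le_of_ne (hR1 f) fun h => (hR f).mp h dvd_rfl
  have hq0 : 0 < q := zero_lt_iff.mpr (by
    rwa [hq, Valuation.ne_zero_iff, ne_eq, map_eq_zero_iff _ hinj])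
  have hfu : ¬ IsUnit f := fun h => (hf 1).mpr h.dvd (by simp)
  have hdec : ∀ x : R, x ≠ 0 → ∃ (n : ℕ) (u : R), x = f ^ n * u ∧ ¬ f ∣ u := fun x hx =>
    ⟨_, (FiniteMultiplicity.of_not_isUnit hfu hx).exists_eq_pow_mul_and_not_dvd⟩
  have hv : ∀ (n : ℕ) (u : R), ¬ f ∣ u → W.valuation (algebraMap R K (f ^ n * u)) = q ^ n :=
    fun n u hu => by rw [map_mul, map_pow, map_mul, map_pow, (hR u).mpr hu, mul_one]
  have hFK : ∀ x : R, algebraMap F K (algebraMap R F x) = algebraMap R K x := fun x =>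
    (IsScalarTower.algebraMap_apply R F K x).symm
  have hO : ∀ z : F, algebraMap F K z ∈ W →
      ∃ a b : R, ¬ f ∣ b ∧ z = algebraMap R F a / algebraMap R F b := by
    intro z hz
    rcases eq_or_ne z 0 with rfl | hz0
    · exact ⟨0, 1, fun h => hfu (isUnit_of_dvd_one h), by simp⟩
    obtain ⟨a, b, hb, rfl⟩ := IsFractionRing.div_surjective R z
    have hb0 : b ≠ 0 := nonZeroDivisors.ne_zero hb
    have ha0 : a ≠ 0 := fun h => hz0 (by simp [h])
    obtain ⟨n, u, rfl, hu⟩ := hdec a ha0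
    obtain ⟨m, w, rfl, hw⟩ := hdec b hb0
    rw [← W.valuation_le_one_iff, map_div₀, map_div₀, hFK, hFK, hv n u hu, hv m w hw,
      div_le_one₀ (pow_pos hq0 m), pow_le_pow_iff_right_of_lt_one₀ hq0 hq1] at hz
    refine ⟨f ^ (n - m) * u, w, hw, ?_⟩
    have hf0' : algebraMap R F f ≠ 0 := by
      rwa [ne_eq, map_eq_zero_iff _ (IsFractionRing.injective R F)]
    have h1 : f ^ n * u = f ^ (n - m) * u * f ^ m := by
      rw [mul_right_comm, ← pow_add, Nat.sub_add_cancel hz]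
    rw [h1, mul_comm (f ^ m) w, map_mul (algebraMap R F) (f ^ (n - m) * u),
      map_mul (algebraMap R F) w, mul_div_mul_right _ _ (by rw [map_pow]; exact pow_ne_zero _ hf0')]
  refine ⟨W, ?_, fun y => ⟨fun hy => ?_, ?_⟩, hO⟩
  · refine isDiscreteValuationRing_of_finiteDimensional (F := F) W (π := algebraMap R F f)
      (by rwa [ne_eq, map_eq_zero_iff _ (IsFractionRing.injective R F)]) (by rwa [hFK])
      fun z hz => ?_
    obtain ⟨a, b, hb, rfl⟩ := IsFractionRing.div_surjective R z
    have hb0 : b ≠ 0 := nonZeroDivisors.ne_zero hb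
    have ha0 : a ≠ 0 := fun h => hz (by simp [h])
    obtain ⟨n, u, rfl, hu⟩ := hdec a ha0
    obtain ⟨m, w, rfl, hw⟩ := hdec b hb0
    refine ⟨n - m, ?_⟩
    rw [map_div₀, map_div₀, hFK, hFK, hv n u hu, hv m w hw, hFK, zpow_sub₀ hq0.ne', zpow_natCast,
      zpow_natCast]
  · let O := W.comap (algebraMap F K)
    let P := (IsLocalRing.maximalIdeal S).comap (algebraMap R S)
    have hRO : ∀ x : R, algebraMap R F x ∈ O := fun x => by
      rw [ValuationSubring.mem_comap, hFK, ← hg]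
      exact hgW _
    let : Algebra R O := ((algebraMap R F).codRestrict O.toSubring hRO).toAlgebra
    have hROF : ∀ x : R, (algebraMap R O x : F) = algebraMap R F x := fun _ => rfl
    have : IsScalarTower R O K := .of_algebraMap_eq fun x => (hFK x).symm
    have hP : ∀ x : R, x ∈ P.primeCompl ↔ ¬ f ∣ x := fun x => not_congr (hf x)
    have hu : ∀ x : R, ¬ f ∣ x → IsUnit (algebraMap R O x) := fun x hx => by
      have h1 := (hR x).mpr hx
      rw [← hFK, valuation_eq_one_iff_of_comap_eq (V := O) (algebraMap F K) rfl] at h1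
      exact (O.valuation_eq_one_iff _).mpr h1
    have : IsLocalization P.primeCompl O := by
      refine ⟨fun x => hu x ((hP x).mp x.2), fun z => ?_, fun {x y} h => ?_⟩
      · obtain ⟨a, b, hb, hz⟩ := hO z z.2
        have hb0 : algebraMap R F b ≠ 0 := by
          rw [ne_eq, map_eq_zero_iff _ (IsFractionRing.injective R F)]
          rintro rfl
          exact hb (dvd_zero f)
        refine ⟨(a, ⟨b, (hP b).mpr hb⟩), Subtype.ext ?_⟩
        rw [MulMemClass.coe_mul, hz]
        exact div_mul_cancel₀ _ hb0
      · exact ⟨1, by rw [IsFractionRing.injective R F (congrArg Subtype.val h)]⟩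
    obtain ⟨b, c, hb, hc, hc1, hcy⟩ := exists_isIntegral_mul_eq O W (fun x hx => hx)
      (Algebra.IsAlgebraic.isAlgebraic (R := F) y) hy
    obtain ⟨s, hs⟩ := IsIntegral.exists_multiple_integral_of_isLocalization P.primeCompl b hb
    obtain ⟨t, ht⟩ := IsIntegral.exists_multiple_integral_of_isLocalization P.primeCompl c hc
    obtain ⟨b', hb'⟩ := hint _ hs
    obtain ⟨c', hc'⟩ := hint _ ht
    have hcu : IsUnit c' := by
      rw [← hunit, hc', Submonoid.smul_def, Algebra.smul_def, map_mul, hc1, mul_one]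
      exact (hR t).mpr ((hP t).mp t.2)
    have hsu : IsUnit (algebraMap R S s) := by
      rw [← hunit, hg]
      exact (hR s).mpr ((hP s).mp s.2)
    obtain ⟨u, hu'⟩ := isUnit_iff_exists_inv.mp (hsu.mul hcu)
    refine ⟨algebraMap R S t * b' * u, ?_⟩
    have h1 := congrArg g hu'
    rw [map_mul, map_mul, map_one, hg, hc', Submonoid.smul_def, Algebra.smul_def] at h1
    rw [map_mul, map_mul, hg, hb', Submonoid.smul_def, Algebra.smul_def, ← hcy]
    linear_combination y * h1
  · rintro ⟨s, rfl⟩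
    exact hgW s

end

section

/-! ### The Dedekind scheme of a finite extension of the field of Laurent series in `x, y` -/

section InvX

variable (k₀ : Type u) [Field k₀] (K : Type u) [Field K] [Algebra (PowerSeriesXY k₀) K]
  [Algebra (LaurentXY k₀) K] [IsScalarTower (PowerSeriesXY k₀) (LaurentXY k₀) K]

theorem algebraMap_powerSeriesXY_injective : Function.Injective (algebraMap (PowerSeriesXY k₀) K) := by
  rw [IsScalarTower.algebraMap_eq (PowerSeriesXY k₀) (LaurentXY k₀) K]
  exact (algebraMap (LaurentXY k₀) K).injective.comp
    (IsFractionRing.injective (PowerSeriesXY k₀) (LaurentXY k₀))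

variable [FiniteDimensional (LaurentXY k₀) K]

/-- The inclusion of `k₀[[x, y]]` in `A[x⁻¹]`. -/
def xyToInvX : PowerSeriesXY k₀ →+* InvX k₀ K :=
  (algebraMap (IntClosure k₀ K) (InvX k₀ K)).comp (algebraMap (PowerSeriesXY k₀) (IntClosure k₀ K))

theorem coe_xyToInvX (x : PowerSeriesXY k₀) :
    (xyToInvX k₀ K x : K) = algebraMap (PowerSeriesXY k₀) K x := rfl

theorem isUnit_xyToInvX_X_zero : IsUnit (xyToInvX k₀ K (MvPowerSeries.X 0)) :=
  IsLocalization.map_units (InvX k₀ K)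
    (⟨elemX k₀ K, Submonoid.mem_powers _⟩ : Submonoid.powers (elemX k₀ K))

theorem laurentToInvX_algebraMap (c : PowerSeries k₀) :
    laurentToInvX k₀ K (algebraMap (PowerSeries k₀) (LaurentSeries k₀) c) =
      xyToInvX k₀ K (c.toMvPowerSeries 0) :=
  IsLocalization.lift_eq _ _

theorem exists_mul_eq_of_invX (b : InvX k₀ K) : ∃ (n : ℕ) (a : IntClosure k₀ K),
    b * xyToInvX k₀ K (MvPowerSeries.X 0) ^ n = algebraMap (IntClosure k₀ K) (InvX k₀ K) a := by
  obtain ⟨⟨a, ⟨_, n, rfl⟩⟩, h⟩ := IsLocalization.surj (Submonoid.powers (elemX k₀ K)) b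
  exact ⟨n, a, by rw [← h, map_pow]; rfl⟩

theorem algebraMap_intClosure_invX_injective :
    Function.Injective (algebraMap (IntClosure k₀ K) (InvX k₀ K)) := fun _ _ h =>
  Subtype.ext (congrArg (Subtype.val : InvX k₀ K → K) h)

/-- Otherwise `y` would divide a power of `x` in `A`, but a prime of `A` above `(y)` contains `y`
and not `x`. This shows that A[x⁻¹] is not a field, and hence that neither closed points nor points
with algebraic residue field are generic. -/
theorem not_isUnit_xyToInvX_X_one : ¬ IsUnit (xyToInvX k₀ K (MvPowerSeries.X 1)) := by
  intro hu
  obtain ⟨b, hb⟩ := isUnit_iff_exists_inv.mp hu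
  obtain ⟨n, a, ha⟩ := exists_mul_eq_of_invX k₀ K b
  let Q : Ideal (PowerSeriesXY k₀) := RingHom.ker ((PowerSeries.constantCoeff (R := PowerSeries k₀)).comp
    (powerSeriesXYEquiv k₀ : PowerSeriesXY k₀ →+* PowerSeries (PowerSeries k₀)))
  have hQ : Q.IsPrime := RingHom.ker_isPrime _
  have hQ1 : MvPowerSeries.X 1 ∈ Q := by
    rw [RingHom.mem_ker, RingHom.comp_apply]
    exact (congrArg _ (powerSeriesXYEquiv_X_one k₀)).trans (by simp)
  have hQ0 : MvPowerSeries.X 0 ∉ Q := by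
    rw [RingHom.mem_ker, RingHom.comp_apply]
    exact fun h => PowerSeries.X_ne_zero ((congrArg _ (powerSeriesXYEquiv_X_zero k₀)).symm.trans h)
  obtain ⟨Q', -, hQ', hQQ⟩ := Ideal.exists_ideal_over_prime_of_isIntegral Q (⊥ : Ideal (IntClosure k₀ K))
    (by
      rw [Ideal.comap_bot_of_injective]
      · exact bot_le
      · exact fun _ _ h => algebraMap_powerSeriesXY_injective k₀ K (congrArg Subtype.val h))
  have h1 : algebraMap (PowerSeriesXY k₀) (IntClosure k₀ K) (MvPowerSeries.X 1) * a =
      algebraMap (PowerSeriesXY k₀) (IntClosure k₀ K) (MvPowerSeries.X 0) ^ n := by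
    apply algebraMap_intClosure_invX_injective k₀ K
    rw [map_mul, map_pow, ← ha, ← mul_assoc]
    change xyToInvX k₀ K (MvPowerSeries.X 1) * b * _ = _
    rw [hb, one_mul]
    rfl
  refine hQ0 ?_
  rw [← hQQ, Ideal.mem_comap]
  refine hQ'.mem_of_pow_mem n ?_
  rw [← h1]
  refine Ideal.mul_mem_right _ _ ?_
  rw [← Ideal.mem_comap, hQQ]
  exact hQ1

theorem comap_xyToInvX_ne_bot {q : Ideal (InvX k₀ K)} (hq : q ≠ ⊥) :
    q.comap (xyToInvX k₀ K) ≠ ⊥ := by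
  obtain ⟨b, hbq, hb⟩ := Submodule.exists_mem_ne_zero_of_ne_bot hq
  obtain ⟨n, a, ha⟩ := exists_mul_eq_of_invX k₀ K b
  have ha0 : a ≠ 0 := by
    rintro rfl
    rw [map_zero] at ha
    exact hb ((((isUnit_xyToInvX_X_zero k₀ K).pow n).mul_left_eq_zero).mp ha)
  have haq : a ∈ q.comap (algebraMap (IntClosure k₀ K) (InvX k₀ K)) := by
    rw [Ideal.mem_comap, ← ha]
    exact Ideal.mul_mem_right _ _ hbq
  rw [xyToInvX, ← Ideal.comap_comap]
  exact Ideal.comap_ne_bot_of_integral_mem ha0 haq (Algebra.IsIntegral.isIntegral a)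

theorem exists_comap_xyToInvX_eq_span {q : Ideal (InvX k₀ K)} [q.IsPrime] (hq : q ≠ ⊥) :
    ∃ f, f ≠ 0 ∧ q.comap (xyToInvX k₀ K) = Ideal.span {f} ∧ ∃ d : ℕ, ∀ g : PowerSeriesXY k₀,
      ∃ c : Fin d → PowerSeries k₀,
      g - ∑ i, (c i).toMvPowerSeries 0 * MvPowerSeries.X 1 ^ (i : ℕ) ∈ q.comap (xyToInvX k₀ K) := by
  have hne := comap_xyToInvX_ne_bot k₀ K hq
  obtain ⟨f, hf, h⟩ := exists_eq_span_singleton_of_X_notMem k₀ (q.comap (xyToInvX k₀ K)) hne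
    fun h => Ideal.IsPrime.ne_top ‹q.IsPrime›
      (Ideal.eq_top_of_isUnit_mem q h (isUnit_xyToInvX_X_zero k₀ K))
  refine ⟨f, ?_, hf, h⟩
  rintro rfl
  exact hne (by rw [hf, Ideal.span_singleton_eq_bot])

end InvX

/-! ### Stalks and rational points of affine schemes -/

section Affine

variable (R : CommRingCat.{u}) [IsDomain R] (K : Type u) [Field K] [Algebra R K] [IsFractionRing R K]

theorem stalkHom_affineFunctionField (x : Spec R) (b : R) :
    stalkHom (affineFunctionField R K) x (StructureSheaf.toStalk R x b) = algebraMap R K b := by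
  have h : algebraMap ((Spec R).presheaf.stalk x) (Spec R).functionField
      (StructureSheaf.toStalk R x b) = algebraMap R (Spec R).functionField b := by
    exact congr($(StructureSheaf.toStalk_stalkSpecializes (R := R)
      ((genericPoint_spec (Spec R)).specializes (y := x) trivial)) b)
  refine (congrArg (affineFunctionField R K) h).trans ?_
  exact (IsLocalization.algEquiv (nonZeroDivisors R) (Spec R).functionField K).commutes b

end Affine

theorem asIdeal_apply_closedPoint {R : CommRingCat.{u}} {ℓ : Type u} [Field ℓ]
    (q : Spec (.of ℓ) ⟶ Spec R) :
    PrimeSpectrum.asIdeal (show PrimeSpectrum R from q (IsLocalRing.closedPoint ℓ)) =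
      RingHom.ker (Spec.preimage q).hom := by
  obtain ⟨f, rfl⟩ := Spec.map_surjective q
  rw [Spec.preimage_map]
  ext b
  change f.hom b ∈ IsLocalRing.maximalIdeal ℓ ↔ _
  rw [IsLocalRing.maximalIdeal_eq_bot, Ideal.mem_bot, RingHom.mem_ker]

theorem comp_preimage_of_comp_map_eq {R S T : CommRingCat.{u}} (f : S ⟶ R) (q : Spec T ⟶ Spec R)
    {g : S ⟶ T} (h : q ≫ Spec.map f = Spec.map g) : f ≫ Spec.preimage q = g :=
  Spec.map_injective (by rw [Spec.map_comp, Spec.map_preimage, h])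

section DedekindScheme

variable (k₀ : Type u) [Field k₀] (K : Type u) [Field K] [Algebra (PowerSeriesXY k₀) K]
  [Algebra (LaurentXY k₀) K] [IsScalarTower (PowerSeriesXY k₀) (LaurentXY k₀) K]
  [FiniteDimensional (LaurentXY k₀) K]

/-- The prime ideal of `A[x⁻¹]` corresponding to a point of the Dedekind scheme. -/
def primeOf (y : dedekindScheme k₀ K) : Ideal (InvX k₀ K) :=
  PrimeSpectrum.asIdeal (show PrimeSpectrum (InvX k₀ K) from y)

instance (y : dedekindScheme k₀ K) : (primeOf k₀ K y).IsPrime :=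
  PrimeSpectrum.isPrime (show PrimeSpectrum (InvX k₀ K) from y)

/-- The homomorphism from `A[x⁻¹]` to the local ring at a point. -/
def invXToStalk (y : dedekindScheme k₀ K) : InvX k₀ K →+* (dedekindScheme k₀ K).presheaf.stalk y :=
  (StructureSheaf.toStalk (InvX k₀ K) y).hom

theorem stalkHom_invXToStalk (y : dedekindScheme k₀ K) (b : InvX k₀ K) :
    stalkHom (dedekindFunctionField k₀ K) y (invXToStalk k₀ K y b) = b :=
  stalkHom_affineFunctionField (.of (InvX k₀ K)) K y b

theorem invXToStalk_mem_iff (y : dedekindScheme k₀ K) (b : InvX k₀ K) :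
    invXToStalk k₀ K y b ∈ IsLocalRing.maximalIdeal _ ↔ b ∈ primeOf k₀ K y := by
  let : Algebra (InvX k₀ K) ((dedekindScheme k₀ K).presheaf.stalk y) :=
    (invXToStalk k₀ K y).toAlgebra
  have : IsLocalization.AtPrime ((dedekindScheme k₀ K).presheaf.stalk y) (primeOf k₀ K y) :=
    StructureSheaf.IsLocalization.to_stalk (InvX k₀ K) y
  exact IsLocalization.AtPrime.to_map_mem_maximal_iff _ (primeOf k₀ K y) b

theorem exists_valuationSubring_stalk (y : dedekindScheme k₀ K) (hy : primeOf k₀ K y ≠ ⊥) :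
    ∃ W : ValuationSubring K, IsDiscreteValuationRing W ∧
      (∃ e : (dedekindScheme k₀ K).presheaf.stalk y ≃+* W,
        ∀ s, (e s : K) = stalkHom (dedekindFunctionField k₀ K) y s) ∧
      ∀ z : LaurentXY k₀, algebraMap _ K z ∈ W → ∃ a b : PowerSeriesXY k₀,
        xyToInvX k₀ K b ∉ primeOf k₀ K y ∧ z = algebraMap _ _ a / algebraMap _ _ b := by
  obtain ⟨f, hf0, hf, -⟩ := exists_comap_xyToInvX_eq_span k₀ K hy
  have hf' : ∀ x, xyToInvX k₀ K x ∈ primeOf k₀ K y ↔ f ∣ x := fun x => by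
    rw [← Ideal.mem_comap, hf, Ideal.mem_span_singleton]
  let : Algebra (PowerSeriesXY k₀) ((dedekindScheme k₀ K).presheaf.stalk y) :=
    ((invXToStalk k₀ K y).comp (xyToInvX k₀ K)).toAlgebra
  obtain ⟨W, h₁, h₂, h₃⟩ := exists_valuationSubring_eq_range (R := PowerSeriesXY k₀)
    (F := LaurentXY k₀) (stalkHom (dedekindFunctionField k₀ K) y) (stalkHom_injective _ y)
    (fun x => stalkHom_invXToStalk k₀ K y (xyToInvX k₀ K x))
    (fun z hz => ⟨invXToStalk k₀ K y (algebraMap (IntClosure k₀ K) (InvX k₀ K) ⟨z, hz⟩),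
      stalkHom_invXToStalk k₀ K y _⟩) hf0
    (fun x => (invXToStalk_mem_iff k₀ K y (xyToInvX k₀ K x)).trans (hf' x))
  refine ⟨W, h₁, ⟨RingEquiv.ofBijective
    ((stalkHom (dedekindFunctionField k₀ K) y).codRestrict W.toSubring fun s => (h₂ _).mpr ⟨s, rfl⟩)
    ⟨fun _ _ h => stalkHom_injective (dedekindFunctionField k₀ K) y
      (congrArg (Subtype.val : W → K) h), fun x => ?_⟩, fun _ => rfl⟩, fun z hz => ?_⟩
  · obtain ⟨s, hs⟩ := (h₂ _).mp x.2
    exact ⟨s, Subtype.ext hs⟩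
  obtain ⟨a, b, hb, h⟩ := h₃ z hz
  exact ⟨a, b, fun h => hb ((hf' b).mp h), h⟩

theorem isDiscreteValuationRing_stalk_dedekindScheme (y : dedekindScheme k₀ K)
    (hy : primeOf k₀ K y ≠ ⊥) :
    IsDiscreteValuationRing ((dedekindScheme k₀ K).presheaf.stalk y) := by
  obtain ⟨W, _, ⟨e, -⟩, -⟩ := exists_valuationSubring_stalk k₀ K y hy
  exact IsDiscreteValuationRing.RingEquivClass.isDiscreteValuationRing e.symm

variable {k₀ K} in
/-- The evaluation homomorphism defined by a rational point of the Dedekind scheme. -/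
def evalInvX {ℓ : Type u} [Field ℓ] [Algebra (LaurentSeries k₀) ℓ]
    (p : Points (dedekindSchemeHom k₀ K) ℓ) : InvX k₀ K →+* ℓ :=
  (Spec.preimage (S := .of ℓ) (R := .of (InvX k₀ K)) p.1).hom

section

variable {ℓ : Type u} [Field ℓ] [Algebra (LaurentSeries k₀) ℓ]
    (p : Points (dedekindSchemeHom k₀ K) ℓ)

theorem map_evalInvX : Spec.map (CommRingCat.ofHom (evalInvX p)) = p.1 :=
  Spec.map_preimage (S := .of ℓ) (R := .of (InvX k₀ K)) p.1

theorem evalInvX_laurentToInvX (x : LaurentSeries k₀) :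
    evalInvX p (laurentToInvX k₀ K x) = algebraMap _ ℓ x :=
  congr($(comp_preimage_of_comp_map_eq (R := .of (InvX k₀ K))
    (CommRingCat.ofHom (laurentToInvX k₀ K)) p.1 p.2) x)

theorem ker_evalInvX : RingHom.ker (evalInvX p) = primeOf k₀ K p.pt :=
  (asIdeal_apply_closedPoint (R := .of (InvX k₀ K)) p.1).symm

theorem evalInvX_tautPoint (y : dedekindScheme k₀ K) (b : InvX k₀ K) :
    evalInvX (ℓ := ResidueField (dedekindSchemeHom k₀ K) y)
      (tautPoint (dedekindSchemeHom k₀ K) y) b =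
        (dedekindScheme k₀ K).residue y (invXToStalk k₀ K y b) := by
  have h : @Eq (CommRingCat.of (InvX k₀ K) ⟶ .of (ResidueField (dedekindSchemeHom k₀ K) y))
      (CommRingCat.ofHom (evalInvX (tautPoint (dedekindSchemeHom k₀ K) y)))
      (StructureSheaf.toStalk (InvX k₀ K) y ≫ (dedekindScheme k₀ K).residue y) := by
    refine Spec.map_injective ((map_evalInvX k₀ K _).trans ?_)
    refine Eq.trans ?_ (Spec.map_comp _ _).symm
    exact congrArg (Spec.map ((dedekindScheme k₀ K).residue y) ≫ ·)
      (Spec.fromSpecStalk_eq' (.of (InvX k₀ K)) y)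
  exact congr($h b)

theorem xyToInvX_X_one_ne_zero : xyToInvX k₀ K (MvPowerSeries.X 1) ≠ 0 := fun h => by
  have h' : algebraMap (PowerSeriesXY k₀) K (MvPowerSeries.X 1) = 0 :=
    congrArg (Subtype.val : InvX k₀ K → K) h
  rw [map_eq_zero_iff _ (algebraMap_powerSeriesXY_injective k₀ K)] at h'
  have := congrArg (MvPowerSeries.coeff (Finsupp.single (1 : Fin 2) 1)) h'
  simp [MvPowerSeries.coeff_X] at this

/-- At the generic point, A[x⁻¹] would embed in an algebraic extension of k₀((x)) as a subalgebra
over k₀((x)), hence be a field, and `y` would be invertible. -/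
theorem primeOf_pt_ne_bot [Algebra.IsAlgebraic (LaurentSeries k₀) ℓ] :
    primeOf k₀ K p.pt ≠ ⊥ := by
  rw [← ker_evalInvX]
  intro h
  have hinj : Function.Injective (evalInvX p) := (injective_iff_map_eq_zero _).mpr fun b hb => by
    rwa [← RingHom.mem_ker, h, Ideal.mem_bot] at hb
  let : Algebra (LaurentSeries k₀) (InvX k₀ K) := (laurentToInvX k₀ K).toAlgebra
  let φ : InvX k₀ K →ₐ[LaurentSeries k₀] ℓ := ⟨evalInvX p, evalInvX_laurentToInvX k₀ K p⟩
  have h1 := φ.range.inv_mem_of_algebraic (x := ⟨evalInvX p (xyToInvX k₀ K (MvPowerSeries.X 1)), _, rfl⟩)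
    (Algebra.IsAlgebraic.isAlgebraic _)
  obtain ⟨b, hb⟩ : ∃ b, evalInvX p b = (evalInvX p (xyToInvX k₀ K (MvPowerSeries.X 1)))⁻¹ := h1
  refine not_isUnit_xyToInvX_X_one k₀ K (isUnit_iff_exists_inv.mpr ⟨b, hinj ?_⟩)
  rw [map_mul, map_one, hb, mul_inv_cancel₀]
  rw [ne_eq, map_eq_zero_iff _ hinj]
  exact xyToInvX_X_one_ne_zero k₀ K

end

theorem primeOf_ne_bot_of_isClosed {y : dedekindScheme k₀ K} (hy : IsClosed {y}) :
    primeOf k₀ K y ≠ ⊥ := by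
  have hmax : (primeOf k₀ K y).IsMaximal :=
    (PrimeSpectrum.isClosed_singleton_iff_isMaximal (R := InvX k₀ K) y).mp hy
  intro h
  rw [h] at hmax
  exact not_isUnit_xyToInvX_X_one k₀ K (isUnit_iff_exists_inv.mpr
    ((Ring.isField_iff_maximal_bot.mpr hmax).mul_inv_cancel (xyToInvX_X_one_ne_zero k₀ K)))

end DedekindScheme

end

/-! ### Finiteness of the residue fields over k₀((x)) -/

section

/-- The algebra generated by the image is the span of the image, because the image is closed under
products; being finite-dimensional inside a field, it is a field. -/
theorem exists_finite_intermediateField_of_forall_mem_span {k κ R : Type*} [Field k] [Field κ]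
    [Algebra k κ] [CommRing R] (ψ : R →+* κ) {ι : Type*} [Finite ι] (b : ι → κ)
    (h : ∀ x, ψ x ∈ Submodule.span k (Set.range b)) :
    ∃ κ₀ : IntermediateField k κ, FiniteDimensional k κ₀ ∧ ∀ x, ψ x ∈ κ₀ := by
  let A : Subalgebra k κ := Algebra.adjoin k (ψ.range : Set κ)
  have hA : Subalgebra.toSubmodule A ≤ Submodule.span k (Set.range b) := by
    rw [Algebra.adjoin_eq_span, ← Subring.coe_toSubmonoid, Submonoid.closure_eq, Submodule.span_le]
    rintro _ ⟨x, rfl⟩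
    exact h x
  have : FiniteDimensional k (Submodule.span k (Set.range b)) :=
    FiniteDimensional.span_of_finite k (Set.finite_range b)
  have hfin : FiniteDimensional k A := Submodule.finiteDimensional_of_le hA
  refine ⟨A.toIntermediateField fun x hx => A.inv_mem_of_algebraic (x := ⟨x, hx⟩)
    ((Algebra.IsAlgebraic.isAlgebraic (R := k) (⟨x, hx⟩ : A)).algebraMap (A := κ)), hfin, fun x => ?_⟩
  exact Algebra.subset_adjoin ⟨x, rfl⟩

variable (k₀ : Type u) [Field k₀] (K : Type u) [Field K] [Algebra (PowerSeriesXY k₀) K]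
  [Algebra (LaurentXY k₀) K] [IsScalarTower (PowerSeriesXY k₀) (LaurentXY k₀) K]
  [FiniteDimensional (LaurentXY k₀) K]

/-- The extension is split in two. The image of k₀[[x, y]] lies in a field `κ₀` finite over k₀((x)),
by Weierstrass division. The residue field is finite over `κ₀`, because elements of k₀((x, y))
integral at the point are fractions with invertible denominator and reduce into `κ₀`. -/
theorem finiteDimensional_residueField_dedekindScheme {y : dedekindScheme k₀ K}
    (hy : primeOf k₀ K y ≠ ⊥) :
    FiniteDimensional (LaurentSeries k₀) (ResidueField (dedekindSchemeHom k₀ K) y) := by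
  let p := tautPoint (dedekindSchemeHom k₀ K) y
  let ψ : PowerSeriesXY k₀ →+* ResidueField (dedekindSchemeHom k₀ K) y :=
    (evalInvX p).comp (xyToInvX k₀ K)
  have hψ : ∀ x, ψ x = 0 ↔ xyToInvX k₀ K x ∈ primeOf k₀ K y := fun x => by
    have h := ker_evalInvX k₀ K p
    rw [tautPoint_pt] at h
    rw [← h]
    exact RingHom.mem_ker.symm
  obtain ⟨f, -, -, d, hd⟩ := exists_comap_xyToInvX_eq_span k₀ K hy
  obtain ⟨κ₀, _, hκ₀⟩ := exists_finite_intermediateField_of_forall_mem_span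
    (k := LaurentSeries k₀) ψ (fun i : Fin d => ψ (MvPowerSeries.X 1) ^ (i : ℕ)) fun g => by
      obtain ⟨c, hc⟩ := hd g
      have hc0 := (hψ _).mpr hc
      rw [map_sub, sub_eq_zero] at hc0
      rw [hc0, map_sum]
      refine Submodule.sum_mem _ fun i _ => ?_
      have : ψ ((c i).toMvPowerSeries 0) = algebraMap (LaurentSeries k₀) _
          (algebraMap (PowerSeries k₀) (LaurentSeries k₀) (c i)) := by
        rw [← evalInvX_laurentToInvX k₀ K p, laurentToInvX_algebraMap]
        rfl
      rw [map_mul, map_pow, this, ← Algebra.smul_def]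
      exact Submodule.smul_mem _ _ (Submodule.subset_span ⟨i, rfl⟩)
  obtain ⟨W, -, ⟨e, he⟩, hW⟩ := exists_valuationSubring_stalk k₀ K y hy
  let r : W →+* ResidueField (dedekindSchemeHom k₀ K) y :=
    RingHom.comp ((dedekindScheme k₀ K).residue y).hom (e.symm : W →+* _)
  have hr : Function.Surjective r :=
    ((dedekindScheme k₀ K).residue_surjective y).comp e.symm.surjective
  have : FiniteDimensional κ₀ (ResidueField (dedekindSchemeHom k₀ K) y) := by
    refine finiteDimensional_of_residue (F := LaurentXY k₀) W r hr fun z hz => ?_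
    obtain ⟨a, b, hb, hab⟩ := hW z hz
    have hb0 : ψ b ≠ 0 := (hψ b).not.mpr hb
    have h1 : e.symm ⟨_, hz⟩ * invXToStalk k₀ K y (xyToInvX k₀ K b) =
        invXToStalk k₀ K y (xyToInvX k₀ K a) := by
      apply stalkHom_injective (dedekindFunctionField k₀ K) y
      rw [map_mul, ← he, RingEquiv.apply_symm_apply, stalkHom_invXToStalk, stalkHom_invXToStalk,
        coe_xyToInvX, coe_xyToInvX, IsScalarTower.algebraMap_apply _ (LaurentXY k₀) K b,
        IsScalarTower.algebraMap_apply _ (LaurentXY k₀) K a, ← map_mul, hab, div_mul_cancel₀]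
      rw [ne_eq, map_eq_zero_iff _ (IsFractionRing.injective (PowerSeriesXY k₀) (LaurentXY k₀))]
      rintro rfl
      exact hb0 (map_zero ψ)
    have h2 : r ⟨_, hz⟩ * ψ b = ψ a := by
      have := congrArg ((dedekindScheme k₀ K).residue y) h1
      rw [map_mul] at this
      change r _ * _ = _ at this
      rw [← evalInvX_tautPoint, ← evalInvX_tautPoint] at this
      exact this
    refine ⟨⟨r ⟨_, hz⟩, ?_⟩, rfl⟩
    rw [← mul_div_cancel_right₀ (r ⟨_, hz⟩) hb0, h2]
    exact div_mem (hκ₀ a) (hκ₀ b)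
  exact FiniteDimensional.trans (LaurentSeries k₀) κ₀ _

end

end Reocurrence

end

theorem mainTheorem3 :
    -- (a) function fields of curves over a henselian valued field
    (∀ (k : Type u) [Field k] (Γ₀ : Type v) [LinearOrderedCommGroupWithZero Γ₀] [Valued k Γ₀]
      [HenselianLocalRing (Valued.v : Valuation k Γ₀).valuationSubring]
      (C : Scheme.{u}) [IsIntegral C] (π : C ⟶ Spec (.of k)) [IsProper π]
      [SmoothOfRelativeDimension 1 π]
      (K : Type u) [Field K] (e : C.functionField ≃+* K),
      Reocurrence.EnoughAutomorphisms (Field.absoluteGaloisGroup k) →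
      ∀ (L : Type w) [Field L] [Algebra K L] [FiniteDimensional K L] [IsGalois K L]
        (v : C), IsClosed {v} → Reocurrence.IsUnramifiedIn (Reocurrence.place e v) L →
        Reocurrence.ReocursAt π e L v) ∧
    -- (b) finite extensions of the fraction field of a ring of power series in two variables
    (∀ (k₀ : Type u) [Field k₀] [PerfectField k₀]
      (K : Type u) [Field K] [Algebra (Reocurrence.PowerSeriesXY k₀) K]
      [Algebra (Reocurrence.LaurentXY k₀) K]
      [IsScalarTower (Reocurrence.PowerSeriesXY k₀) (Reocurrence.LaurentXY k₀) K]
      [FiniteDimensional (Reocurrence.LaurentXY k₀) K],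
      Reocurrence.EnoughAutomorphisms
        (Field.absoluteGaloisGroup k₀ × Multiplicative Reocurrence.ZHat) →
      ∀ (L : Type w) [Field L] [Algebra K L] [FiniteDimensional K L] [IsGalois K L]
        (v : Reocurrence.dedekindScheme k₀ K), IsClosed {v} →
        Reocurrence.IsUnramifiedIn
          (Reocurrence.place (Reocurrence.dedekindFunctionField k₀ K) v) L →
        Reocurrence.ReocursAt (Reocurrence.dedekindSchemeHom k₀ K)
          (Reocurrence.dedekindFunctionField k₀ K) L v) := by
  refine ⟨?_, ?_⟩
  · intro k _ Γ₀ _ _ _ C _ π _ _ K _ e _ L _ _ _ _ v hv hunr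
    have := Reocurrence.finiteDimensional_residueField_of_isClosed π hv
    exact Reocurrence.reocursAt_of_isDiscreteValuationRing π e L v
      (fun w => Reocurrence.isDiscreteValuationRing_stalk_of_smooth π w) hunr
  · intro k₀ _ _ K _ _ _ _ _ _ L _ _ _ _ v hv hunr
    have := Reocurrence.finiteDimensional_residueField_dedekindScheme k₀ K
      (Reocurrence.primeOf_ne_bot_of_isClosed k₀ K hv)
    exact Reocurrence.reocursAt_of_isDiscreteValuationRing _ _ L v
      (fun w => Reocurrence.isDiscreteValuationRing_stalk_dedekindScheme k₀ K w.pt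
        (Reocurrence.primeOf_pt_ne_bot k₀ K w)) hunr
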